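/- **Setting.** Let $\mathcal N$ be a finite set of $n$ elements, $f:2^{\mathcal N}\to\mathbb R_{\ge 0}$ a non-negative submodular function (not necessarily monotone), $B>0$ a budget, and $c$ an additive cost function with $0<c(x)\le B$ for every $x\in\mathcal N$. Write $f(x\,|\,T)=f(T\cup\{x\})-f(T)$, $f(x)=f(\{x\})$ and $OPT=\max\{f(T):T\subseteq\mathcal N,\ c(T)\le B\}$. The function $f$ is accessed only through value queries. In one adaptive round an algorithm makes any finite number of queries that depend only on its random draws and on the answers of earlier rounds; procedures run in parallel share their rounds. Logarithms are natural. Let $\textsc{SubmodMax}(X,\delta)$ be a procedure with value queries, with its own independent randomness, that for $X\subseteq\mathcal N$ and $\delta\in(0,1)$ outputs a (random) set $S_-\subseteq X$ with $\max_{T\subseteq X}f(T)\le(2+\delta)\,\mathbb E[f(S_-)]$ and always uses at most $R(\delta)$ adaptive rounds and at most $Q(\delta)\,n$ queries, where $R,Q$ are given functions of the precision only. **$\textsc{SampleSeq}(S,X,B)$.** Start with the empty sequence $A$. While $X\ne\emptyset$: draw $a$ uniformly at random from $X$, append it to $A$, and replace $X$ by $\{x\in X\setminus\{a\}: c(x)+c(A)+c(S)\le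 B\}$. Return $A=[a_1,\dots,a_d]$. **$\textsc{ThreshSeq}(X,\tau,\delta,\ell,B)$.** Start with $S=\emptyset$, $\mathrm{ctr}=0$ and replace $X$ by $\{x\in X:f(x)\ge\tau c(x)\}$. While $X\neq\emptyset$ and $\mathrm{ctr}<\ell$: let $[a_1,\dots,a_d]=\textsc{SampleSeq}(S,X,B)$ and, for $1\le i\le d$, put $A_i=\{a_1,\dots,a_i\}$, $X_i=\{a\in X\setminus A_i:c(a)+c(S\cup A_i)\le B\}$, $G_i=\{a\in X_i:f(a\,|\,S\cup A_i)\ge\tau c(a)\}$, $E_i=\{a\in X_i:f(a\,|\,S\cup A_i)<0\}$ (the values needed are queried in one adaptive round); let $i^*=\min\{i:c(G_i)\le(1-\delta)c(X)\}$, $j^*=\min\{j:\sum_{x\in G_j}\delta f(x\,|\,S\cup A_j)\le\sum_{x\in E_j}|f(x\,|\,S\cup A_j)|\}$ and $k^*=\min\{i^*,j^*\}$; replace $S$ by $S\cup A_{k^*}$ and $X$ by $G_{k^*}$, and increase $\mathrm{ctr}$ by $1$ if $j^*<i^*$. Return $S$. **$\textsc{ParKnapsack}(\mathcal N,f,\varepsilon,\alpha,p,B)$.**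 Let $\mathcal N_-=\{x\in\mathcal N:c(x)<B/n\}$ and $\mathcal N_+=\mathcal N\setminus\mathcal N_-$. Put $\hat\varepsilon=\varepsilon/125$, $\ell=\hat\varepsilon^{-2}$, $k=\lceil\hat\varepsilon^{-1}\log n\rceil$, $r=\lceil\hat\varepsilon^{-1}\log(\hat\varepsilon^{-1})\rceil$. Compute $S_-=\textsc{SubmodMax}(\mathcal N_-,\hat\varepsilon)$; if $\mathcal N_+=\emptyset$, return $S_-$. Otherwise let $x^*\in\mathcal N_+$ maximize $f(x)$ and put $\hat\tau=\alpha n f(x^*)/B$. Sample each element of $\mathcal N_+$ independently with probability $p$ to obtain $H$. For all $0\le i\le k$ and $1\le j\le r$, in parallel and with independent randomness, let $S^i_j=\textsc{ThreshSeq}(H,\hat\tau(1-\hat\varepsilon)^i,\hat\varepsilon,\ell,B)$. Return a set of maximum value among all the $S^i_j$, $\{x^*\}$ and $S_-$. **Theorem.** Let $\alpha=2-\sqrt3$, $p=\frac{1-\alpha}2$ and $0<\varepsilon<\frac13$. Then the set $T$ returned by $\textsc{ParKnapsack}$ always satisfies $c(T)\le B$, and $$OPT\le(9.465+\varepsilon)\,\mathbb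 E[f(T)].$$ For fixed $\varepsilon$ and $n\to\infty$, $\textsc{ParKnapsack}$ uses $O\!\left(\frac1\varepsilon\log n\right)$ adaptive rounds and $O\!\left(\frac{n^2}{\varepsilon^3}\log^2n\,\log\frac1\varepsilon\right)$ value queries, with absolute implied constants: there is an absolute constant $C>0$ such that for all functions $R,Q$ and every $\varepsilon\in(0,\frac13)$ there is $n_0$ such that for all $n\ge n_0$ and all instances as above, every run uses at most $\frac C\varepsilon\log n$ adaptive rounds and at most $C\frac{n^2}{\varepsilon^3}\log^2n\,\log\frac1\varepsilon$ queries. Moreover, with the same $C$, for all $n\ge2$ and all $\varepsilon\in(0,\frac13)$ every run uses at most $C\left(\frac1\varepsilon\log n+\frac1{\varepsilon^2}\right)+R(\varepsilon/125)$ adaptive rounds and at most $C\,\frac{n^2}{\varepsilon^2}\log n\,\log\frac1\varepsilon\left(\frac1\varepsilon\log n+\frac1{\varepsilon^2}\right)+Q(\varepsilon/125)\,n$ queries. -/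

import Mathlib

noncomputable section

/-! ## Set functions -/

/-- Marginal value `f(x | T) = f(T ∪ {x}) - f(T)`. -/
def marginal {V : Type} [DecidableEq V] (f : Finset V → ℝ) (x : V) (T : Finset V) : ℝ :=
  f (insert x T) - f T

/-- Submodularity: marginal values are non-increasing. -/
def IsSubmodular {V : Type} [DecidableEq V] (f : Finset V → ℝ) : Prop :=
  ∀ S T : Finset V, S ⊆ T → ∀ x, x ∉ T → marginal f x T ≤ marginal f x S

/-- The additive extension to sets of the costs of the elements. -/
def setCost {V : Type} (c : V → ℝ) (T : Finset V) : ℝ := ∑ x ∈ T, c x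

/-! ## Randomized algorithms with access to a value oracle

A program never sees the objective function. It can only `ask` for the values of a finite family
of sets; all the queries of one `ask` are made at once, and this is one adaptive round. Later
rounds may depend on these answers (through `bind`). -/

/-- Randomized value-query programs over the ground set `V` with output type `α`. -/
inductive Prog (V : Type) : Type → Type 1
  /-- return a value -/
  | ret {α : Type} (a : α) : Prog V α
  /-- run `p`, then run a continuation that depends on the output of `p` -/
  | bind {α β : Type} (p : Prog V α) (k : α → Prog V β) : Prog V β
  /-- draw a random value, independently of all previous draws; no oracle access -/
  | draw {α : Type} (μ : PMF α) : Prog V α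
  /-- one adaptive round that queries the sets in `Q`. The answer is the table of the values of
  the queried sets, filled up with `0` outside of `Q` -/
  | ask (Q : Finset (Finset V)) : Prog V (Finset V → ℝ)
  /-- run two programs in parallel, with independent randomness -/
  | par {α β : Type} (p : Prog V α) (q : Prog V β) : Prog V (α × β)

/-- The result of one run: the output, the number of adaptive rounds, the number of queries. -/
structure Outcome (α : Type) where
  out : α
  rounds : ℕ
  queries : ℕ

namespace Prog

variable {V : Type} [DecidableEq V]

/-- The joint law of output, rounds and queries when the oracle answers with `f`. In sequence,
rounds and queries add up; in parallel, queries add up and rounds are shared. -/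
def run (f : Finset V → ℝ) : {α : Type} → Prog V α → PMF (Outcome α)
  | _, .ret a => PMF.pure ⟨a, 0, 0⟩
  | _, .bind p k =>
      (run f p).bind fun o₁ => (run f (k o₁.out)).bind fun o₂ =>
        PMF.pure ⟨o₂.out, o₁.rounds + o₂.rounds, o₁.queries + o₂.queries⟩
  | _, .draw μ => μ.bind fun a => PMF.pure ⟨a, 0, 0⟩
  | _, .ask Q => PMF.pure ⟨fun S => if S ∈ Q then f S else 0, 1, Q.card⟩
  | _, .par p q =>
      (run f p).bind fun o₁ => (run f q).bind fun o₂ =>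
        PMF.pure ⟨(o₁.out, o₂.out), max o₁.rounds o₂.rounds, o₁.queries + o₂.queries⟩

/-- Run a list of programs in parallel. -/
def parAll {α : Type} : List (Prog V α) → Prog V (List α)
  | [] => .ret []
  | p :: ps => .bind (.par p (parAll ps)) fun r => .ret (r.1 :: r.2)

/-- Every run, whatever the random draws, takes at most `r` adaptive rounds. -/
def RoundsLE {α : Type} (P : Prog V α) (f : Finset V → ℝ) (r : ℝ) : Prop :=
  ∀ o ∈ (P.run f).support, (o.rounds : ℝ) ≤ r

/-- Every run, whatever the random draws, makes at most `q` value queries in total. -/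
def QueriesLE {α : Type} (P : Prog V α) (f : Finset V → ℝ) (q : ℝ) : Prop :=
  ∀ o ∈ (P.run f).support, (o.queries : ℝ) ≤ q

/-- The expected value `E[f(S)]` of the random set `S` output by `P`. -/
def expectedValue [Fintype V] (P : Prog V (Finset V)) (f : Finset V → ℝ) : ℝ :=
  ∑ S : Finset V, ((P.run f).map Outcome.out S).toReal * f S

end Prog

/-! ## The unconstrained maximization oracle -/

/-- On the objective `f`, the procedure `sub` is a `(2 + δ)`-approximation (in expectation) for
maximizing `f` over the subsets of a given set `X`, for every precision `δ ∈ (0, 1)`, with at most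
`R δ` adaptive rounds and at most `Q δ * n` queries. -/
def IsSubmodMax {V : Type} [Fintype V] [DecidableEq V] (f : Finset V → ℝ)
    (sub : ℝ → Finset V → Prog V (Finset V)) (R Q : ℝ → ℝ) : Prop :=
  ∀ δ : ℝ, 0 < δ → δ < 1 → ∀ X : Finset V,
    (∀ o ∈ ((sub δ X).run f).support, o.out ⊆ X) ∧
    (∀ T ⊆ X, f T ≤ (2 + δ) * (sub δ X).expectedValue f) ∧
    (sub δ X).RoundsLE f (R δ) ∧
    (sub δ X).QueriesLE f (Q δ * (Fintype.card V : ℝ))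

/-! ## The algorithm -/

section Algorithm

variable {V : Type} [DecidableEq V]

/-- The elements of `X` outside of `T` that still fit into the budget together with `S ∪ T`. -/
def fitting (c : V → ℝ) (B : ℝ) (S X T : Finset V) : Finset V :=
  (X \ T).filter fun a => c a + setCost c (S ∪ T) ≤ B

/-- `SampleSeq`: draw the elements `a₁, a₂, …` one after the other, uniformly at random among the
elements left in `X`; after each draw keep only the elements that still fit. `A` is the sequence
drawn so far. The first argument bounds the number of draws; each draw removes an element of `X`,
so that `X.card` is enough for the loop to run until `X` is empty. -/
def sampleSeqAux (c : V → ℝ) (B : ℝ) (S : Finset V) : ℕ → List V → Finset V → PMF (List V)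
  | 0, A, _ => PMF.pure A
  | m + 1, A, X =>
      if h : X.Nonempty then
        (PMF.uniformOfFinset X h).bind fun a =>
          sampleSeqAux c B S m (A ++ [a])
            ((X.erase a).filter fun x => c x + setCost c (A ++ [a]).toFinset + setCost c S ≤ B)
      else PMF.pure A

def sampleSeq (c : V → ℝ) (B : ℝ) (S X : Finset V) : PMF (List V) :=
  sampleSeqAux c B S X.card [] X

/-- The prefix `{a₁, …, aᵢ}` of a sequence. -/
def prefixSet (A : List V) (i : ℕ) : Finset V := (A.take i).toFinset

/-- The set `Xᵢ`. -/
def restSet (c : V → ℝ) (B : ℝ) (S X : Finset V) (A : List V) (i : ℕ) : Finset V :=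
  fitting c B S X (prefixSet A i)

/-- The set `Gᵢ`, computed from a table `g` of oracle answers. -/
def goodSet (g : Finset V → ℝ) (c : V → ℝ) (B τ : ℝ) (S X : Finset V) (A : List V) (i : ℕ) :
    Finset V :=
  (restSet c B S X A i).filter fun a => τ * c a ≤ marginal g a (S ∪ prefixSet A i)

/-- The set `Eᵢ`, computed from a table `g` of oracle answers. -/
def negSet (g : Finset V → ℝ) (c : V → ℝ) (B : ℝ) (S X : Finset V) (A : List V) (i : ℕ) :
    Finset V :=
  (restSet c B S X A i).filter fun a => marginal g a (S ∪ prefixSet A i) < 0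

/-- The index `i*` of the cost condition (a minimum of a nonempty set of indices). -/
def costIndex (g : Finset V → ℝ) (c : V → ℝ) (B τ δ : ℝ) (S X : Finset V) (A : List V) : ℕ :=
  sInf {i : ℕ | 1 ≤ i ∧ i ≤ A.length ∧
    setCost c (goodSet g c B τ S X A i) ≤ (1 - δ) * setCost c X}

/-- The index `j*` of the value condition (a minimum of a nonempty set of indices). -/
def valueIndex (g : Finset V → ℝ) (c : V → ℝ) (B τ δ : ℝ) (S X : Finset V) (A : List V) : ℕ :=
  sInf {j : ℕ | 1 ≤ j ∧ j ≤ A.length ∧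
    ∑ x ∈ goodSet g c B τ S X A j, δ * marginal g x (S ∪ prefixSet A j) ≤
      ∑ x ∈ negSet g c B S X A j, |marginal g x (S ∪ prefixSet A j)|}

/-- The sets whose values determine `Gᵢ`, `Eᵢ`, `i*` and `j*` for all prefixes of `A`. -/
def prefixQueries (c : V → ℝ) (B : ℝ) (S X : Finset V) (A : List V) : Finset (Finset V) :=
  (Finset.Icc 1 A.length).biUnion fun i =>
    insert (S ∪ prefixSet A i)
      ((restSet c B S X A i).image fun a => insert a (S ∪ prefixSet A i))

/-- The while loop of `ThreshSeq`, with the state `S`, `X`, `ctr`. Every iteration is one adaptive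
round. The first argument bounds the number of iterations; each iteration removes an element of
`X`, so that the cardinality of the initial `X` is enough. -/
def threshLoop (c : V → ℝ) (B τ δ ℓ : ℝ) :
    ℕ → Finset V → Finset V → ℕ → Prog V (Finset V)
  | 0, S, _, _ => .ret S
  | m + 1, S, X, ctr =>
      if X.Nonempty ∧ (ctr : ℝ) < ℓ then
        .bind (.draw (sampleSeq c B S X)) fun A =>
        .bind (.ask (prefixQueries c B S X A)) fun g =>
          threshLoop c B τ δ ℓ m
            (S ∪ prefixSet A (min (costIndex g c B τ δ S X A) (valueIndex g c B τ δ S X A)))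
            (goodSet g c B τ S X A
              (min (costIndex g c B τ δ S X A) (valueIndex g c B τ δ S X A)))
            (if valueIndex g c B τ δ S X A < costIndex g c B τ δ S X A then ctr + 1 else ctr)
      else .ret S

/-- `ThreshSeq(X, τ, δ, ℓ, B)`. -/
def threshSeq (c : V → ℝ) (X : Finset V) (τ δ ℓ B : ℝ) : Prog V (Finset V) :=
  .bind (.ask (X.image fun x => {x})) fun g =>
    threshLoop c B τ δ ℓ (X.filter fun x => τ * c x ≤ g {x}).card ∅
      (X.filter fun x => τ * c x ≤ g {x}) 0

/-- A coin that shows `true` with probability `p ∈ [0, 1]` and `false` with probability `1 - p`. -/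
def coin (p : ℝ) : PMF Bool :=
  PMF.ofFintype
    (fun b => if b then min (ENNReal.ofReal p) 1 else 1 - min (ENNReal.ofReal p) 1)
    (by simp [add_tsub_cancel_of_le])

/-- Sample each element of a list independently with probability `p`. -/
def sampleList (p : ℝ) : List V → PMF (Finset V)
  | [] => PMF.pure ∅
  | x :: l => (coin p).bind fun b => (sampleList p l).bind fun H =>
      PMF.pure (if b then insert x H else H)

/-- Sample each element of a set independently with probability `p`. -/
def sampleSubset (p : ℝ) (X : Finset V) : PMF (Finset V) := sampleList p X.toList

/-- An element of the nonempty set `s` that maximizes `g`. -/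
def maximizer {β : Type} (g : β → ℝ) (s : Finset β) (h : s.Nonempty) : β :=
  (s.exists_max_image g h).choose

/-- The set of small elements. -/
def smallSet [Fintype V] (c : V → ℝ) (B : ℝ) : Finset V :=
  Finset.univ.filter fun x => c x < B / (Fintype.card V : ℝ)

/-- The set of large elements. -/
def largeSet [Fintype V] (c : V → ℝ) (B : ℝ) : Finset V :=
  Finset.univ \ smallSet c B

/-- The parallel runs of `ThreshSeq` on `H`: for every `0 ≤ i ≤ k`, a number `r` of independent
runs with the threshold `τ₀ * (1 - δ) ^ i`. -/
def threshRuns (c : V → ℝ) (B τ₀ δ ℓ : ℝ) (k r : ℕ) (H : Finset V) : Prog V (List (Finset V)) :=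
  .parAll ((List.range (k + 1)).flatMap fun i =>
    List.replicate r (threshSeq c H (τ₀ * (1 - δ) ^ i) δ ℓ B))

/-- Query all the candidates and return one of maximum value. -/
def bestOf (s : Finset (Finset V)) (h : s.Nonempty) : Prog V (Finset V) :=
  .bind (.ask s) fun g => .ret (maximizer g s h)

/-- `ParKnapsack`, with the subroutine `sub` for unconstrained maximization. If there are no large
elements, then the output of `sub` is the only candidate. -/
def parKnapsack [Fintype V] (sub : ℝ → Finset V → Prog V (Finset V)) (c : V → ℝ)
    (ε α p B : ℝ) : Prog V (Finset V) :=
  let n : ℝ := Fintype.card V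
  let δ : ℝ := ε / 125
  let ℓ : ℝ := (δ ^ 2)⁻¹
  let k : ℕ := ⌈δ⁻¹ * Real.log n⌉₊
  let r : ℕ := ⌈δ⁻¹ * Real.log δ⁻¹⌉₊
  .bind (sub δ (smallSet c B)) fun Sm =>
    if h : (largeSet c B).Nonempty then
      .bind (.ask ((largeSet c B).image fun x => {x})) fun g =>
        let x := maximizer (fun y => g {y}) (largeSet c B) h
        let τ₀ : ℝ := α * n * (g {x} / B)
        .bind (.draw (sampleSubset p (largeSet c B))) fun H =>
        .bind (threshRuns c B τ₀ δ ℓ k r H) fun L =>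
          bestOf (insert {x} (insert Sm L.toFinset)) (Finset.insert_nonempty _ _)
    else .ret Sm

end Algorithm

end

/-! Let `S_-` be the set found among the small elements, `O` the large part of an optimal set, and
`a(H)` the expected value of the returned set given `S_-` and the sample `H`. Up to factors `1 +
O(ε̂)`, the core inequality is `f(O) + 2 max(f(x*), f(S_-)) ≤ (6 + 2√3) E_H[a(H)]`
(`le_bernSum_sample`). Since `S_-` is a `(2 + ε̂)`-approximation on the small elements and `f` is
subadditive across the two parts, averaging over `S_-` bounds `OPT`, and `6 + 2√3 < 9.4642`.

For a fixed sample, `ThreshSeq` provides two facts. Until a sequence is cut, a uniformly drawn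
element gains on average at least `(1-δ)²τ` per unit of cost, so `f - (1-δ)²τ c` is a submartingale
along the loop (`potential_le_pexp_threshLoop`). At the end either `X` is empty or the counter has
reached `δ⁻²`; in the latter case the discarded elements with negative marginals, together with `f ≥
0`, force what is left in `X` to be worth at most `δ f(S)` (`threshSeq_union_le`). With Markov's
inequality for the cost, the `r` repetitions and the right threshold on the grid, this yields a
dichotomy for every `κ` (`threshRuns_capped_or_saturated`): up to powers of `1-δ`, either `a(H) ≥
α(1-κ) n f(x*)`, or some `S ⊆ H` has `f(S ∪ K) ≤ a(H)(1 + c(K)/((1-κ)B))` for all `K ⊆ H` whose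
elements cost at most `κB`.

To average over `H`, fix `K = H ∩ O'` for a suitable `O' ⊆ O`. The set `S ∖ K` depends on the rest
of the sample and contains no element with probability above `p`, so `E f(S ∪ K) ≥ (1-p) f(K)`
(`le_bernSum_of_subset`). This turns the dichotomy into certified lower bounds that depend only on
the value and the cost of `K` (`le_bernSum_of_capped_or_saturated`). On `O` the function `f`
dominates an additive function, and the certified bound dominates a concave quadratic in a single
additive weight of `K`; its expectation needs only a mean and a variance
(`Minorant.Valid.lower_bound`). The quadratic depends on the density `θ = f(O)/(n f(x*))` and on `w
= max(f(x*), f(S_-))/f(O)`. A finite table of quadratics, checked numerically, covers `θ ≤ 1`, `w ≤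
0.134`; for larger `w` the core inequality is immediate from `a(H) ≥ w f(O)`.

For the adaptivity, an iteration of the loop either shrinks `c(X)` by the factor `1-δ` or increments
the counter. Large elements cost between `B/n` and `B`, so `O(δ⁻¹ log n)` iterations of the first
kind and `⌈ℓ⌉` of the second suffice. -/

noncomputable section

/-! ## Expectations with respect to a probability mass function -/

/-- The expectation of a real function. -/
def pexp {α : Type*} (μ : PMF α) (g : α → ℝ) : ℝ := ∑' a, (μ a).toReal * g a

/-- Boundedness of a real function. -/
def IsBdd {α : Type*} (g : α → ℝ) : Prop := ∃ C : ℝ, ∀ a, |g a| ≤ C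

theorem IsBdd.of_finite {α : Type*} [Finite α] (g : α → ℝ) : IsBdd g := by
  have := Fintype.ofFinite α
  exact ⟨∑ b, |g b|, fun a => Finset.single_le_sum (f := fun b => |g b|)
    (fun _ _ => abs_nonneg _) (Finset.mem_univ a)⟩

theorem IsBdd.comp {α β : Type*} {g : β → ℝ} (hg : IsBdd g) (k : α → β) :
    IsBdd fun a => g (k a) := by
  obtain ⟨C, hC⟩ := hg
  exact ⟨C, fun a => hC _⟩

theorem IsBdd.of_comp_finite {α β : Type*} [Finite β] (g : β → ℝ) (k : α → β) :
    IsBdd fun a => g (k a) := (IsBdd.of_finite g).comp k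

theorem isBdd_const {α : Type*} (c : ℝ) : IsBdd fun _ : α => c := ⟨|c|, fun _ => le_rfl⟩

theorem IsBdd.const_mul {α : Type*} {g : α → ℝ} (hg : IsBdd g) (c : ℝ) :
    IsBdd fun a => c * g a := by
  obtain ⟨C, hC⟩ := hg
  exact ⟨|c| * C, fun a => by
    rw [abs_mul]; exact mul_le_mul_of_nonneg_left (hC a) (abs_nonneg _)⟩

theorem PMF.summable_toReal {α : Type*} (μ : PMF α) : Summable fun a => (μ a).toReal :=
  ENNReal.summable_toReal μ.tsum_coe_ne_top

theorem PMF.tsum_toReal {α : Type*} (μ : PMF α) : ∑' a, (μ a).toReal = 1 := by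
  rw [← ENNReal.tsum_toReal_eq fun a => μ.apply_ne_top a, μ.tsum_coe, ENNReal.toReal_one]

theorem summable_pexp {α : Type*} (μ : PMF α) {g : α → ℝ} (hg : IsBdd g) :
    Summable fun a => (μ a).toReal * g a := by
  obtain ⟨C, hC⟩ := hg
  refine Summable.of_norm_bounded (g := fun a => (μ a).toReal * C) (μ.summable_toReal.mul_right C)
    fun a => ?_
  rw [norm_mul, Real.norm_of_nonneg ENNReal.toReal_nonneg]
  exact mul_le_mul_of_nonneg_left (hC a) ENNReal.toReal_nonneg

theorem pexp_fintype {α : Type*} [Fintype α] (μ : PMF α) (g : α → ℝ) :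
    pexp μ g = ∑ a, (μ a).toReal * g a := tsum_fintype _

theorem pexp_const {α : Type*} (μ : PMF α) (c : ℝ) : pexp μ (fun _ => c) = c := by
  rw [pexp, tsum_mul_right, μ.tsum_toReal, one_mul]

theorem pexp_pure {α : Type*} (a : α) (g : α → ℝ) : pexp (PMF.pure a) g = g a := by
  rw [pexp, tsum_eq_single a]
  · simp
  · intro b hb
    simp [hb]

theorem pexp_mono {α : Type*} {μ : PMF α} {g h : α → ℝ} (hg : IsBdd g) (hh : IsBdd h)
    (H : ∀ a ∈ μ.support, g a ≤ h a) : pexp μ g ≤ pexp μ h := by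
  refine (summable_pexp μ hg).tsum_le_tsum (fun a => ?_) (summable_pexp μ hh)
  by_cases ha : a ∈ μ.support
  · exact mul_le_mul_of_nonneg_left (H a ha) ENNReal.toReal_nonneg
  · simp [(PMF.apply_eq_zero_iff μ a).2 ha]

theorem pexp_congr {α : Type*} {μ : PMF α} {g h : α → ℝ} (H : ∀ a ∈ μ.support, g a = h a) :
    pexp μ g = pexp μ h := by
  refine tsum_congr fun a => ?_
  by_cases ha : a ∈ μ.support
  · rw [H a ha]
  · simp [(PMF.apply_eq_zero_iff μ a).2 ha]

theorem pexp_add {α : Type*} (μ : PMF α) {g h : α → ℝ} (hg : IsBdd g) (hh : IsBdd h) :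
    pexp μ (fun a => g a + h a) = pexp μ g + pexp μ h := by
  simp only [pexp, mul_add]
  exact (summable_pexp μ hg).tsum_add (summable_pexp μ hh)

theorem pexp_const_mul {α : Type*} (μ : PMF α) (c : ℝ) (g : α → ℝ) :
    pexp μ (fun a => c * g a) = c * pexp μ g := by
  simp only [pexp, mul_left_comm _ c, tsum_mul_left]

theorem le_pexp {α : Type*} {μ : PMF α} {g : α → ℝ} (hg : IsBdd g) {c : ℝ}
    (H : ∀ a ∈ μ.support, c ≤ g a) : c ≤ pexp μ g := by
  rw [← pexp_const μ c]
  exact pexp_mono (isBdd_const c) hg H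

theorem pexp_le {α : Type*} {μ : PMF α} {g : α → ℝ} (hg : IsBdd g) {c : ℝ}
    (H : ∀ a ∈ μ.support, g a ≤ c) : pexp μ g ≤ c := by
  rw [← pexp_const μ c]
  exact pexp_mono hg (isBdd_const c) H

theorem IsBdd.pexp {α β : Type*} {g : β → ℝ} (hg : IsBdd g) (k : α → PMF β) :
    IsBdd fun a => pexp (k a) g := by
  obtain ⟨C, hC⟩ := hg
  refine ⟨C, fun a => abs_le.2 ⟨?_, ?_⟩⟩
  · exact le_pexp ⟨C, hC⟩ fun b _ => (abs_le.1 (hC b)).1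
  · exact pexp_le ⟨C, hC⟩ fun b _ => (abs_le.1 (hC b)).2

/-- Fubini: all weights have total mass one, so a bound of `g` dominates the double series.
Boundedness is carried around because lists and oracle tables range over infinite types. -/
theorem pexp_bind {α β : Type*} (μ : PMF α) (k : α → PMF β) {g : β → ℝ} (hg : IsBdd g) :
    pexp (μ.bind k) g = pexp μ fun a => pexp (k a) g := by
  have h1 : ∀ b, ((μ.bind k) b).toReal * g b = ∑' a, (μ a).toReal * ((k a b).toReal * g b) := by
    intro b
    rw [PMF.bind_apply, ENNReal.tsum_toReal_eq, ← tsum_mul_right]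
    · simp [ENNReal.toReal_mul, mul_assoc]
    · intro a
      exact ENNReal.mul_ne_top (μ.apply_ne_top a) ((k a).apply_ne_top b)
  have hs : Summable (Function.uncurry fun (a : α) (b : β) =>
      (μ a).toReal * ((k a b).toReal * g b)) := by
    obtain ⟨C, hC⟩ := hg
    have hC0 : ∀ b, ‖g b‖ ≤ C := hC
    have h2 : Summable (Function.uncurry fun (a : α) (b : β) =>
        (μ a).toReal * ((k a b).toReal * C)) := by
      by_cases hb : Nonempty β
      · have hCn : 0 ≤ C := (abs_nonneg _).trans (hC hb.some)
        have h3 : ∀ a, Summable fun b => (μ a).toReal * ((k a b).toReal * C) := fun a =>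
          ((k a).summable_toReal.mul_right C).mul_left (μ a).toReal
        have h4 : ∀ a, ∑' b, (μ a).toReal * ((k a b).toReal * C) = (μ a).toReal * C := fun a => by
          rw [tsum_mul_left, tsum_mul_right, PMF.tsum_toReal, one_mul]
        have h5 : Summable fun a => ∑' b, (μ a).toReal * ((k a b).toReal * C) := by
          simp only [h4]
          exact μ.summable_toReal.mul_right C
        refine (summable_prod_of_nonneg ?_).2 ⟨h3, h5⟩
        intro x
        exact mul_nonneg ENNReal.toReal_nonneg (mul_nonneg ENNReal.toReal_nonneg hCn)
      · have : IsEmpty β := not_nonempty_iff.1 hb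
        exact summable_of_hasFiniteSupport (Set.toFinite _)
    refine Summable.of_norm_bounded h2 ?_
    rintro ⟨a, b⟩
    simp only [Function.uncurry_apply_pair, norm_mul, Real.norm_of_nonneg ENNReal.toReal_nonneg]
    exact mul_le_mul_of_nonneg_left (mul_le_mul_of_nonneg_left (hC0 b) ENNReal.toReal_nonneg)
      ENNReal.toReal_nonneg
  unfold pexp
  simp only [h1]
  rw [hs.tsum_comm]
  simp only [tsum_mul_left]

theorem pexp_uniformOfFinset {α : Type*} (s : Finset α) (hs : s.Nonempty) (g : α → ℝ) :
    pexp (PMF.uniformOfFinset s hs) g = (s.card : ℝ)⁻¹ * ∑ a ∈ s, g a := by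
  rw [pexp, tsum_eq_sum (s := s), Finset.mul_sum]
  · refine Finset.sum_congr rfl fun a ha => ?_
    rw [PMF.uniformOfFinset_apply_of_mem hs ha]
    simp
  · intro a ha
    simp [PMF.uniformOfFinset_apply_of_notMem hs ha]

/-! ## The law of the output of a program -/

namespace Prog

variable {V : Type} [DecidableEq V]

/-- The law of the output. -/
def law {α : Type} (P : Prog V α) (f : Finset V → ℝ) : PMF α := (P.run f).map Outcome.out

theorem law_ret {α : Type} (a : α) (f : Finset V → ℝ) : (ret a : Prog V α).law f = PMF.pure a := by
  simp [law, run, PMF.pure_map]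

theorem law_draw {α : Type} (μ : PMF α) (f : Finset V → ℝ) : (draw μ : Prog V α).law f = μ := by
  simp [law, run, PMF.map_bind, PMF.pure_map]

theorem law_ask (Q : Finset (Finset V)) (f : Finset V → ℝ) :
    (ask Q).law f = PMF.pure fun S => if S ∈ Q then f S else 0 := by
  simp [law, run, PMF.pure_map]

theorem law_bind {α β : Type} (P : Prog V α) (k : α → Prog V β) (f : Finset V → ℝ) :
    (bind P k).law f = (P.law f).bind fun a => (k a).law f := by
  simp only [law, run, PMF.map_bind, PMF.pure_map, PMF.bind_map]
  rfl

theorem law_par {α β : Type} (P : Prog V α) (Q : Prog V β) (f : Finset V → ℝ) :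
    (par P Q).law f = (P.law f).bind fun a => (Q.law f).bind fun b => PMF.pure (a, b) := by
  simp only [law, run, PMF.map_bind, PMF.pure_map, PMF.bind_map]
  rfl

theorem law_ask_bind {β : Type} (Q : Finset (Finset V)) (k : (Finset V → ℝ) → Prog V β)
    (f : Finset V → ℝ) :
    (bind (ask Q) k).law f = (k fun S => if S ∈ Q then f S else 0).law f := by
  rw [law_bind, law_ask, PMF.pure_bind]

theorem mem_support_law {α : Type} {P : Prog V α} {f : Finset V → ℝ} {a : α} :
    a ∈ (P.law f).support ↔ ∃ o ∈ (P.run f).support, o.out = a := by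
  simp [law, PMF.support_map]

theorem expectedValue_eq [Fintype V] (P : Prog V (Finset V)) (f : Finset V → ℝ) :
    P.expectedValue f = pexp (P.law f) f := (pexp_fintype _ _).symm

theorem mem_support_run_bind {α β : Type} {P : Prog V α} {k : α → Prog V β} {f : Finset V → ℝ}
    {o : Outcome β} : o ∈ ((bind P k).run f).support ↔
      ∃ o₁ ∈ (P.run f).support, ∃ o₂ ∈ ((k o₁.out).run f).support,
        o = ⟨o₂.out, o₁.rounds + o₂.rounds, o₁.queries + o₂.queries⟩ := by
  simp only [run, PMF.mem_support_bind_iff, PMF.mem_support_pure_iff]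

theorem mem_support_run_par {α β : Type} {P : Prog V α} {Q : Prog V β} {f : Finset V → ℝ}
    {o : Outcome (α × β)} : o ∈ ((par P Q).run f).support ↔
      ∃ o₁ ∈ (P.run f).support, ∃ o₂ ∈ (Q.run f).support,
        o = ⟨(o₁.out, o₂.out), max o₁.rounds o₂.rounds, o₁.queries + o₂.queries⟩ := by
  simp only [run, PMF.mem_support_bind_iff, PMF.mem_support_pure_iff]

theorem mem_support_run_ask_bind {β : Type} {Q : Finset (Finset V)}
    {k : (Finset V → ℝ) → Prog V β} {f : Finset V → ℝ} {o : Outcome β} :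
    o ∈ ((bind (ask Q) k).run f).support ↔
      ∃ o₂ ∈ ((k fun S => if S ∈ Q then f S else 0).run f).support,
        o = ⟨o₂.out, 1 + o₂.rounds, Q.card + o₂.queries⟩ := by
  simp [run]

theorem mem_support_run_draw_bind {α β : Type} {μ : PMF α}
    {k : α → Prog V β} {f : Finset V → ℝ} {o : Outcome β} :
    o ∈ ((bind (draw μ) k).run f).support ↔
      ∃ a ∈ μ.support, o ∈ ((k a).run f).support := by
  simp only [run, PMF.mem_support_bind_iff, PMF.mem_support_pure_iff]
  constructor
  · rintro ⟨_, ⟨a, ha, rfl⟩, o₂, h, rfl⟩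
    exact ⟨a, ha, by simpa using h⟩
  · rintro ⟨a, ha, h⟩
    exact ⟨_, ⟨a, ha, rfl⟩, o, h, by simp⟩

theorem mem_support_run_ret {α : Type} {a : α} {f : Finset V → ℝ} {o : Outcome α} :
    o ∈ ((ret a : Prog V α).run f).support ↔ o = ⟨a, 0, 0⟩ := by
  simp only [run, PMF.mem_support_pure_iff]

end Prog

end

noncomputable section

/-! ## Set functions and costs -/

section SetFunctions

variable {V : Type}

theorem setCost_nonneg {c : V → ℝ} (hc : ∀ x, 0 < c x) (T : Finset V) : 0 ≤ setCost c T :=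
  Finset.sum_nonneg fun x _ => (hc x).le

theorem setCost_mono {c : V → ℝ} (hc : ∀ x, 0 < c x) {S T : Finset V} (h : S ⊆ T) :
    setCost c S ≤ setCost c T :=
  Finset.sum_le_sum_of_subset_of_nonneg h fun x _ _ => (hc x).le

@[simp]
theorem setCost_empty {c : V → ℝ} : setCost c ∅ = 0 := Finset.sum_empty

variable [DecidableEq V]

theorem setCost_insert {c : V → ℝ} {a : V} {T : Finset V} (h : a ∉ T) :
    setCost c (insert a T) = c a + setCost c T := Finset.sum_insert h

theorem setCost_union {c : V → ℝ} {S T : Finset V} (h : Disjoint S T) :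
    setCost c (S ∪ T) = setCost c S + setCost c T := Finset.sum_union h

theorem IsSubmodular.marginal_anti {f : Finset V → ℝ} (hf : IsSubmodular f) {S T : Finset V}
    (h : S ⊆ T) {x : V} (hx : x ∉ T) : marginal f x T ≤ marginal f x S := hf S T h x hx

/-- Add the elements of `T ∖ S` one at a time; each marginal is at most the one at `S`. -/
theorem IsSubmodular.union_le {f : Finset V → ℝ} (hf : IsSubmodular f) (S T : Finset V) :
    f (S ∪ T) ≤ f S + ∑ x ∈ T \ S, marginal f x S := by
  induction T using Finset.induction_on with
  | empty => simp
  | insert a T ha ih =>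
    by_cases haS : a ∈ S
    · rw [Finset.union_insert, Finset.insert_eq_of_mem (Finset.mem_union_left _ haS),
        Finset.insert_sdiff_of_mem _ haS]
      exact ih
    · have h1 := hf S (S ∪ T) Finset.subset_union_left a (by simp [haS, ha])
      rw [Finset.union_insert, Finset.insert_sdiff_of_notMem _ haS,
        Finset.sum_insert (by simp [ha])]
      have h2 : marginal f a (S ∪ T) = f (insert a (S ∪ T)) - f (S ∪ T) := rfl
      linarith

end SetFunctions

/-! ## The random sequence -/

section SampleSeq

variable {V : Type} [DecidableEq V]

theorem mem_fitting {c : V → ℝ} {B : ℝ} {S X T : Finset V} {a : V} :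
    a ∈ fitting c B S X T ↔ (a ∈ X ∧ a ∉ T) ∧ c a + setCost c (S ∪ T) ≤ B := by
  simp [fitting]

/-- The sampler filters its pool incrementally. Since the cost of the drawn set only grows, nothing
filtered out earlier would fit later, and the pool is always a function of the drawn set alone. -/
theorem fitting_append {c : V → ℝ} (hc : ∀ x, 0 < c x) {B : ℝ} {S X : Finset V}
    (hSX : Disjoint S X) {A : List V} {a : V} (hA : ∀ x ∈ A, x ∈ X)
    (ha : a ∈ fitting c B S X A.toFinset) :
    ((fitting c B S X A.toFinset).erase a).filter
        (fun x => c x + setCost c (A ++ [a]).toFinset + setCost c S ≤ B) =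
      fitting c B S X (A ++ [a]).toFinset := by
  have hd : Disjoint S (A ++ [a]).toFinset := by
    refine hSX.mono_right fun x hx => ?_
    simp only [List.mem_toFinset, List.mem_append, List.mem_singleton] at hx
    rcases hx with hx | rfl
    · exact hA x hx
    · exact (mem_fitting.1 ha).1.1
  ext x
  rw [Finset.mem_filter, Finset.mem_erase, mem_fitting, mem_fitting, setCost_union hd]
  have hm : setCost c (S ∪ A.toFinset) ≤ setCost c S + setCost c (A ++ [a]).toFinset := by
    rw [← setCost_union hd]
    exact setCost_mono hc (Finset.union_subset_union_right (by
      intro y hy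
      simp only [List.mem_toFinset, List.mem_append] at hy ⊢
      exact Or.inl hy))
  simp only [List.mem_toFinset, List.mem_append, List.mem_singleton, not_or]
  constructor
  · rintro ⟨⟨h1, ⟨h2, h3⟩, h4⟩, h5⟩
    exact ⟨⟨h2, h3, h1⟩, by linarith⟩
  · rintro ⟨⟨h1, h2, h3⟩, h4⟩
    exact ⟨⟨h3, ⟨h1, h2⟩, by linarith⟩, by linarith⟩

theorem fitting_append_cost {c : V → ℝ} {B : ℝ} {S X : Finset V}
    (hSX : Disjoint S X) {A : List V} {a : V}
    (ha : a ∈ fitting c B S X A.toFinset) :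
    S ∪ (A ++ [a]).toFinset = insert a (S ∪ A.toFinset) ∧ a ∉ S ∪ A.toFinset ∧
    setCost c (S ∪ (A ++ [a]).toFinset) ≤ B := by
  obtain ⟨⟨h1, h2⟩, h3⟩ := mem_fitting.1 ha
  have h4 : a ∉ S ∪ A.toFinset := by
    rw [Finset.mem_union]
    rintro (h | h)
    · exact Finset.disjoint_left.1 hSX h h1
    · exact h2 h
  have h5 : S ∪ (A ++ [a]).toFinset = insert a (S ∪ A.toFinset) := by
    ext x; simp
  refine ⟨h5, h4, ?_⟩
  rw [h5, setCost_insert h4]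
  exact h3

theorem card_fitting_append_lt {c : V → ℝ} {B : ℝ} {S X : Finset V} {A : List V} {a : V}
    (hc : ∀ x, 0 < c x)
    (ha : a ∈ fitting c B S X A.toFinset) :
    (fitting c B S X (A ++ [a]).toFinset).card < (fitting c B S X A.toFinset).card := by
  refine Finset.card_lt_card ⟨fun x hx => ?_, fun h => ?_⟩
  · obtain ⟨⟨h1, h2⟩, h3⟩ := mem_fitting.1 hx
    simp only [List.mem_toFinset, List.mem_append, List.mem_singleton, not_or] at h2
    refine mem_fitting.2 ⟨⟨h1, by simpa using h2.1⟩, le_trans ?_ h3⟩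
    have := setCost_mono hc (S := S ∪ A.toFinset) (T := S ∪ (A ++ [a]).toFinset)
      (Finset.union_subset_union_right (by
        intro y hy
        simp only [List.mem_toFinset, List.mem_append] at hy ⊢
        exact Or.inl hy))
    linarith
  · have := (mem_fitting.1 (h ha)).1.2
    simp at this

/-- Every draw shrinks the pool, so the fuel `m` never runs out before the pool does. The emptiness
of the final pool is what makes the stopping indices exist. -/
theorem mem_support_sampleSeqAux {c : V → ℝ} (hc : ∀ x, 0 < c x) {B : ℝ} {S X : Finset V}
    (hSX : Disjoint S X) (m : ℕ) (A : List V) (hm : (fitting c B S X A.toFinset).card ≤ m)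
    (hA : ∀ x ∈ A, x ∈ X) (hn : A.Nodup) (hB : setCost c (S ∪ A.toFinset) ≤ B)
    (A' : List V)
    (h : A' ∈ (sampleSeqAux c B S m A (fitting c B S X A.toFinset)).support) :
    A <+: A' ∧ A'.Nodup ∧ (∀ x ∈ A', x ∈ X) ∧ setCost c (S ∪ A'.toFinset) ≤ B ∧
      fitting c B S X A'.toFinset = ∅ := by
  induction m generalizing A with
  | zero =>
    simp only [sampleSeqAux, PMF.mem_support_pure_iff] at h
    subst h
    exact ⟨List.prefix_rfl, hn, hA, hB, by simpa using hm⟩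
  | succ m ih =>
    rw [sampleSeqAux] at h
    split_ifs at h with hne
    · rw [PMF.mem_support_bind_iff] at h
      obtain ⟨a, ha, h⟩ := h
      rw [PMF.mem_support_uniformOfFinset_iff] at ha
      rw [fitting_append hc hSX hA ha] at h
      obtain ⟨h1, h2, h3⟩ := fitting_append_cost hSX ha
      have hlt := card_fitting_append_lt hc ha
      obtain ⟨k1, k2⟩ := ih (A ++ [a]) (by omega)
        (by
          intro x hx
          rcases List.mem_append.1 hx with hx | hx
          · exact hA x hx
          · rw [List.mem_singleton.1 hx]; exact (mem_fitting.1 ha).1.1)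
        (by
          rw [List.nodup_append]
          refine ⟨hn, by simp, ?_⟩
          intro x hx y hy hxy
          rw [List.mem_singleton] at hy
          subst hxy
          subst hy
          exact (mem_fitting.1 ha).1.2 (by simpa using hx))
        h3 h
      exact ⟨(List.prefix_append _ _).trans k1, k2⟩
    · rw [PMF.mem_support_pure_iff] at h
      subst h
      exact ⟨List.prefix_rfl, hn, hA, hB, Finset.not_nonempty_iff_eq_empty.1 hne⟩

/-- The invariant of the state `S`, `X` of the loop on the sampled set `H`. -/
structure LoopInv (f : Finset V → ℝ) (c : V → ℝ) (B τ : ℝ) (H S X : Finset V) : Prop where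
  left : S ⊆ H
  right : X ⊆ H
  disj : Disjoint S X
  cost : setCost c S ≤ B
  fits : ∀ a ∈ X, c a + setCost c S ≤ B
  dens : ∀ a ∈ X, τ * c a ≤ marginal f a S

theorem LoopInv.fitting_eq {f : Finset V → ℝ} {c : V → ℝ} {B τ : ℝ} {H S X : Finset V}
    (h : LoopInv f c B τ H S X) : fitting c B S X ∅ = X := by
  ext x
  rw [mem_fitting]
  simp only [Finset.notMem_empty, not_false_eq_true, and_true, Finset.union_empty]
  exact ⟨fun h => h.1, fun hx => ⟨hx, h.fits x hx⟩⟩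

theorem mem_support_sampleSeq {f : Finset V → ℝ} {c : V → ℝ} (hc : ∀ x, 0 < c x) {B τ : ℝ}
    {H S X : Finset V} (h : LoopInv f c B τ H S X) {A : List V}
    (hA : A ∈ (sampleSeq c B S X).support) :
    A.Nodup ∧ (∀ x ∈ A, x ∈ X) ∧ setCost c (S ∪ A.toFinset) ≤ B ∧
      fitting c B S X A.toFinset = ∅ := by
  have h1 := h.fitting_eq
  have h2 := mem_support_sampleSeqAux hc (B := B) h.disj X.card [] (by simp [h1]) (by simp)
    (by simp) (by simpa using h.cost) A (by simpa [h1, sampleSeq] using hA)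
  exact h2.2

theorem length_pos_of_mem_support_sampleSeq {f : Finset V → ℝ} {c : V → ℝ} (hc : ∀ x, 0 < c x)
    {B τ : ℝ} {H S X : Finset V} (h : LoopInv f c B τ H S X) (hX : X.Nonempty) {A : List V}
    (hA : A ∈ (sampleSeq c B S X).support) : 0 < A.length := by
  rw [List.length_pos_iff]
  rintro rfl
  have h1 := (mem_support_sampleSeq hc h hA).2.2.2
  rw [List.toFinset_nil, h.fitting_eq] at h1
  exact hX.ne_empty h1

/-! ### Stopping indices -/

/-- The condition of `costIndex` at the prefix of length `i`. -/
def CostStop (f : Finset V → ℝ) (c : V → ℝ) (B τ δ : ℝ) (S X : Finset V) (A : List V) (i : ℕ) :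
    Prop := setCost c (goodSet f c B τ S X A i) ≤ (1 - δ) * setCost c X

/-- The condition of `valueIndex` at the prefix of length `i`. -/
def ValueStop (f : Finset V → ℝ) (c : V → ℝ) (B τ δ : ℝ) (S X : Finset V) (A : List V) (i : ℕ) :
    Prop := ∑ x ∈ goodSet f c B τ S X A i, δ * marginal f x (S ∪ prefixSet A i) ≤
      ∑ x ∈ negSet f c B S X A i, |marginal f x (S ∪ prefixSet A i)|

/-- The index at which the sequence is cut. -/
def stopIndex (f : Finset V → ℝ) (c : V → ℝ) (B τ δ : ℝ) (S X : Finset V) (A : List V) : ℕ :=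
  min (costIndex f c B τ δ S X A) (valueIndex f c B τ δ S X A)

/-- The oracle table is `0` off the queried sets. It is consulted only at prefixes with `1 ≤ i ≤
A.length`, where it agrees with `f`, so everything the program computes from it can be replaced by
the same expression in `f`. -/
theorem marginal_table {f : Finset V → ℝ} {c : V → ℝ} {B : ℝ} {S X : Finset V}
    {A : List V} {i : ℕ} (h1 : 1 ≤ i) (h2 : i ≤ A.length) {a : V} (ha : a ∈ restSet c B S X A i) :
    marginal (fun T => if T ∈ prefixQueries c B S X A then f T else 0) a (S ∪ prefixSet A i) =
      marginal f a (S ∪ prefixSet A i) := by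
  have e1 : insert a (S ∪ prefixSet A i) ∈ prefixQueries c B S X A := by
    simp only [prefixQueries, Finset.mem_biUnion, Finset.mem_Icc]
    exact ⟨i, ⟨h1, h2⟩, Finset.mem_insert_of_mem (Finset.mem_image_of_mem _ ha)⟩
  have e2 : S ∪ prefixSet A i ∈ prefixQueries c B S X A := by
    simp only [prefixQueries, Finset.mem_biUnion, Finset.mem_Icc]
    exact ⟨i, ⟨h1, h2⟩, Finset.mem_insert_self _ _⟩
  simp only [marginal]
  rw [if_pos e1, if_pos e2]

theorem goodSet_table {f : Finset V → ℝ} {c : V → ℝ} {B τ : ℝ} {S X : Finset V}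
    {A : List V} {i : ℕ} (h1 : 1 ≤ i) (h2 : i ≤ A.length) :
    goodSet (fun T => if T ∈ prefixQueries c B S X A then f T else 0) c B τ S X A i =
      goodSet f c B τ S X A i :=
  Finset.filter_congr fun a ha => by rw [marginal_table h1 h2 ha]

theorem negSet_table {f : Finset V → ℝ} {c : V → ℝ} {B : ℝ} {S X : Finset V}
    {A : List V} {i : ℕ} (h1 : 1 ≤ i) (h2 : i ≤ A.length) :
    negSet (fun T => if T ∈ prefixQueries c B S X A then f T else 0) c B S X A i =
      negSet f c B S X A i :=
  Finset.filter_congr fun a ha => by rw [marginal_table h1 h2 ha]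

theorem costIndex_table {f : Finset V → ℝ} {c : V → ℝ} {B τ δ : ℝ} {S X : Finset V}
    {A : List V} :
    costIndex (fun T => if T ∈ prefixQueries c B S X A then f T else 0) c B τ δ S X A =
      costIndex f c B τ δ S X A := by
  unfold costIndex
  congr 1
  ext i
  simp only [Set.mem_ofPred_eq]
  refine and_congr_right fun h1 => and_congr_right fun h2 => ?_
  rw [goodSet_table h1 h2]

theorem valueIndex_table {f : Finset V → ℝ} {c : V → ℝ} {B τ δ : ℝ} {S X : Finset V}
    {A : List V} :
    valueIndex (fun T => if T ∈ prefixQueries c B S X A then f T else 0) c B τ δ S X A =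
      valueIndex f c B τ δ S X A := by
  unfold valueIndex
  congr 1
  ext i
  simp only [Set.mem_ofPred_eq]
  refine and_congr_right fun h1 => and_congr_right fun h2 => ?_
  rw [goodSet_table h1 h2, negSet_table h1 h2]
  rw [Finset.sum_congr rfl fun x hx => by
      rw [marginal_table h1 h2 (Finset.mem_of_mem_filter _ hx)],
    Finset.sum_congr (s₁ := negSet f c B S X A i) rfl fun x hx => by
      rw [marginal_table h1 h2 (Finset.mem_of_mem_filter _ hx)]]

theorem restSet_length {c : V → ℝ} {B : ℝ} {S X : Finset V} {A : List V}
    (h : fitting c B S X A.toFinset = ∅) : restSet c B S X A A.length = ∅ := by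
  rw [restSet, prefixSet, List.take_length, h]

theorem costIndex_spec {f : Finset V → ℝ} {c : V → ℝ} (hc : ∀ x, 0 < c x) {B τ δ : ℝ}
    (hδ : δ ≤ 1)
    {S X : Finset V} {A : List V} (h0 : 0 < A.length) (h : fitting c B S X A.toFinset = ∅) :
    (1 ≤ costIndex f c B τ δ S X A ∧ costIndex f c B τ δ S X A ≤ A.length) ∧
      CostStop f c B τ δ S X A (costIndex f c B τ δ S X A) ∧
      ∀ i, 1 ≤ i → i < costIndex f c B τ δ S X A → ¬ CostStop f c B τ δ S X A i := by
  have hne : {i : ℕ | 1 ≤ i ∧ i ≤ A.length ∧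
      setCost c (goodSet f c B τ S X A i) ≤ (1 - δ) * setCost c X}.Nonempty := by
    -- After the whole sequence nothing fits, so the good set is empty and the condition holds; the
    -- infimum is therefore attained and is not the default value `0`.
    refine ⟨A.length, h0, le_rfl, ?_⟩
    rw [goodSet, restSet_length h, Finset.filter_empty, setCost_empty]
    exact mul_nonneg (by linarith) (setCost_nonneg hc X)
  have hm := Nat.sInf_mem hne
  refine ⟨⟨hm.1, hm.2.1⟩, hm.2.2, fun i h1 h2 h3 => ?_⟩
  exact Nat.notMem_of_lt_sInf h2 ⟨h1, (h2.trans_le hm.2.1).le, h3⟩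

theorem valueIndex_spec {f : Finset V → ℝ} {c : V → ℝ} {B τ δ : ℝ}
    {S X : Finset V} {A : List V} (h0 : 0 < A.length) (h : fitting c B S X A.toFinset = ∅) :
    (1 ≤ valueIndex f c B τ δ S X A ∧ valueIndex f c B τ δ S X A ≤ A.length) ∧
      ValueStop f c B τ δ S X A (valueIndex f c B τ δ S X A) ∧
      ∀ i, 1 ≤ i → i < valueIndex f c B τ δ S X A → ¬ ValueStop f c B τ δ S X A i := by
  have hne : {i : ℕ | 1 ≤ i ∧ i ≤ A.length ∧
      ∑ x ∈ goodSet f c B τ S X A i, δ * marginal f x (S ∪ prefixSet A i) ≤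
      ∑ x ∈ negSet f c B S X A i, |marginal f x (S ∪ prefixSet A i)|}.Nonempty := by
    refine ⟨A.length, h0, le_rfl, ?_⟩
    rw [goodSet, negSet, restSet_length h, Finset.filter_empty, Finset.filter_empty]
    simp
  have hm := Nat.sInf_mem hne
  refine ⟨⟨hm.1, hm.2.1⟩, hm.2.2, fun i h1 h2 h3 => ?_⟩
  exact Nat.notMem_of_lt_sInf h2 ⟨h1, (h2.trans_le hm.2.1).le, h3⟩

theorem prefixSet_subset (A : List V) (i : ℕ) : prefixSet A i ⊆ A.toFinset := fun x hx => by
  simp only [prefixSet, List.mem_toFinset] at hx ⊢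
  exact List.mem_of_mem_take hx

theorem stopIndex_bounds {f : Finset V → ℝ} {c : V → ℝ} (hc : ∀ x, 0 < c x) {B τ δ : ℝ}
    (hδ : δ ≤ 1)
    {S X : Finset V} {A : List V} (h0 : 0 < A.length) (h : fitting c B S X A.toFinset = ∅) :
    1 ≤ stopIndex f c B τ δ S X A ∧ stopIndex f c B τ δ S X A ≤ A.length :=
  ⟨le_min (costIndex_spec hc hδ h0 h).1.1 (valueIndex_spec h0 h).1.1,
    (min_le_left _ _).trans (costIndex_spec hc hδ h0 h).1.2⟩

theorem mem_goodSet {f : Finset V → ℝ} {c : V → ℝ} {B τ : ℝ} {S X : Finset V}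
    {A : List V} {i : ℕ} {a : V} : a ∈ goodSet f c B τ S X A i ↔
      ((a ∈ X ∧ a ∉ prefixSet A i) ∧ c a + setCost c (S ∪ prefixSet A i) ≤ B) ∧
        τ * c a ≤ marginal f a (S ∪ prefixSet A i) := by
  rw [goodSet, Finset.mem_filter, restSet, mem_fitting]

theorem mem_negSet {f : Finset V → ℝ} {c : V → ℝ} {B : ℝ} {S X : Finset V}
    {A : List V} {i : ℕ} {a : V} : a ∈ negSet f c B S X A i ↔
      ((a ∈ X ∧ a ∉ prefixSet A i) ∧ c a + setCost c (S ∪ prefixSet A i) ≤ B) ∧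
        marginal f a (S ∪ prefixSet A i) < 0 := by
  rw [negSet, Finset.mem_filter, restSet, mem_fitting]

theorem goodSet_subset {f : Finset V → ℝ} {c : V → ℝ} {B τ : ℝ} {S X : Finset V}
    {A : List V} {i : ℕ} : goodSet f c B τ S X A i ⊆ X := fun _ ha => (mem_goodSet.1 ha).1.1.1

theorem LoopInv.step {f : Finset V → ℝ} {c : V → ℝ} (hc : ∀ x, 0 < c x) {B τ : ℝ}
    {H S X : Finset V} (h : LoopInv f c B τ H S X) {A : List V}
    (hA : A ∈ (sampleSeq c B S X).support) (i : ℕ) :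
    LoopInv f c B τ H (S ∪ prefixSet A i) (goodSet f c B τ S X A i) := by
  obtain ⟨h1, h2, h3, h4⟩ := mem_support_sampleSeq hc h hA
  have hp : prefixSet A i ⊆ X := fun x hx => h2 x (by simpa using prefixSet_subset A i hx)
  refine ⟨Finset.union_subset h.left (hp.trans h.right), goodSet_subset.trans h.right, ?_, ?_,
    fun a ha => (mem_goodSet.1 ha).1.2, fun a ha => (mem_goodSet.1 ha).2⟩
  · rw [Finset.disjoint_left]
    intro a ha hg
    rcases Finset.mem_union.1 ha with ha | ha
    · exact Finset.disjoint_left.1 h.disj ha (mem_goodSet.1 hg).1.1.1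
    · exact (mem_goodSet.1 hg).1.1.2 ha
  · exact (setCost_mono hc (Finset.union_subset_union_right (prefixSet_subset A i))).trans h3

theorem card_goodSet_lt {f : Finset V → ℝ} {c : V → ℝ} {B τ : ℝ}
    {S X : Finset V} {A : List V} (hA : ∀ x ∈ A, x ∈ X) {i : ℕ} (h1 : 1 ≤ i)
    (h0 : 0 < A.length) :
    (goodSet f c B τ S X A i).card < X.card := by
  obtain ⟨a, l, rfl⟩ := List.exists_cons_of_length_pos h0
  refine Finset.card_lt_card ⟨goodSet_subset, fun h => ?_⟩
  refine (mem_goodSet.1 (h (hA a (by simp)))).1.1.2 ?_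
  obtain ⟨j, rfl⟩ := Nat.exists_eq_add_of_le' h1
  simp [prefixSet]

/-- There are at most `n` prefixes, and each needs `1 + |Xᵢ| ≤ n` values because `a₁` is never in
`Xᵢ`. -/
theorem card_prefixQueries_le [Fintype V] {c : V → ℝ} {B : ℝ} {S X : Finset V} {A : List V}
    (hn : A.Nodup) :
    (prefixQueries c B S X A).card ≤ Fintype.card V * Fintype.card V := by
  have hl : A.length ≤ Fintype.card V := hn.length_le_card
  have h1 : ∀ i ∈ Finset.Icc 1 A.length, (insert (S ∪ prefixSet A i)
      ((restSet c B S X A i).image fun a => insert a (S ∪ prefixSet A i))).card ≤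
      Fintype.card V := by
    intro i hi
    rw [Finset.mem_Icc] at hi
    refine (Finset.card_insert_le _ _).trans ?_
    have h2 : restSet c B S X A i ⊂ Finset.univ := by
      refine ⟨Finset.subset_univ _, fun h => ?_⟩
      obtain ⟨a, l, rfl⟩ := List.exists_cons_of_length_pos (show 0 < A.length by omega)
      refine (mem_fitting.1 (h (Finset.mem_univ a))).1.2 ?_
      obtain ⟨j, rfl⟩ := Nat.exists_eq_add_of_le' hi.1
      simp [prefixSet]
    have h3 := Finset.card_lt_card h2
    rw [Finset.card_univ] at h3
    have h4 := Finset.card_image_le (s := restSet c B S X A i)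
      (f := fun a => insert a (S ∪ prefixSet A i))
    omega
  refine (Finset.card_biUnion_le_card_mul _ _ _ h1).trans ?_
  rw [Nat.card_Icc]
  exact Nat.mul_le_mul_right _ (by omega)

end SampleSeq

end

noncomputable section

/-! ## The loop of `ThreshSeq` -/

section Loop

variable {V : Type} [DecidableEq V]

/-- The value of the counter after one iteration. -/
def nextCtr (f : Finset V → ℝ) (c : V → ℝ) (B τ δ : ℝ) (S X : Finset V) (A : List V)
    (ctr : ℕ) : ℕ :=
  if valueIndex f c B τ δ S X A < costIndex f c B τ δ S X A then ctr + 1 else ctr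

theorem threshLoop_body_eq {f : Finset V → ℝ} {c : V → ℝ} (hc : ∀ x, 0 < c x) {B τ δ : ℝ}
    (hδ : δ ≤ 1) {ℓ : ℝ} {S X : Finset V} {A : List V} (h0 : 0 < A.length)
    (h : fitting c B S X A.toFinset = ∅) (m ctr : ℕ) :
    let g := fun T => if T ∈ prefixQueries c B S X A then f T else 0
    threshLoop c B τ δ ℓ m
      (S ∪ prefixSet A (min (costIndex g c B τ δ S X A) (valueIndex g c B τ δ S X A)))
      (goodSet g c B τ S X A
        (min (costIndex g c B τ δ S X A) (valueIndex g c B τ δ S X A)))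
      (if valueIndex g c B τ δ S X A < costIndex g c B τ δ S X A then ctr + 1 else ctr) =
    threshLoop c B τ δ ℓ m (S ∪ prefixSet A (stopIndex f c B τ δ S X A))
      (goodSet f c B τ S X A (stopIndex f c B τ δ S X A)) (nextCtr f c B τ δ S X A ctr) := by
  intro g
  obtain ⟨h1, h2⟩ := stopIndex_bounds (f := f) (τ := τ) hc hδ h0 h
  have e : min (costIndex g c B τ δ S X A) (valueIndex g c B τ δ S X A) =
      stopIndex f c B τ δ S X A := by
    rw [stopIndex, ← costIndex_table (f := f), ← valueIndex_table (f := f)]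
  rw [e, goodSet_table h1 h2, nextCtr, ← costIndex_table (f := f), ← valueIndex_table (f := f)]

/-- The full invariant of the loop. -/
structure FullInv (f : Finset V → ℝ) (c : V → ℝ) (B τ δ : ℝ) (H S X : Finset V) (ctr : ℕ) :
    Prop extends LoopInv f c B τ H S X where
  removed : ∀ o ∈ H, o ∉ S → o ∉ X → marginal f o S < τ * c o ∨ B < c o + setCost c S
  negative : ∃ N ⊆ H, Disjoint N S ∧ Disjoint N X ∧
    ctr * δ * ∑ x ∈ X, marginal f x S ≤ ∑ x ∈ N, -marginal f x S

/-- The witness `N` collects the elements `E` discarded at value stops. As `S` grows and `X`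
shrinks, submodularity decreases `∑_X f(x|S)` and increases `-f(x|S)` on `N`, so the inequality for
the old counter persists. A value stop adds `δ ∑_G ≤ ∑_E |·|`, which pays for one more unit of the
counter. -/
theorem FullInv.step {f : Finset V → ℝ} (hf : IsSubmodular f) {c : V → ℝ} (hc : ∀ x, 0 < c x)
    {B τ δ : ℝ} (hτ : 0 ≤ τ) (hδ0 : 0 ≤ δ) {H S X : Finset V} {ctr : ℕ}
    (h : FullInv f c B τ δ H S X ctr) (hX : X.Nonempty) {A : List V}
    (hA : A ∈ (sampleSeq c B S X).support) :
    FullInv f c B τ δ H (S ∪ prefixSet A (stopIndex f c B τ δ S X A))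
      (goodSet f c B τ S X A (stopIndex f c B τ δ S X A)) (nextCtr f c B τ δ S X A ctr) := by
  have h0 := length_pos_of_mem_support_sampleSeq hc h.toLoopInv hX hA
  obtain ⟨g1, g2, g3, g4⟩ := mem_support_sampleSeq hc h.toLoopInv hA
  set k := stopIndex f c B τ δ S X A with hk
  have hs := h.toLoopInv.step hc hA k
  have hp : prefixSet A k ⊆ X := fun x hx => g2 x (by simpa using prefixSet_subset A k hx)
  have hSS : S ⊆ S ∪ prefixSet A k := Finset.subset_union_left
  have hmono : ∑ x ∈ goodSet f c B τ S X A k, marginal f x (S ∪ prefixSet A k) ≤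
      ∑ x ∈ X, marginal f x S := by
    refine (Finset.sum_le_sum fun x hx => hf.marginal_anti hSS
      (Finset.disjoint_right.1 hs.disj hx)).trans ?_
    refine Finset.sum_le_sum_of_subset_of_nonneg goodSet_subset fun x hx _ => ?_
    exact (mul_nonneg hτ (hc x).le).trans (h.dens x hx)
  refine ⟨hs, ?_, ?_⟩
  · intro o ho hoS hoX
    rw [Finset.mem_union, not_or] at hoS
    by_cases hox : o ∈ X
    · by_cases hfit : c o + setCost c (S ∪ prefixSet A k) ≤ B
      · left
        by_contra hd
        exact hoX (mem_goodSet.2 ⟨⟨⟨hox, hoS.2⟩, hfit⟩, not_lt.1 hd⟩)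
      · exact Or.inr (not_le.1 hfit)
    · rcases h.removed o ho hoS.1 hox with h1 | h1
      · exact Or.inl ((hf.marginal_anti hSS (by simpa using hoS)).trans_lt h1)
      · exact Or.inr (h1.trans_le (by gcongr; exact setCost_mono hc hSS))
  · obtain ⟨N, hN1, hN2, hN3, hN4⟩ := h.negative
    have hNS : Disjoint N (S ∪ prefixSet A k) :=
      Finset.disjoint_union_right.2 ⟨hN2, hN3.mono_right hp⟩
    have hNX : Disjoint N (goodSet f c B τ S X A k) := hN3.mono_right goodSet_subset
    have hN5 : ∑ x ∈ N, -marginal f x S ≤ ∑ x ∈ N, -marginal f x (S ∪ prefixSet A k) :=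
      Finset.sum_le_sum fun x hx => neg_le_neg
        (hf.marginal_anti hSS (Finset.disjoint_left.1 hNS hx))
    have hN6 : ctr * δ * ∑ x ∈ goodSet f c B τ S X A k, marginal f x (S ∪ prefixSet A k) ≤
        ∑ x ∈ N, -marginal f x (S ∪ prefixSet A k) :=
      ((mul_le_mul_of_nonneg_left hmono (by positivity)).trans hN4).trans hN5
    unfold nextCtr
    split_ifs with hlt
    · have hkv : k = valueIndex f c B τ δ S X A := min_eq_right hlt.le
      have hval := (valueIndex_spec (f := f) (τ := τ) (δ := δ) h0 g4).2.1
      rw [← hkv, ValueStop] at hval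
      have hEX : negSet f c B S X A k ⊆ X := fun x hx => (mem_negSet.1 hx).1.1.1
      refine ⟨N ∪ negSet f c B S X A k, Finset.union_subset hN1 (hEX.trans h.right), ?_, ?_, ?_⟩
      · refine Finset.disjoint_union_left.2 ⟨hNS, ?_⟩
        rw [Finset.disjoint_left]
        intro x hx hx'
        rcases Finset.mem_union.1 hx' with h1 | h1
        · exact Finset.disjoint_left.1 h.disj h1 (hEX hx)
        · exact (mem_negSet.1 hx).1.1.2 h1
      · refine Finset.disjoint_union_left.2 ⟨hNX, ?_⟩
        rw [Finset.disjoint_left]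
        intro x hx hx'
        have h1 := (mem_negSet.1 hx).2
        have h2 := (mem_goodSet.1 hx').2
        have h3 := mul_nonneg hτ (hc x).le
        linarith
      · rw [Finset.sum_union (hN3.mono_right hEX)]
        have h1 : ∑ x ∈ negSet f c B S X A k, |marginal f x (S ∪ prefixSet A k)| =
            ∑ x ∈ negSet f c B S X A k, -marginal f x (S ∪ prefixSet A k) :=
          Finset.sum_congr rfl fun x hx => abs_of_neg (mem_negSet.1 hx).2
        rw [← Finset.mul_sum] at hval
        push_cast
        linarith
    · exact ⟨N, hN1, hNS, hNX, hN6⟩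

theorem mem_support_threshLoop {f : Finset V → ℝ} (hf : IsSubmodular f) {c : V → ℝ}
    (hc : ∀ x, 0 < c x) {B τ δ ℓ : ℝ} (hτ : 0 ≤ τ) (hδ0 : 0 ≤ δ) (hδ : δ ≤ 1) {H : Finset V}
    (m : ℕ) {S X : Finset V} {ctr : ℕ} (h : FullInv f c B τ δ H S X ctr) (hm : X.card ≤ m)
    {o : Outcome (Finset V)} (ho : o ∈ ((threshLoop c B τ δ ℓ m S X ctr).run f).support) :
    ∃ X' ctr', FullInv f c B τ δ H o.out X' ctr' ∧ (X' = ∅ ∨ ℓ ≤ (ctr' : ℝ)) := by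
  induction m generalizing S X ctr o with
  | zero =>
    rw [threshLoop, Prog.mem_support_run_ret] at ho
    subst ho
    exact ⟨X, ctr, h, Or.inl (by simpa using hm)⟩
  | succ m ih =>
    rw [threshLoop] at ho
    split_ifs at ho with hcond
    · rw [Prog.mem_support_run_draw_bind] at ho
      obtain ⟨A, hA, ho⟩ := ho
      rw [Prog.mem_support_run_ask_bind] at ho
      have h0 := length_pos_of_mem_support_sampleSeq hc h.toLoopInv hcond.1 hA
      obtain ⟨g1, g2, g3, g4⟩ := mem_support_sampleSeq hc h.toLoopInv hA
      rw [threshLoop_body_eq hc hδ h0 g4] at ho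
      obtain ⟨o₂, ho₂, rfl⟩ := ho
      have := card_goodSet_lt (f := f) (c := c) (B := B) (τ := τ) (S := S) g2
        (stopIndex_bounds (f := f) (τ := τ) (δ := δ) hc hδ h0 g4).1 h0
      have h1 := ih (h.step hf hc hτ hδ0 hcond.1 hA) (by omega) ho₂
      exact h1
    · rw [Prog.mem_support_run_ret] at ho
      subst ho
      refine ⟨X, ctr, h, ?_⟩
      rcases not_and_or.1 hcond with h1 | h1
      · exact Or.inl (Finset.not_nonempty_iff_eq_empty.1 h1)
      · exact Or.inr (not_lt.1 h1)

/-- The rounds and queries of the loop: an iteration either decreases the cost of `X` by the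
factor `1 - δ` or increases the counter. -/
theorem rounds_threshLoop [Fintype V] {f : Finset V → ℝ} {c : V → ℝ}
    (hc : ∀ x, 0 < c x) {B τ δ ℓ b : ℝ} (hδ1 : δ < 1) {H : Finset V}
    (hb : ∀ x ∈ H, b ≤ c x) (t m : ℕ) {S X : Finset V} {ctr : ℕ}
    (h : LoopInv f c B τ H S X) (hX : (1 - δ) ^ t * setCost c X < b)
    {o : Outcome (Finset V)} (ho : o ∈ ((threshLoop c B τ δ ℓ m S X ctr).run f).support) :
    o.rounds ≤ t + (⌈ℓ⌉₊ - ctr) ∧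
      o.queries ≤ (t + (⌈ℓ⌉₊ - ctr)) * (Fintype.card V * Fintype.card V) := by
  induction m generalizing S X ctr o t with
  | zero =>
    rw [threshLoop, Prog.mem_support_run_ret] at ho
    subst ho
    simp
  | succ m ih =>
    rw [threshLoop] at ho
    split_ifs at ho with hcond
    · rw [Prog.mem_support_run_draw_bind] at ho
      obtain ⟨A, hA, ho⟩ := ho
      rw [Prog.mem_support_run_ask_bind] at ho
      have h0 := length_pos_of_mem_support_sampleSeq hc h hcond.1 hA
      obtain ⟨g1, g2, g3, g4⟩ := mem_support_sampleSeq hc h hA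
      rw [threshLoop_body_eq hc hδ1.le h0 g4] at ho
      obtain ⟨o₂, ho₂, rfl⟩ := ho
      have hq := card_prefixQueries_le (c := c) (B := B) (S := S) (X := X) g1
      have hs := h.step hc hA (stopIndex f c B τ δ S X A)
      have hctr : ctr < ⌈ℓ⌉₊ := Nat.lt_ceil.2 hcond.2
      have hd : 0 < 1 - δ := by linarith
      -- Each iteration lowers the budget `t + (⌈ℓ⌉₊ - ctr)` by one and is charged one round and at
      -- most `n²` queries.
      have key : ∀ t' ctr' : ℕ, t' + (⌈ℓ⌉₊ - ctr') + 1 ≤ t + (⌈ℓ⌉₊ - ctr) →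
          o₂.rounds ≤ t' + (⌈ℓ⌉₊ - ctr') ∧
            o₂.queries ≤ (t' + (⌈ℓ⌉₊ - ctr')) * (Fintype.card V * Fintype.card V) →
          1 + o₂.rounds ≤ t + (⌈ℓ⌉₊ - ctr) ∧ (prefixQueries c B S X A).card + o₂.queries ≤
            (t + (⌈ℓ⌉₊ - ctr)) * (Fintype.card V * Fintype.card V) := by
        rintro t' ctr' h1 ⟨h2, h3⟩
        refine ⟨by omega, ?_⟩
        calc _ ≤ Fintype.card V * Fintype.card V +
              (t' + (⌈ℓ⌉₊ - ctr')) * (Fintype.card V * Fintype.card V) := add_le_add hq h3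
          _ = (t' + (⌈ℓ⌉₊ - ctr') + 1) * (Fintype.card V * Fintype.card V) := by ring
          _ ≤ _ := Nat.mul_le_mul_right _ h1
      by_cases hlt : valueIndex f c B τ δ S X A < costIndex f c B τ δ S X A
      · rw [nextCtr, if_pos hlt] at ho₂
        refine key t (ctr + 1) (by omega) (ih t hs ?_ ho₂)
        refine lt_of_le_of_lt ?_ hX
        gcongr
        exact setCost_mono hc goodSet_subset
      · rw [nextCtr, if_neg hlt] at ho₂
        have hk : stopIndex f c B τ δ S X A = costIndex f c B τ δ S X A :=
          min_eq_left (not_lt.1 hlt)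
        have hcs := (costIndex_spec (f := f) (τ := τ) hc hδ1.le h0 g4).2.1
        rw [← hk, CostStop] at hcs
        obtain ⟨x, hx⟩ := hcond.1
        have hbx : b ≤ setCost c X := (hb x (h.right hx)).trans
          (Finset.single_le_sum (f := c) (fun y _ => (hc y).le) hx)
        -- The case `t = 0` cannot occur: a nonempty `X` costs at least `b`.
        rcases t with _ | t
        · rw [pow_zero, one_mul] at hX
          linarith
        · refine key t ctr (by omega) (ih t hs ?_ ho₂)
          refine lt_of_le_of_lt ?_ hX
          rw [pow_succ, mul_assoc]
          gcongr
    · rw [Prog.mem_support_run_ret] at ho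
      subst ho
      simp

/-! ### The expected gain of one iteration -/

/-- The cut is a stopping time: both conditions at a prefix depend on that prefix only, so the
elements drawn afterwards do not move it. -/
theorem stopIndex_eq_of_prefix {f : Finset V → ℝ} {c : V → ℝ} (hc : ∀ x, 0 < c x) {B τ δ : ℝ}
    (hδ : δ ≤ 1) {S X : Finset V} {A A' : List V} (h0 : 0 < A.length) (hp : A <+: A')
    (h : fitting c B S X A'.toFinset = ∅)
    (hno : ∀ i, 1 ≤ i → i < A.length → ¬ CostStop f c B τ δ S X A i ∧
      ¬ ValueStop f c B τ δ S X A i)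
    (hst : CostStop f c B τ δ S X A A.length ∨ ValueStop f c B τ δ S X A A.length) :
    prefixSet A' (stopIndex f c B τ δ S X A') = A.toFinset := by
  have htake : ∀ i ≤ A.length, A'.take i = A.take i := by
    intro i hi
    obtain ⟨l, rfl⟩ := hp
    rw [List.take_append_of_le_length hi]
  have hps : ∀ i ≤ A.length, prefixSet A' i = prefixSet A i := fun i hi => by
    rw [prefixSet, htake i hi, prefixSet]
  have hC : ∀ i ≤ A.length, (CostStop f c B τ δ S X A' i ↔ CostStop f c B τ δ S X A i) := by
    intro i hi
    simp only [CostStop, goodSet, restSet, hps i hi]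
  have hV : ∀ i ≤ A.length, (ValueStop f c B τ δ S X A' i ↔ ValueStop f c B τ δ S X A i) := by
    intro i hi
    simp only [ValueStop, goodSet, negSet, restSet, hps i hi]
  have h0' : 0 < A'.length := h0.trans_le hp.length_le
  obtain ⟨c1, c2, c3⟩ := costIndex_spec (f := f) (τ := τ) hc hδ h0' h
  obtain ⟨v1, v2, v3⟩ := valueIndex_spec (f := f) (τ := τ) (δ := δ) h0' h
  have hge : A.length ≤ stopIndex f c B τ δ S X A' := by
    refine le_min ?_ ?_
    · by_contra hlt
      rw [not_le] at hlt
      exact (hno _ c1.1 hlt).1 ((hC _ hlt.le).1 c2)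
    · by_contra hlt
      rw [not_le] at hlt
      exact (hno _ v1.1 hlt).2 ((hV _ hlt.le).1 v2)
  have hle : stopIndex f c B τ δ S X A' ≤ A.length := by
    rcases hst with hst | hst
    · refine (min_le_left _ _).trans ?_
      by_contra hlt
      exact c3 _ h0 (not_le.1 hlt) ((hC _ le_rfl).2 hst)
    · refine (min_le_right _ _).trans ?_
      by_contra hlt
      exact v3 _ h0 (not_le.1 hlt) ((hV _ le_rfl).2 hst)
  rw [le_antisymm hle hge, hps _ le_rfl, prefixSet, List.take_length]

/-- Let `R` be the fitting set. Each failed condition costs one factor `1 - δ`: without a value stop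
`∑_R ≥ ∑_G - ∑_E |·| ≥ (1-δ) ∑_G ≥ (1-δ) τ c(G)`, and without a cost stop `c(G) ≥ (1-δ) c(X) ≥ (1-δ)
c(R)`. -/
theorem sum_marginal_of_not_stop {f : Finset V → ℝ} {c : V → ℝ} (hc : ∀ x, 0 < c x) {B τ δ : ℝ}
    (hτ : 0 ≤ τ) (hδ : δ ≤ 1) {S X : Finset V} {A : List V}
    (h1 : ¬ CostStop f c B τ δ S X A A.length) (h2 : ¬ ValueStop f c B τ δ S X A A.length) :
    (1 - δ) ^ 2 * τ * setCost c (fitting c B S X A.toFinset) ≤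
      ∑ a ∈ fitting c B S X A.toFinset, marginal f a (S ∪ A.toFinset) := by
  have e : prefixSet A A.length = A.toFinset := by rw [prefixSet, List.take_length]
  rw [CostStop, not_le] at h1
  rw [ValueStop, not_le] at h2
  simp only [goodSet, negSet, restSet, e] at h1 h2
  set R := fitting c B S X A.toFinset with hR
  have hRX : R ⊆ X := fun x hx => (mem_fitting.1 hx).1.1
  set G := R.filter fun a => τ * c a ≤ marginal f a (S ∪ A.toFinset) with hG
  set E := R.filter fun a => marginal f a (S ∪ A.toFinset) < 0 with hE
  have hGE : Disjoint G E := by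
    rw [Finset.disjoint_left]
    intro x hx hx'
    have h3 := (Finset.mem_filter.1 hx).2
    have h4 := (Finset.mem_filter.1 hx').2
    have := mul_nonneg hτ (hc x).le
    linarith
  have hsum : ∑ a ∈ G, marginal f a (S ∪ A.toFinset) - ∑ a ∈ E, |marginal f a (S ∪ A.toFinset)| ≤
      ∑ a ∈ R, marginal f a (S ∪ A.toFinset) := by
    have h3 : ∑ a ∈ G ∪ E, marginal f a (S ∪ A.toFinset) ≤
        ∑ a ∈ R, marginal f a (S ∪ A.toFinset) := by
      refine Finset.sum_le_sum_of_subset_of_nonneg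
        (Finset.union_subset (Finset.filter_subset _ _) (Finset.filter_subset _ _)) ?_
      intro x hx hx'
      by_contra hneg
      exact hx' (Finset.mem_union_right _ (Finset.mem_filter.2 ⟨hx, not_le.1 hneg⟩))
    rw [Finset.sum_union hGE] at h3
    have h4 : ∑ a ∈ E, |marginal f a (S ∪ A.toFinset)| =
        ∑ a ∈ E, -marginal f a (S ∪ A.toFinset) :=
      Finset.sum_congr rfl fun x hx => abs_of_neg (Finset.mem_filter.1 hx).2
    rw [h4, Finset.sum_neg_distrib]
    linarith
  have h5 : τ * setCost c G ≤ ∑ a ∈ G, marginal f a (S ∪ A.toFinset) := by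
    rw [setCost, Finset.mul_sum]
    exact Finset.sum_le_sum fun x hx => (Finset.mem_filter.1 hx).2
  rw [← Finset.mul_sum] at h2
  have h6 : (1 - δ) * setCost c R ≤ setCost c G :=
    (mul_le_mul_of_nonneg_left (setCost_mono hc hRX) (by linarith)).trans h1.le
  have h7 : (1 - δ) * (τ * ((1 - δ) * setCost c R)) ≤
      (1 - δ) * ∑ a ∈ G, marginal f a (S ∪ A.toFinset) := by
    refine mul_le_mul_of_nonneg_left (le_trans ?_ h5) (by linarith)
    exact mul_le_mul_of_nonneg_left h6 hτ
  nlinarith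

/-- The potential whose expectation does not decrease along the loop. -/
def potential (f : Finset V → ℝ) (c : V → ℝ) (κ : ℝ) (S : Finset V) : ℝ := f S - κ * setCost c S

/-- A stopped submartingale. A uniform draw from the fitting set `R` has mean gain `∑_R f(a|·)/|R|`
and mean cost `c(R)/|R|`; these are compared by `sum_marginal_of_not_stop`, and for the first draw
by the density invariant of `X`. Once the cut is reached the potential is frozen. -/
theorem potential_le_pexp_sampleSeqAux [Fintype V] {f : Finset V → ℝ} {c : V → ℝ}
    (hc : ∀ x, 0 < c x)
    {B τ δ : ℝ} (hτ : 0 ≤ τ) (hδ0 : 0 ≤ δ) (hδ : δ ≤ 1) {H S X : Finset V}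
    (h : LoopInv f c B τ H S X) (hX : X.Nonempty) (m : ℕ) (A : List V)
    (hm : (fitting c B S X A.toFinset).card ≤ m) (hA : ∀ x ∈ A, x ∈ X) (hn : A.Nodup)
    (hB : setCost c (S ∪ A.toFinset) ≤ B)
    (hno : ∀ i, 1 ≤ i → i ≤ A.length → ¬ CostStop f c B τ δ S X A i ∧
      ¬ ValueStop f c B τ δ S X A i) :
    potential f c ((1 - δ) ^ 2 * τ) (S ∪ A.toFinset) ≤
      pexp (sampleSeqAux c B S m A (fitting c B S X A.toFinset)) fun A' =>
        potential f c ((1 - δ) ^ 2 * τ) (S ∪ prefixSet A' (stopIndex f c B τ δ S X A')) := by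
  set κ := (1 - δ) ^ 2 * τ with hκ
  have hκτ : κ ≤ τ := by
    have : (1 - δ) ^ 2 ≤ 1 := pow_le_one₀ (by linarith) (by linarith)
    nlinarith
  have hne : (fitting c B S X A.toFinset).Nonempty := by
    rw [Finset.nonempty_iff_ne_empty]
    intro he
    rcases Nat.eq_zero_or_pos A.length with h0 | h0
    · rw [List.length_eq_zero_iff] at h0
      subst h0
      rw [List.toFinset_nil, h.fitting_eq] at he
      exact hX.ne_empty he
    · refine (hno A.length h0 le_rfl).1 ?_
      rw [CostStop, goodSet, restSet_length he, Finset.filter_empty, setCost_empty]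
      exact mul_nonneg (by linarith) (setCost_nonneg hc X)
  have hgain : κ * setCost c (fitting c B S X A.toFinset) ≤
      ∑ a ∈ fitting c B S X A.toFinset, marginal f a (S ∪ A.toFinset) := by
    rcases Nat.eq_zero_or_pos A.length with h0 | h0
    · rw [List.length_eq_zero_iff] at h0
      subst h0
      rw [List.toFinset_nil, h.fitting_eq, Finset.union_empty, setCost, Finset.mul_sum]
      exact Finset.sum_le_sum fun a ha =>
        (mul_le_mul_of_nonneg_right hκτ (hc a).le).trans (h.dens a ha)
    · obtain ⟨h1, h2⟩ := hno A.length h0 le_rfl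
      exact sum_marginal_of_not_stop hc hτ hδ h1 h2
  induction m generalizing A with
  | zero => exact absurd hm (by simpa using hne.ne_empty)
  | succ m ih =>
    rw [sampleSeqAux, dif_pos hne, pexp_bind _ _ (IsBdd.of_comp_finite (potential f c κ) _),
      pexp_uniformOfFinset]
    have hterm : ∀ a ∈ fitting c B S X A.toFinset,
        potential f c κ (S ∪ (A ++ [a]).toFinset) ≤
        pexp (sampleSeqAux c B S m (A ++ [a]) (((fitting c B S X A.toFinset).erase a).filter
          fun x => c x + setCost c (A ++ [a]).toFinset + setCost c S ≤ B)) fun A' =>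
          potential f c κ (S ∪ prefixSet A' (stopIndex f c B τ δ S X A')) := by
      intro a ha
      rw [fitting_append hc h.disj hA ha]
      obtain ⟨h1, h2, h3⟩ := fitting_append_cost h.disj ha
      have hlt := card_fitting_append_lt hc ha
      have hA' : ∀ x ∈ A ++ [a], x ∈ X := by
        intro x hx
        rcases List.mem_append.1 hx with hx | hx
        · exact hA x hx
        · rw [List.mem_singleton.1 hx]; exact (mem_fitting.1 ha).1.1
      have hn' : (A ++ [a]).Nodup := by
        rw [List.nodup_append]
        refine ⟨hn, by simp, ?_⟩
        intro x hx y hy hxy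
        rw [List.mem_singleton] at hy
        subst hxy
        subst hy
        exact (mem_fitting.1 ha).1.2 (by simpa using hx)
      have htake : ∀ i ≤ A.length, prefixSet (A ++ [a]) i = prefixSet A i := fun i hi => by
        rw [prefixSet, List.take_append_of_le_length hi, prefixSet]
      have hno' : ∀ i, 1 ≤ i → i < (A ++ [a]).length →
          ¬ CostStop f c B τ δ S X (A ++ [a]) i ∧ ¬ ValueStop f c B τ δ S X (A ++ [a]) i := by
        intro i hi hi'
        rw [List.length_append, List.length_singleton] at hi'
        have h4 := hno i hi (by omega)
        simpa only [CostStop, ValueStop, goodSet, negSet, restSet, htake i (by omega)] using h4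
      by_cases hst : CostStop f c B τ δ S X (A ++ [a]) (A ++ [a]).length ∨
          ValueStop f c B τ δ S X (A ++ [a]) (A ++ [a]).length
      · refine le_pexp (IsBdd.of_comp_finite (potential f c κ) _) fun A' hA'' => le_of_eq ?_
        obtain ⟨p1, -, -, -, p5⟩ := mem_support_sampleSeqAux hc h.disj m (A ++ [a]) (by omega)
          hA' hn' h3 A' hA''
        rw [stopIndex_eq_of_prefix hc hδ (by simp) p1 p5 hno' hst]
      · rw [not_or] at hst
        have hno2 : ∀ i, 1 ≤ i → i ≤ (A ++ [a]).length →
            ¬ CostStop f c B τ δ S X (A ++ [a]) i ∧ ¬ ValueStop f c B τ δ S X (A ++ [a]) i := by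
          intro i hi hi'
          rcases hi'.lt_or_eq with h4 | rfl
          · exact hno' i hi h4
          · exact hst
        refine ih (A ++ [a]) (by omega) hA' hn' h3 hno2 ?_ ?_
        · rw [Finset.nonempty_iff_ne_empty]
          intro he
          refine hst.1 ?_
          rw [CostStop, goodSet, restSet_length he, Finset.filter_empty, setCost_empty]
          exact mul_nonneg (by linarith) (setCost_nonneg hc X)
        · exact sum_marginal_of_not_stop hc hτ hδ hst.1 hst.2
    have hcard : 0 < ((fitting c B S X A.toFinset).card : ℝ) := by exact_mod_cast hne.card_pos
    rw [le_inv_mul_iff₀ hcard]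
    refine le_trans ?_ (Finset.sum_le_sum hterm)
    have hexp : ∀ a ∈ fitting c B S X A.toFinset, potential f c κ (S ∪ (A ++ [a]).toFinset) =
        potential f c κ (S ∪ A.toFinset) + (marginal f a (S ∪ A.toFinset) - κ * c a) := by
      intro a ha
      obtain ⟨h1, h2, -⟩ := fitting_append_cost h.disj ha
      rw [potential, potential, h1, setCost_insert h2, marginal]
      ring
    rw [Finset.sum_congr rfl hexp, Finset.sum_add_distrib, Finset.sum_const, nsmul_eq_mul,
      Finset.sum_sub_distrib, ← Finset.mul_sum]
    have : κ * ∑ a ∈ fitting c B S X A.toFinset, c a ≤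
      ∑ a ∈ fitting c B S X A.toFinset, marginal f a (S ∪ A.toFinset) := hgain
    linarith

theorem potential_le_pexp_threshLoop [Fintype V] {f : Finset V → ℝ} {c : V → ℝ}
    (hc : ∀ x, 0 < c x) {B τ δ ℓ : ℝ} (hτ : 0 ≤ τ) (hδ0 : 0 ≤ δ) (hδ : δ ≤ 1) {H : Finset V}
    (m : ℕ) {S X : Finset V} {ctr : ℕ} (h : LoopInv f c B τ H S X) :
    potential f c ((1 - δ) ^ 2 * τ) S ≤
      pexp ((threshLoop c B τ δ ℓ m S X ctr).law f) (potential f c ((1 - δ) ^ 2 * τ)) := by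
  induction m generalizing S X ctr with
  | zero => rw [threshLoop, Prog.law_ret, pexp_pure]
  | succ m ih =>
    rw [threshLoop]
    split_ifs with hcond
    · rw [Prog.law_bind, Prog.law_draw, pexp_bind _ _ (IsBdd.of_finite _)]
      have h1 := potential_le_pexp_sampleSeqAux hc hτ hδ0 hδ h hcond.1 X.card []
        (by simp [h.fitting_eq]) (by simp) (by simp) (by simpa using h.cost)
        (fun i hi hi' => by simp at hi'; omega)
      rw [List.toFinset_nil, Finset.union_empty, h.fitting_eq] at h1
      refine h1.trans (pexp_mono (IsBdd.of_comp_finite (potential f c _) _)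
        ((IsBdd.of_finite _).pexp _) fun A hA => ?_)
      have h0 := length_pos_of_mem_support_sampleSeq hc h hcond.1 hA
      obtain ⟨g1, g2, g3, g4⟩ := mem_support_sampleSeq hc h hA
      rw [Prog.law_ask_bind, threshLoop_body_eq hc hδ h0 g4]
      exact ih (h.step hc hA _)
    · rw [Prog.law_ret, pexp_pure]

end Loop

end

noncomputable section

/-! ## The procedure `ThreshSeq` -/

section ThreshSeq

variable {V : Type} [DecidableEq V]

/-- The set function with the value at the empty set replaced by `0`. -/
def zeroAtEmpty (f : Finset V → ℝ) (S : Finset V) : ℝ := if S = ∅ then 0 else f S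

@[simp]
theorem zeroAtEmpty_empty (f : Finset V → ℝ) : zeroAtEmpty f ∅ = 0 := if_pos rfl

theorem zeroAtEmpty_of_ne (f : Finset V → ℝ) {S : Finset V} (h : S ≠ ∅) :
    zeroAtEmpty f S = f S := if_neg h

theorem zeroAtEmpty_nonneg {f : Finset V → ℝ} (hf : ∀ S, 0 ≤ f S) (S : Finset V) :
    0 ≤ zeroAtEmpty f S := by
  unfold zeroAtEmpty
  split_ifs
  · exact le_rfl
  · exact hf S

theorem zeroAtEmpty_le {f : Finset V → ℝ} (hf : ∀ S, 0 ≤ f S) (S : Finset V) :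
    zeroAtEmpty f S ≤ f S := by
  unfold zeroAtEmpty
  split_ifs
  · exact hf S
  · exact le_rfl

/-- Lowering the value at `∅` only raises the marginals at `∅`, where submodularity wants them
large. The change is useful because the initial filter of `ThreshSeq` tests `f {x}`, which is the
marginal at `∅` only if `f ∅ = 0`. -/
theorem IsSubmodular.zeroAtEmpty {f : Finset V → ℝ} (h : IsSubmodular f) (hf : ∀ S, 0 ≤ f S) :
    IsSubmodular (zeroAtEmpty f) := by
  intro S T hST x hx
  have e : ∀ U : Finset V, U ≠ ∅ → marginal (_root_.zeroAtEmpty f) x U = marginal f x U := by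
    intro U hU
    rw [marginal, marginal, zeroAtEmpty_of_ne f hU, zeroAtEmpty_of_ne f (Finset.insert_ne_empty _ _)]
  by_cases hS : S = ∅
  · subst hS
    by_cases hT : T = ∅
    · rw [hT]
    · rw [e T hT]
      refine (h ∅ T hST x hx).trans ?_
      rw [marginal, marginal, zeroAtEmpty_of_ne f (Finset.insert_ne_empty _ _), zeroAtEmpty_empty]
      linarith [hf ∅]
  · have hT : T ≠ ∅ := fun hT => hS (Finset.subset_empty.1 (hT ▸ hST))
    rw [e S hS, e T hT]
    exact h S T hST x hx

/-- The empty set is never queried, as only prefixes with `i ≥ 1` occur. Hence the algorithm cannot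
distinguish `f` from `zeroAtEmpty f`. -/
theorem run_threshLoop_congr {f f' : Finset V → ℝ} (h : ∀ T, T ≠ ∅ → f T = f' T) (c : V → ℝ)
    (B τ δ ℓ : ℝ) (m : ℕ) (S X : Finset V) (ctr : ℕ) :
    (threshLoop c B τ δ ℓ m S X ctr).run f = (threshLoop c B τ δ ℓ m S X ctr).run f' := by
  induction m generalizing S X ctr with
  | zero => rfl
  | succ m ih =>
    rw [threshLoop]
    split_ifs with hcond
    · have ht : ∀ A : List V, (fun T => if T ∈ prefixQueries c B S X A then f T else 0) =
          fun T => if T ∈ prefixQueries c B S X A then f' T else 0 := by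
        intro A
        funext T
        split_ifs with hT
        · refine h T ?_
          simp only [prefixQueries, Finset.mem_biUnion, Finset.mem_Icc] at hT
          obtain ⟨i, ⟨h1, h2⟩, hT⟩ := hT
          rcases Finset.mem_insert.1 hT with rfl | hT
          · obtain ⟨a, l, rfl⟩ := List.exists_cons_of_length_pos (show 0 < A.length by omega)
            obtain ⟨j, rfl⟩ := Nat.exists_eq_add_of_le' h1
            refine Finset.nonempty_iff_ne_empty.1 ⟨a, ?_⟩
            simp [prefixSet]
          · obtain ⟨a, -, rfl⟩ := Finset.mem_image.1 hT
            exact Finset.insert_ne_empty _ _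
        · rfl
      simp only [Prog.run, PMF.pure_bind, ht, ih]
    · rfl

theorem run_threshSeq_congr {f f' : Finset V → ℝ} (h : ∀ T, T ≠ ∅ → f T = f' T) (c : V → ℝ)
    (H : Finset V) (τ δ ℓ B : ℝ) :
    (threshSeq c H τ δ ℓ B).run f = (threshSeq c H τ δ ℓ B).run f' := by
  have ht : (fun T => if T ∈ H.image (fun x => ({x} : Finset V)) then f T else 0) =
      fun T => if T ∈ H.image (fun x => ({x} : Finset V)) then f' T else 0 := by
    funext T
    split_ifs with hT
    · obtain ⟨a, -, rfl⟩ := Finset.mem_image.1 hT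
      exact h _ (Finset.singleton_ne_empty a)
    · rfl
  simp only [threshSeq, Prog.run, PMF.pure_bind, ht, run_threshLoop_congr h]

theorem filter_table {f : Finset V → ℝ} {c : V → ℝ} {H : Finset V} {τ : ℝ} :
    (H.filter fun x => τ * c x ≤ (fun T => if T ∈ H.image (fun x => ({x} : Finset V)) then f T
      else 0) {x}) = H.filter fun x => τ * c x ≤ f {x} :=
  Finset.filter_congr fun x hx => by dsimp only; rw [if_pos (Finset.mem_image_of_mem _ hx)]

theorem fullInv_init {f : Finset V → ℝ} (h0 : f ∅ = 0) {c : V → ℝ} {B τ δ : ℝ} (hB : 0 ≤ B)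
    (hcB : ∀ x, c x ≤ B) (H : Finset V) :
    FullInv f c B τ δ H ∅ (H.filter fun x => τ * c x ≤ f {x}) 0 := by
  have hm : ∀ x, marginal f x ∅ = f {x} := fun x => by simp [marginal, h0]
  refine ⟨⟨Finset.empty_subset _, Finset.filter_subset _ _, Finset.disjoint_empty_left _,
    by simpa using hB, fun a _ => by simpa using hcB a, fun a ha => ?_⟩, ?_, ?_⟩
  · rw [hm]
    exact (Finset.mem_filter.1 ha).2
  · intro o ho _ hoX
    left
    rw [hm]
    by_contra hlt
    exact hoX (Finset.mem_filter.2 ⟨ho, not_lt.1 hlt⟩)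
  · exact ⟨∅, Finset.empty_subset _, Finset.disjoint_empty_left _, Finset.disjoint_empty_left _,
      by simp⟩

/-- Elements of `K` still in `X` contribute at most `∑_X f(x|S) ≤ δ f(S)` in total. The others were
removed, and since they fit they were removed for a density below `τ`. -/
theorem threshSeq_union_le {f : Finset V → ℝ} (hf0 : ∀ S, 0 ≤ f S) (hf : IsSubmodular f)
    (h0 : f ∅ = 0) {c : V → ℝ} (hc : ∀ x, 0 < c x) {B τ δ : ℝ} (hB : 0 ≤ B)
    (hcB : ∀ x, c x ≤ B) (hτ : 0 ≤ τ) (hδ0 : 0 < δ) (hδ : δ ≤ 1) {H : Finset V}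
    {o : Outcome (Finset V)}
    (ho : o ∈ ((threshSeq c H τ δ (δ ^ 2)⁻¹ B).run f).support) :
    o.out ⊆ H ∧ setCost c o.out ≤ B ∧
      ∀ K ⊆ H, (∀ x ∈ K, c x + setCost c o.out ≤ B) →
        f (o.out ∪ K) ≤ (1 + δ) * f o.out + τ * setCost c K := by
  rw [threshSeq, Prog.mem_support_run_ask_bind, filter_table] at ho
  obtain ⟨o₂, ho₂, rfl⟩ := ho
  obtain ⟨X, ctr, hinv, hend⟩ := mem_support_threshLoop hf hc hτ hδ0.le hδ _
    (fullInv_init h0 hB hcB H) le_rfl ho₂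
  refine ⟨hinv.left, hinv.cost, fun K hK hfit => ?_⟩
  set S := o₂.out with hS
  have hXpos : ∀ x ∈ X, 0 ≤ marginal f x S := fun x hx =>
    (mul_nonneg hτ (hc x).le).trans (hinv.dens x hx)
  have hX : ∑ x ∈ X, marginal f x S ≤ δ * f S := by
    rcases hend with rfl | hend
    · simpa using mul_nonneg hδ0.le (hf0 S)
    · obtain ⟨N, hN1, hN2, hN3, hN4⟩ := hinv.negative
      -- From `0 ≤ f(S ∪ N) ≤ f(S) + ∑_N f(x|S)` the negative mass on `N` is at most `f(S)`. With
      -- the counter at least `δ⁻²`, the invariant then gives `δ⁻¹ ∑_X f(x|S) ≤ f(S)`.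
      have h1 := hf.union_le S N
      have h2 := hf0 (S ∪ N)
      rw [Finset.sdiff_eq_self_of_disjoint hN2] at h1
      rw [Finset.sum_neg_distrib] at hN4
      have h3 : 0 ≤ ∑ x ∈ X, marginal f x S := Finset.sum_nonneg hXpos
      have h4 : (δ ^ 2)⁻¹ * δ * ∑ x ∈ X, marginal f x S ≤ ctr * δ * ∑ x ∈ X, marginal f x S := by
        gcongr
      have h5 : (δ ^ 2)⁻¹ * δ * ∑ x ∈ X, marginal f x S ≤ f S := by linarith
      have h6 : δ * ((δ ^ 2)⁻¹ * δ * ∑ x ∈ X, marginal f x S) = ∑ x ∈ X, marginal f x S := by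
        field_simp
      rw [← h6]
      exact mul_le_mul_of_nonneg_left h5 hδ0.le
  have h1 := hf.union_le S K
  have h2 : ∑ x ∈ K \ S, marginal f x S ≤
      ∑ x ∈ K \ S, ((if x ∈ X then marginal f x S else 0) + τ * c x) := by
    refine Finset.sum_le_sum fun x hx => ?_
    rw [Finset.mem_sdiff] at hx
    have hτc := mul_nonneg hτ (hc x).le
    split_ifs with hxX
    · linarith
    · rcases hinv.removed x (hK hx.1) hx.2 hxX with h3 | h3
      · linarith
      · exact absurd (hfit x hx.1) (not_le.2 h3)
  rw [Finset.sum_add_distrib, ← Finset.sum_filter, ← Finset.mul_sum] at h2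
  have h3 : ∑ x ∈ (K \ S).filter (· ∈ X), marginal f x S ≤ ∑ x ∈ X, marginal f x S :=
    Finset.sum_le_sum_of_subset_of_nonneg (fun x hx => (Finset.mem_filter.1 hx).2)
      fun x hx _ => hXpos x hx
  have h4 : τ * ∑ x ∈ K \ S, c x ≤ τ * setCost c K :=
    mul_le_mul_of_nonneg_left (setCost_mono hc Finset.sdiff_subset) hτ
  linarith

theorem pexp_setCost_threshSeq_le [Fintype V] {f : Finset V → ℝ}
    (h0 : f ∅ = 0) {c : V → ℝ} (hc : ∀ x, 0 < c x) {B τ δ ℓ : ℝ} (hB : 0 ≤ B)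
    (hcB : ∀ x, c x ≤ B) (hτ : 0 ≤ τ) (hδ0 : 0 ≤ δ) (hδ : δ ≤ 1) (H : Finset V) :
    (1 - δ) ^ 2 * τ * pexp ((threshSeq c H τ δ ℓ B).law f) (setCost c) ≤
      pexp ((threshSeq c H τ δ ℓ B).law f) f := by
  have h1 := potential_le_pexp_threshLoop hc hτ hδ0 hδ (ℓ := ℓ)
    (H.filter fun x => τ * c x ≤ f {x}).card (ctr := 0)
    (fullInv_init (δ := δ) h0 hB hcB H).toLoopInv
  rw [threshSeq, Prog.law_ask_bind, filter_table]
  have h2 : potential f c ((1 - δ) ^ 2 * τ) = fun S => f S + (-((1 - δ) ^ 2 * τ)) * setCost c S := by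
    funext S
    rw [potential]
    ring
  rw [h2, pexp_add _ (IsBdd.of_finite _) (IsBdd.of_finite _), pexp_const_mul] at h1
  simp only [h0, setCost_empty, mul_zero, add_zero] at h1
  linarith

theorem rounds_threshSeq [Fintype V] {f : Finset V → ℝ} (h0 : f ∅ = 0) {c : V → ℝ}
    (hc : ∀ x, 0 < c x) {B τ δ ℓ b : ℝ} (hB : 0 ≤ B)
    (hcB : ∀ x, c x ≤ B) (hδ1 : δ < 1) {H : Finset V}
    (hb : ∀ x ∈ H, b ≤ c x) {t : ℕ} (ht : (1 - δ) ^ t * setCost c H < b)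
    {o : Outcome (Finset V)} (ho : o ∈ ((threshSeq c H τ δ ℓ B).run f).support) :
    o.rounds ≤ t + ⌈ℓ⌉₊ + 1 ∧
      o.queries ≤ (t + ⌈ℓ⌉₊) * (Fintype.card V * Fintype.card V) + Fintype.card V := by
  rw [threshSeq, Prog.mem_support_run_ask_bind, filter_table] at ho
  obtain ⟨o₂, ho₂, rfl⟩ := ho
  have h1 := rounds_threshLoop hc hδ1 hb t _ (fullInv_init (δ := δ) h0 hB hcB H).toLoopInv
    (lt_of_le_of_lt (by
      have : 0 < 1 - δ := by linarith
      gcongr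
      exact setCost_mono hc (Finset.filter_subset _ _)) ht) ho₂
  have h2 : (H.image fun x => ({x} : Finset V)).card ≤ Fintype.card V :=
    Finset.card_image_le.trans (Finset.card_le_univ _)
  rw [Nat.sub_zero] at h1
  exact ⟨by dsimp only; omega, by dsimp only; omega⟩

end ThreshSeq

end

noncomputable section

/-! ## Parallel runs -/

section Parallel

variable {V : Type} [DecidableEq V]

theorem pexp_parAll_cons {α : Type} (P : Prog V α) (l : List (Prog V α)) (f : Finset V → ℝ)
    {G : List α → ℝ} (hG : IsBdd G) :
    pexp ((Prog.parAll (P :: l)).law f) G =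
      pexp (P.law f) fun a => pexp ((Prog.parAll l).law f) fun L => G (a :: L) := by
  rw [Prog.parAll, Prog.law_bind, Prog.law_par, pexp_bind _ _ hG,
    pexp_bind _ _ (hG.pexp _)]
  refine pexp_congr fun a _ => ?_
  rw [pexp_bind _ _ (hG.pexp _)]
  simp only [pexp_pure, Prog.law_ret]

theorem pexp_parAll_append {α : Type} (l₁ l₂ : List (Prog V α)) (f : Finset V → ℝ)
    {G : List α → ℝ} (hG : IsBdd G) :
    pexp ((Prog.parAll (l₁ ++ l₂)).law f) G =
      pexp ((Prog.parAll l₁).law f) fun L₁ => pexp ((Prog.parAll l₂).law f) fun L₂ =>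
        G (L₁ ++ L₂) := by
  induction l₁ generalizing G with
  | nil => simp [Prog.parAll, Prog.law_ret, pexp_pure]
  | cons P l ih =>
    have hb : IsBdd fun L₁ => pexp ((Prog.parAll l₂).law f) fun L₂ => G (L₁ ++ L₂) := by
      obtain ⟨C, hC⟩ := hG
      refine ⟨C, fun L₁ => abs_le.2 ⟨?_, ?_⟩⟩
      · exact le_pexp ⟨C, fun _ => hC _⟩ fun _ _ => (abs_le.1 (hC _)).1
      · exact pexp_le ⟨C, fun _ => hC _⟩ fun _ _ => (abs_le.1 (hC _)).2
    rw [List.cons_append, pexp_parAll_cons _ _ _ hG, pexp_parAll_cons _ _ _ hb]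
    refine pexp_congr fun a _ => ?_
    rw [ih (hG.comp fun L => a :: L)]
    rfl

open Classical in
/-- The probability of an event. -/
def prob {α : Type*} (μ : PMF α) (p : α → Prop) : ℝ := pexp μ fun a => if p a then 1 else 0

open Classical in
theorem isBdd_indicator {α : Type*} (p : α → Prop) :
    IsBdd fun a => if p a then (1 : ℝ) else 0 :=
  ⟨1, fun a => by dsimp only; split_ifs <;> simp⟩

theorem prob_le_one {α : Type*} (μ : PMF α) (p : α → Prop) : prob μ p ≤ 1 :=
  pexp_le (isBdd_indicator p) fun a _ => by split_ifs <;> simp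

theorem prob_nonneg {α : Type*} (μ : PMF α) (p : α → Prop) : 0 ≤ prob μ p :=
  le_pexp (isBdd_indicator p) fun a _ => by split_ifs <;> simp

open Classical in
theorem le_prob_parAll_replicate {α : Type} (P : Prog V α) (f : Finset V → ℝ) (p : α → Prop)
    (r : ℕ) : 1 - (1 - prob (P.law f) p) ^ r ≤
      prob ((Prog.parAll (List.replicate r P)).law f) fun L => ∃ a ∈ L, p a := by
  induction r with
  | zero => simpa using prob_nonneg _ _
  | succ r ih =>
    set u := prob ((Prog.parAll (List.replicate r P)).law f) fun L => ∃ a ∈ L, p a with hu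
    set π := prob (P.law f) p with hπ
    have hu1 : u ≤ 1 := prob_le_one _ _
    have hπ1 : π ≤ 1 := prob_le_one _ _
    have e : prob ((Prog.parAll (List.replicate (r + 1) P)).law f) (fun L => ∃ a ∈ L, p a) =
        u + (1 - u) * π := by
      have h1 : ∀ a, (prob ((Prog.parAll (List.replicate r P)).law f) fun L =>
          ∃ b ∈ a :: L, p b) = u + (1 - u) * if p a then 1 else 0 := by
        intro a
        by_cases ha : p a
        · simp [prob, ha, pexp_const]
        · simp only [List.mem_cons, exists_eq_or_imp, ha, false_or, if_false, mul_zero, add_zero,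
            hu]
      rw [prob, List.replicate_succ, pexp_parAll_cons _ _ _ (isBdd_indicator _)]
      refine (pexp_congr fun a _ => h1 a).trans ?_
      rw [pexp_add _ (isBdd_const _) ((isBdd_indicator p).const_mul _), pexp_const, pexp_const_mul]
      rfl
    rw [e, pow_succ]
    nlinarith

theorem le_pexp_parAll_block {α : Type} (P : Prog V α) (f : Finset V → ℝ) (p : α → Prop)
    (l₁ l₂ : List (Prog V α)) (r : ℕ) {G : List α → ℝ} (hG : IsBdd G) (hG0 : ∀ L, 0 ≤ G L)
    {m : ℝ} (hm : 0 ≤ m)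
    (h : ∀ L, (∃ a ∈ L, p a) → m ≤ G L) :
    m * (1 - (1 - prob (P.law f) p) ^ r) ≤
      pexp ((Prog.parAll (l₁ ++ (List.replicate r P ++ l₂))).law f) G := by
  classical
  rw [pexp_parAll_append _ _ _ hG]
  obtain ⟨C, hC⟩ := hG
  refine le_pexp ⟨C, fun L₁ => abs_le.2 ⟨le_pexp ⟨C, fun _ => hC _⟩ fun _ _ => (abs_le.1 (hC _)).1,
    pexp_le ⟨C, fun _ => hC _⟩ fun _ _ => (abs_le.1 (hC _)).2⟩⟩ fun L₁ _ => ?_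
  rw [pexp_parAll_append _ _ _ ⟨C, fun _ => hC _⟩]
  refine (mul_le_mul_of_nonneg_left (le_prob_parAll_replicate P f p r) hm).trans ?_
  rw [prob, ← pexp_const_mul]
  refine pexp_mono ((isBdd_indicator _).const_mul _) ⟨C, fun L₂ => abs_le.2 ⟨le_pexp
    ⟨C, fun _ => hC _⟩ fun _ _ => (abs_le.1 (hC _)).1,
    pexp_le ⟨C, fun _ => hC _⟩ fun _ _ => (abs_le.1 (hC _)).2⟩⟩ fun L₂ _ => ?_
  refine le_pexp ⟨C, fun _ => hC _⟩ fun L₃ _ => ?_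
  split_ifs with hL
  · obtain ⟨a, ha, hp⟩ := hL
    rw [mul_one]
    exact h _ ⟨a, by simp [ha], hp⟩
  · rw [mul_zero]
    exact hG0 _

theorem le_pexp_parAll_mem {α : Type} {P : Prog V α} (f : Finset V → ℝ) {l : List (Prog V α)}
    (hP : P ∈ l) {G : List α → ℝ} (hG : IsBdd G) {g : α → ℝ} (hg : IsBdd g)
    (h : ∀ L, ∀ a ∈ L, g a ≤ G L) :
    pexp (P.law f) g ≤ pexp ((Prog.parAll l).law f) G := by
  obtain ⟨l₁, l₂, rfl⟩ := List.append_of_mem hP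
  rw [pexp_parAll_append _ _ _ hG]
  obtain ⟨C, hC⟩ := hG
  refine le_pexp ⟨C, fun L₁ => abs_le.2 ⟨le_pexp ⟨C, fun _ => hC _⟩ fun _ _ => (abs_le.1 (hC _)).1,
    pexp_le ⟨C, fun _ => hC _⟩ fun _ _ => (abs_le.1 (hC _)).2⟩⟩ fun L₁ _ => ?_
  rw [pexp_parAll_cons _ _ _ ⟨C, fun _ => hC _⟩]
  refine pexp_mono hg ⟨C, fun L₂ => abs_le.2 ⟨le_pexp
    ⟨C, fun _ => hC _⟩ fun _ _ => (abs_le.1 (hC _)).1,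
    pexp_le ⟨C, fun _ => hC _⟩ fun _ _ => (abs_le.1 (hC _)).2⟩⟩ fun a _ => ?_
  exact le_pexp ⟨C, fun _ => hC _⟩ fun L₃ _ => h _ a (by simp)

/-- The rounds and queries of parallel runs. -/
theorem rounds_parAll {α : Type} {f : Finset V → ℝ} {R Q : ℕ} (l : List (Prog V α))
    (h : ∀ P ∈ l, ∀ o ∈ (P.run f).support, o.rounds ≤ R ∧ o.queries ≤ Q)
    {o : Outcome (List α)} (ho : o ∈ ((Prog.parAll l).run f).support) :
    o.rounds ≤ R ∧ o.queries ≤ l.length * Q := by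
  induction l generalizing o with
  | nil =>
    rw [Prog.parAll, Prog.mem_support_run_ret] at ho
    subst ho
    simp
  | cons P l ih =>
    rw [Prog.parAll, Prog.mem_support_run_bind] at ho
    obtain ⟨o₁, ho₁, o₂, ho₂, rfl⟩ := ho
    rw [Prog.mem_support_run_par] at ho₁
    obtain ⟨o₃, ho₃, o₄, ho₄, rfl⟩ := ho₁
    rw [Prog.mem_support_run_ret] at ho₂
    subst ho₂
    have h1 := h P (by simp) o₃ ho₃
    have h2 := ih (fun P' hP' => h P' (by simp [hP'])) ho₄
    refine ⟨by dsimp only; rw [add_zero]; exact max_le h1.1 h2.1, ?_⟩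
    dsimp only
    rw [List.length_cons, add_zero, add_mul, one_mul]
    omega

theorem mem_support_parAll {α : Type} {f : Finset V → ℝ} {p : α → Prop} (l : List (Prog V α))
    (h : ∀ P ∈ l, ∀ o ∈ (P.run f).support, p o.out)
    {o : Outcome (List α)} (ho : o ∈ ((Prog.parAll l).run f).support) :
    (∀ a ∈ o.out, p a) ∧ o.out.length = l.length := by
  induction l generalizing o with
  | nil =>
    rw [Prog.parAll, Prog.mem_support_run_ret] at ho
    subst ho
    simp
  | cons P l ih =>
    rw [Prog.parAll, Prog.mem_support_run_bind] at ho
    obtain ⟨o₁, ho₁, o₂, ho₂, rfl⟩ := ho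
    rw [Prog.mem_support_run_par] at ho₁
    obtain ⟨o₃, ho₃, o₄, ho₄, rfl⟩ := ho₁
    rw [Prog.mem_support_run_ret] at ho₂
    subst ho₂
    have h1 := h P (by simp) o₃ ho₃
    have h2 := ih (fun P' hP' => h P' (by simp [hP'])) ho₄
    refine ⟨?_, by simpa using h2.2⟩
    intro a ha
    rcases List.mem_cons.1 ha with rfl | ha
    · exact h1
    · exact h2.1 a ha

end Parallel

/-! ### The best candidate for a fixed sample: capped or saturated. -/

section Best

variable {V : Type} [DecidableEq V]

/-- The value of the best of the candidates, given the list of the parallel runs. -/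
def bestValue (f : Finset V → ℝ) (x : V) (Sm : Finset V) (L : List (Finset V)) : ℝ :=
  (insert {x} (insert Sm L.toFinset)).sup' (Finset.insert_nonempty _ _) f

theorem isBdd_bestValue [Fintype V] (f : Finset V → ℝ) (x : V) (Sm : Finset V) :
    IsBdd (bestValue f x Sm) :=
  IsBdd.of_comp_finite (β := Finset (Finset V)) (fun s =>
    (insert ({x} : Finset V) (insert Sm s)).sup' (Finset.insert_nonempty _ _) f)
    (fun L : List (Finset V) => L.toFinset)

theorem le_bestValue_of_mem {f : Finset V → ℝ} {x : V} {Sm : Finset V} {L : List (Finset V)}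
    {S : Finset V} (h : S ∈ L) : f S ≤ bestValue f x Sm L :=
  Finset.le_sup' f (by simp [h])

theorem singleton_le_bestValue {f : Finset V → ℝ} {x : V} {Sm : Finset V}
    {L : List (Finset V)} : f {x} ≤ bestValue f x Sm L :=
  Finset.le_sup' f (by simp)

theorem small_le_bestValue {f : Finset V → ℝ} {x : V} {Sm : Finset V}
    {L : List (Finset V)} : f Sm ≤ bestValue f x Sm L :=
  Finset.le_sup' f (by simp)

theorem maximizer_mem {β : Type} (g : β → ℝ) (s : Finset β) (h : s.Nonempty) :
    maximizer g s h ∈ s := (s.exists_max_image g h).choose_spec.1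

theorem le_maximizer {β : Type} (g : β → ℝ) (s : Finset β) (h : s.Nonempty) {b : β}
    (hb : b ∈ s) : g b ≤ g (maximizer g s h) := (s.exists_max_image g h).choose_spec.2 b hb

theorem pexp_bestOf [Fintype V] (f : Finset V → ℝ) (s : Finset (Finset V)) (h : s.Nonempty) :
    pexp ((bestOf s h).law f) f = s.sup' h f := by
  rw [bestOf, Prog.law_ask_bind, Prog.law_ret, pexp_pure]
  have h1 := maximizer_mem (fun S => if S ∈ s then f S else 0) s h
  refine le_antisymm (Finset.le_sup' f h1) (Finset.sup'_le h f fun S hS => ?_)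
  have h2 := le_maximizer (fun S => if S ∈ s then f S else 0) s h hS
  simpa [hS, h1] using h2

theorem threshRuns_mem_list {c : V → ℝ} {B τ₀ δ ℓ : ℝ} {k r : ℕ} {H : Finset V} {P : Prog V (Finset V)}
    (h : P ∈ (List.range (k + 1)).flatMap fun i =>
      List.replicate r (threshSeq c H (τ₀ * (1 - δ) ^ i) δ ℓ B)) :
    ∃ i ≤ k, P = threshSeq c H (τ₀ * (1 - δ) ^ i) δ ℓ B := by
  rw [List.mem_flatMap] at h
  obtain ⟨i, hi, h⟩ := h
  exact ⟨i, by simpa [Nat.lt_succ_iff] using hi, List.eq_of_mem_replicate h⟩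

theorem threshRuns_list_split (c : V → ℝ) (B τ₀ δ ℓ : ℝ) {k : ℕ} (r : ℕ) (H : Finset V) {i : ℕ}
    (hi : i ≤ k) :
    ∃ l₁ l₂, ((List.range (k + 1)).flatMap fun i =>
      List.replicate r (threshSeq c H (τ₀ * (1 - δ) ^ i) δ ℓ B)) =
      l₁ ++ (List.replicate r (threshSeq c H (τ₀ * (1 - δ) ^ i) δ ℓ B) ++ l₂) := by
  obtain ⟨s, t, hst⟩ := List.append_of_mem (List.mem_range.2 (Nat.lt_succ_of_le hi))
  rw [hst, List.flatMap_append, List.flatMap_cons]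
  exact ⟨_, _, rfl⟩

/-- For every threshold, either the value of the best candidate is large or there is a set of
small cost and small value that `ThreshSeq` cannot extend. -/
theorem threshRuns_dichotomy [Fintype V] {f : Finset V → ℝ} (hf0 : ∀ S, 0 ≤ f S)
    (hf : IsSubmodular f) {c : V → ℝ} (hc : ∀ x, 0 < c x) {B τ₀ δ σ : ℝ} (hB : 0 < B)
    (hcB : ∀ x, c x ≤ B) (hτ : 0 ≤ τ₀) (hδ0 : 0 < δ) (hδ : δ < 1) (hσ : 0 < σ) {k r : ℕ}
    (hr : (1 - δ) ^ r ≤ δ) (x : V) (Sm H : Finset V) {i : ℕ} (hi : i ≤ k) {a : ℝ}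
    (ha : a = pexp ((threshRuns c B τ₀ δ (δ ^ 2)⁻¹ k r H).law f) (bestValue f x Sm))
    (hlt : a < (1 - δ) ^ 3 * (σ * B * (τ₀ * (1 - δ) ^ i))) :
    ∃ S ⊆ H, (1 - δ) * zeroAtEmpty f S ≤ a ∧ ∀ K ⊆ H, (∀ y ∈ K, c y ≤ (1 - σ) * B) →
      zeroAtEmpty f (S ∪ K) ≤ (1 + δ) * zeroAtEmpty f S + τ₀ * (1 - δ) ^ i * setCost c K := by
  classical
  have hd : 0 < 1 - δ := by linarith
  have hbd := isBdd_bestValue f x Sm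
  have hG0 : ∀ L, 0 ≤ bestValue f x Sm L := fun L => (hf0 _).trans singleton_le_bestValue
  have ha0 : 0 ≤ a := by rw [ha]; exact le_pexp hbd fun L _ => hG0 L
  set τ := τ₀ * (1 - δ) ^ i with hτdef
  have hτ0 : 0 ≤ τ := by positivity
  set P := threshSeq c H τ δ (δ ^ 2)⁻¹ B with hP
  have hrun : P.run f = P.run (zeroAtEmpty f) :=
    run_threshSeq_congr (fun T hT => (zeroAtEmpty_of_ne f hT).symm) c H τ δ _ B
  have hlaw : P.law f = P.law (zeroAtEmpty f) := by rw [Prog.law, Prog.law, hrun]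
  obtain ⟨l₁, l₂, hsplit⟩ := threshRuns_list_split c B τ₀ δ (δ ^ 2)⁻¹ r H hi
  rw [← hτdef, ← hP] at hsplit
  have hrpos : 0 < r := by
    rcases Nat.eq_zero_or_pos r with h0 | h0
    · rw [h0, pow_zero] at hr; linarith
    · exact h0
  have hEf : pexp (P.law f) f ≤ a := by
    rw [ha]
    refine le_pexp_parAll_mem f ?_ hbd (IsBdd.of_finite f) fun L S hS => le_bestValue_of_mem hS
    rw [hsplit]
    simp [hrpos.ne']
  have hEc : (1 - δ) ^ 2 * τ * pexp (P.law f) (setCost c) ≤ a := by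
    have h1 := pexp_setCost_threshSeq_le (f := zeroAtEmpty f) (zeroAtEmpty_empty f) hc hB.le hcB
      hτ0 hδ0.le hδ.le (ℓ := (δ ^ 2)⁻¹) H
    rw [← hP, ← hlaw] at h1
    exact (h1.trans (pexp_mono (IsBdd.of_finite _) (IsBdd.of_finite _)
      fun S _ => zeroAtEmpty_le hf0 S)).trans hEf
  have hτpos : 0 < τ := by
    rcases hτ0.lt_or_eq with h | h
    · exact h
    · rw [← h] at hlt; simp at hlt; linarith
  set π := prob (P.law f) fun S => setCost c S < σ * B with hπ
  have hσB : 0 < σ * B := by positivity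
  have hMarkov : σ * B * (1 - π) ≤ pexp (P.law f) (setCost c) := by
    have h1 : σ * B * (1 - π) = pexp (P.law f) fun S =>
        σ * B + (-(σ * B)) * (if setCost c S < σ * B then 1 else 0) := by
      rw [pexp_add _ (isBdd_const _) ((isBdd_indicator _).const_mul _), pexp_const,
        pexp_const_mul, hπ, prob]
      ring
    rw [h1]
    refine pexp_mono (IsBdd.of_finite _) (IsBdd.of_finite _) fun S _ => ?_
    split_ifs with h2
    · have := setCost_nonneg hc S
      linarith
    · linarith
  -- Otherwise Markov's inequality would make the mean cost at least `(1-δ)σB`, and then `hEc` would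
  -- push `a` above the bound in `hlt`.
  have hπδ : δ < π := by
    by_contra hle
    rw [not_lt] at hle
    have h1 : σ * B * (1 - δ) ≤ pexp (P.law f) (setCost c) :=
      (mul_le_mul_of_nonneg_left (by linarith) hσB.le).trans hMarkov
    have h2 : (1 - δ) ^ 2 * τ * (σ * B * (1 - δ)) ≤ a :=
      (mul_le_mul_of_nonneg_left h1 (by positivity)).trans hEc
    linarith [show (1 - δ) ^ 2 * τ * (σ * B * (1 - δ)) = (1 - δ) ^ 3 * (σ * B * τ) by ring]
  set good : Finset (Finset V) := Finset.univ.filter fun S => S ∈ (P.law f).support ∧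
    setCost c S < σ * B with hgood
  have hπg : π = prob (P.law f) fun S => S ∈ good := by
    rw [hπ, prob, prob]
    refine pexp_congr fun S hS => ?_
    have : S ∈ good ↔ setCost c S < σ * B := by
      rw [hgood, Finset.mem_filter]
      exact ⟨fun h => h.2.2, fun h => ⟨Finset.mem_univ _, hS, h⟩⟩
    simp only [this]
  have hne : good.Nonempty := by
    rw [Finset.nonempty_iff_ne_empty]
    intro h
    rw [hπg, h, prob] at hπδ
    simp only [Finset.notMem_empty, if_false, pexp_const] at hπδ
    linarith
  -- The least valuable output among the cheap ones. With probability at least `1 - (1-π)^r ≥ 1 - δ`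
  -- one of the `r` runs is cheap, and it is worth at least as much as this `S`.
  obtain ⟨S, hS, hmin⟩ := good.exists_min_image (zeroAtEmpty f) hne
  rw [hgood, Finset.mem_filter, Prog.mem_support_law] at hS
  obtain ⟨-, ⟨o, ho, rfl⟩, hSc⟩ := hS
  rw [hrun] at ho
  obtain ⟨h1, h2, h3⟩ := threshSeq_union_le (zeroAtEmpty_nonneg hf0) (hf.zeroAtEmpty hf0)
    (zeroAtEmpty_empty f) hc hB.le hcB hτ0 hδ0 hδ.le ho
  refine ⟨o.out, h1, ?_, fun K hK hKc => h3 K hK fun y hy => ?_⟩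
  · have h4 := le_pexp_parAll_block P f (fun S => S ∈ good) l₁ l₂ r hbd hG0
      (zeroAtEmpty_nonneg hf0 o.out) (fun L ⟨S', hS', hp⟩ => (hmin S' hp).trans
        ((zeroAtEmpty_le hf0 S').trans (le_bestValue_of_mem hS')))
    rw [← hsplit, ← hπg] at h4
    have hπ1 : π ≤ 1 := prob_le_one _ _
    have h5 : (1 - π) ^ r ≤ δ :=
      (pow_le_pow_left₀ (by linarith) (by linarith) r).trans hr
    have h6 : zeroAtEmpty f o.out * (1 - δ) ≤ zeroAtEmpty f o.out * (1 - (1 - π) ^ r) :=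
      mul_le_mul_of_nonneg_left (by linarith) (zeroAtEmpty_nonneg hf0 _)
    rw [ha, mul_comm]
    exact h6.trans h4
  · linarith [hKc y hy]

/-- The dichotomy after the choice of the threshold. -/
theorem threshRuns_capped_or_saturated [Fintype V] {f : Finset V → ℝ} (hf0 : ∀ S, 0 ≤ f S)
    (hf : IsSubmodular f) {c : V → ℝ} (hc : ∀ x, 0 < c x) {B δ σ α n : ℝ} (hB : 0 < B)
    (hcB : ∀ x, c x ≤ B) (hα0 : 0 ≤ α) (hα : α ≤ 1) (hn : 0 < n) (hδ0 : 0 < δ) (hδ : δ < 1)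
    (hσ : 0 < σ) (hσ1 : σ ≤ 1) {k r : ℕ}
    (hr : (1 - δ) ^ r ≤ δ) (hk : (1 - δ) ^ k * n ≤ 1) (x : V) (Sm H : Finset V) {a : ℝ}
    (ha : a = pexp ((threshRuns c B (α * n * (f {x} / B)) δ (δ ^ 2)⁻¹ k r H).law f)
      (bestValue f x Sm)) :
    α * σ * n * f {x} ≤ a / (1 - δ) ^ 4 ∨
      ∃ S ⊆ H, ∀ K ⊆ H, (∀ y ∈ K, c y ≤ (1 - σ) * B) →
        zeroAtEmpty f (S ∪ K) ≤ a / (1 - δ) ^ 4 * (1 + setCost c K / (σ * B)) := by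
  have hd : 0 < 1 - δ := by linarith
  have hd1 : 1 - δ ≤ 1 := by linarith
  have hbd := isBdd_bestValue f x Sm
  have hxa : f {x} ≤ a := by
    rw [ha]; exact le_pexp hbd fun L _ => singleton_le_bestValue
  have hx0 := hf0 {x}
  have ha0 : 0 ≤ a := hx0.trans hxa
  set τ₀ := α * n * (f {x} / B) with hτ₀
  have hτ0 : 0 ≤ τ₀ := by positivity
  have hp4 : 0 < (1 - δ) ^ 4 := by positivity
  by_cases h0 : (1 - δ) ^ 3 * (σ * B * (τ₀ * (1 - δ) ^ 0)) ≤ a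
  · left
    rw [le_div_iff₀ hp4]
    have e : (1 - δ) ^ 3 * (σ * B * (τ₀ * (1 - δ) ^ 0)) = α * σ * n * f {x} * (1 - δ) ^ 3 := by
      rw [hτ₀]; field_simp
    rw [e] at h0
    refine le_trans ?_ h0
    exact mul_le_mul_of_nonneg_left (pow_le_pow_of_le_one hd.le hd1 (by norm_num)) (by positivity)
  · right
    rw [not_le] at h0
    -- The last index at which `a` is still below the bound. It lies on the grid, because at `i = k`
    -- the quantity `σBτ` has dropped to at most `f {x} ≤ a`.
    obtain ⟨i, hi, hlt, hnext⟩ : ∃ i ≤ k, a < (1 - δ) ^ 3 * (σ * B * (τ₀ * (1 - δ) ^ i)) ∧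
        (1 - δ) ^ 4 * (σ * B * (τ₀ * (1 - δ) ^ i)) ≤ a := by
      by_contra hcon
      push Not at hcon
      have hall : ∀ i ≤ k, a < (1 - δ) ^ 3 * (σ * B * (τ₀ * (1 - δ) ^ i)) := by
        intro i
        induction i with
        | zero => exact fun _ => h0
        | succ i ih =>
          intro hi
          have h1 := hcon i (by omega) (ih (by omega))
          calc a < (1 - δ) ^ 4 * (σ * B * (τ₀ * (1 - δ) ^ i)) := h1
            _ = _ := by ring
      have h1 := hcon k le_rfl (hall k le_rfl)
      have h2 : (1 - δ) ^ 4 * (σ * B * (τ₀ * (1 - δ) ^ k)) =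
          ((1 - δ) ^ 4 * σ * α) * (f {x} * ((1 - δ) ^ k * n)) := by
        rw [hτ₀]; field_simp
      have h3 : f {x} * ((1 - δ) ^ k * n) ≤ f {x} := by
        simpa using mul_le_mul_of_nonneg_left hk hx0
      have h4 : (1 - δ) ^ 4 * σ * α ≤ 1 :=
        mul_le_one₀ (mul_le_one₀ (pow_le_one₀ hd.le hd1) hσ.le hσ1) hα0 hα
      have h5 : ((1 - δ) ^ 4 * σ * α) * (f {x} * ((1 - δ) ^ k * n)) ≤ 1 * f {x} :=
        mul_le_mul h4 h3 (by positivity) (by norm_num)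
      linarith
    obtain ⟨S, hSH, hSa, hSK⟩ := threshRuns_dichotomy hf0 hf hc hB hcB hτ0 hδ0 hδ hσ hr x Sm H hi
      ha hlt
    refine ⟨S, hSH, fun K hK hKc => (hSK K hK hKc).trans ?_⟩
    have hz := zeroAtEmpty_nonneg hf0 S
    have h1 : (1 + δ) * zeroAtEmpty f S ≤ a / (1 - δ) ^ 4 := by
      rw [le_div_iff₀ hp4]
      have h2 : (1 + δ) * (1 - δ) ^ 3 ≤ 1 := by
        have h3 : (1 + δ) * (1 - δ) ≤ 1 := by nlinarith
        have h4 : (1 - δ) ^ 2 ≤ 1 := pow_le_one₀ hd.le hd1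
        calc (1 + δ) * (1 - δ) ^ 3 = ((1 + δ) * (1 - δ)) * (1 - δ) ^ 2 := by ring
          _ ≤ 1 * 1 := mul_le_mul h3 h4 (by positivity) (by norm_num)
          _ = 1 := by norm_num
      calc (1 + δ) * zeroAtEmpty f S * (1 - δ) ^ 4 =
          ((1 + δ) * (1 - δ) ^ 3) * ((1 - δ) * zeroAtEmpty f S) := by ring
        _ ≤ 1 * a := mul_le_mul h2 hSa (by positivity) (by norm_num)
        _ = a := one_mul a
    have h2 : τ₀ * (1 - δ) ^ i * setCost c K ≤ a / (1 - δ) ^ 4 * (setCost c K / (σ * B)) := by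
      have h3 : τ₀ * (1 - δ) ^ i ≤ a / (1 - δ) ^ 4 / (σ * B) := by
        rw [le_div_iff₀ (by positivity), le_div_iff₀ hp4]
        linarith
      calc _ ≤ a / (1 - δ) ^ 4 / (σ * B) * setCost c K :=
            mul_le_mul_of_nonneg_right h3 (setCost_nonneg hc K)
        _ = _ := by ring
    linarith

end Best

end

noncomputable section

/-! ## Independent sampling -/

section Sampling

variable {V : Type} [DecidableEq V]

/-- The expected value of `g H` when `H` contains each element of `X` independently with
probability `p`. -/
def bernSum (p : ℝ) (X : Finset V) (g : Finset V → ℝ) : ℝ :=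
  ∑ H ∈ X.powerset, p ^ H.card * (1 - p) ^ (X.card - H.card) * g H

@[simp] theorem bernSum_empty (p : ℝ) (g : Finset V → ℝ) : bernSum p ∅ g = g ∅ := by
  simp [bernSum]

theorem bernSum_insert (p : ℝ) {x : V} {X : Finset V} (hx : x ∉ X) (g : Finset V → ℝ) :
    bernSum p (insert x X) g =
      p * bernSum p X (fun H => g (insert x H)) + (1 - p) * bernSum p X g := by
  rw [bernSum, Finset.sum_powerset_insert hx, add_comm, bernSum, bernSum, Finset.mul_sum,
    Finset.mul_sum, Finset.card_insert_of_notMem hx]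
  congr 1 <;> refine Finset.sum_congr rfl fun H hH => ?_
  · rw [Finset.mem_powerset] at hH
    rw [Finset.card_insert_of_notMem fun h => hx (hH h), Nat.add_sub_add_right, pow_succ]
    ring
  · rw [Finset.mem_powerset] at hH
    have h1 := Finset.card_le_card hH
    rw [show X.card + 1 - H.card = (X.card - H.card) + 1 by omega, pow_succ]
    ring

theorem bernSum_add (p : ℝ) (X : Finset V) (g h : Finset V → ℝ) :
    bernSum p X (fun H => g H + h H) = bernSum p X g + bernSum p X h := by
  simp only [bernSum, mul_add, Finset.sum_add_distrib]

theorem bernSum_const_mul (p : ℝ) (X : Finset V) (a : ℝ) (g : Finset V → ℝ) :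
    bernSum p X (fun H => a * g H) = a * bernSum p X g := by
  rw [bernSum, bernSum, Finset.mul_sum]
  exact Finset.sum_congr rfl fun _ _ => by ring

theorem bernSum_const (p : ℝ) (X : Finset V) (a : ℝ) : bernSum p X (fun _ => a) = a := by
  induction X using Finset.induction_on with
  | empty => simp
  | insert x X hx ih => rw [bernSum_insert p hx, ih]; ring

theorem bernSum_congr {p : ℝ} {X : Finset V} {g h : Finset V → ℝ} (H : ∀ S ⊆ X, g S = h S) :
    bernSum p X g = bernSum p X h :=
  Finset.sum_congr rfl fun S hS => by rw [H S (Finset.mem_powerset.1 hS)]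

theorem bernSum_mono {p : ℝ} (hp0 : 0 ≤ p) (hp1 : p ≤ 1) {X : Finset V} {g h : Finset V → ℝ}
    (H : ∀ S ⊆ X, g S ≤ h S) : bernSum p X g ≤ bernSum p X h := by
  have h1 : 0 ≤ 1 - p := by linarith
  exact Finset.sum_le_sum fun S hS =>
    mul_le_mul_of_nonneg_left (H S (Finset.mem_powerset.1 hS)) (by positivity)

theorem bernSum_union (p : ℝ) {X Y : Finset V} (h : Disjoint X Y) (g : Finset V → ℝ) :
    bernSum p (X ∪ Y) g = bernSum p X fun K => bernSum p Y fun G => g (K ∪ G) := by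
  induction X using Finset.induction_on generalizing g with
  | empty => simp
  | insert x X hx ih =>
    rw [Finset.disjoint_insert_left] at h
    rw [Finset.insert_union, bernSum_insert p (by simp [hx, h.1]), ih h.2, ih h.2,
      bernSum_insert p hx]
    simp only [Finset.insert_union]

theorem bernSum_mem (p : ℝ) {X : Finset V} {z : V} (hz : z ∈ X) :
    bernSum p X (fun H => if z ∈ H then 1 else 0) = p := by
  rw [← Finset.insert_erase hz, bernSum_insert p (Finset.notMem_erase z X)]
  have h1 : bernSum p (X.erase z) (fun H => if z ∈ H then (1 : ℝ) else 0) = 0 := by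
    rw [bernSum_congr (h := fun _ => 0), bernSum_const]
    intro S hS
    rw [if_neg fun h => Finset.notMem_erase z X (hS h)]
  simp [h1, bernSum_const]

/-- The first two moments of a weighted sum of independent coins. -/
theorem bernSum_moments (p : ℝ) (X : Finset V) (z : V → ℝ) :
    bernSum p X (fun H => ∑ o ∈ H, z o) = p * ∑ o ∈ X, z o ∧
    bernSum p X (fun H => (∑ o ∈ H, z o) ^ 2) =
      p * (1 - p) * ∑ o ∈ X, z o ^ 2 + (p * ∑ o ∈ X, z o) ^ 2 := by
  induction X using Finset.induction_on with
  | empty => simp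
  | insert x X hx ih =>
    obtain ⟨ih1, ih2⟩ := ih
    have e1 : bernSum p X (fun H => ∑ o ∈ insert x H, z o) = z x + p * ∑ o ∈ X, z o := by
      rw [bernSum_congr (h := fun H => z x + ∑ o ∈ H, z o)
        (fun S hS => Finset.sum_insert fun h => hx (hS h)), bernSum_add, bernSum_const, ih1]
    have e2 : bernSum p X (fun H => (∑ o ∈ insert x H, z o) ^ 2) = z x ^ 2 +
        (2 * z x * (p * ∑ o ∈ X, z o) + (p * (1 - p) * ∑ o ∈ X, z o ^ 2 +
          (p * ∑ o ∈ X, z o) ^ 2)) := by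
      rw [bernSum_congr (h := fun H => z x ^ 2 + (2 * z x * (∑ o ∈ H, z o) + (∑ o ∈ H, z o) ^ 2))
        (fun S hS => by rw [Finset.sum_insert fun h => hx (hS h)]; ring), bernSum_add,
        bernSum_const, bernSum_add, bernSum_const_mul, ih1, ih2]
    rw [bernSum_insert p hx, bernSum_insert p hx, e1, e2, ih1, ih2, Finset.sum_insert hx,
      Finset.sum_insert hx]
    constructor <;> ring

theorem pexp_coin {p : ℝ} (hp0 : 0 ≤ p) (hp1 : p ≤ 1) (g : Bool → ℝ) :
    pexp (coin p) g = p * g true + (1 - p) * g false := by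
  have h1 : min (ENNReal.ofReal p) 1 = ENNReal.ofReal p :=
    min_eq_left (ENNReal.ofReal_le_one.2 hp1)
  rw [pexp_fintype]
  simp only [Fintype.sum_bool, coin, PMF.ofFintype_apply, h1, if_true]
  rw [ENNReal.toReal_ofReal hp0]
  simp [ENNReal.toReal_sub_of_le (ENNReal.ofReal_le_one.2 hp1), ENNReal.toReal_ofReal hp0]

theorem pexp_sampleList [Fintype V] {p : ℝ} (hp0 : 0 ≤ p) (hp1 : p ≤ 1) {l : List V}
    (hl : l.Nodup) (g : Finset V → ℝ) :
    pexp (sampleList p l) g = bernSum p l.toFinset g := by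
  induction l generalizing g with
  | nil => simp [sampleList, pexp_pure]
  | cons x l ih =>
    rw [List.nodup_cons] at hl
    rw [sampleList, pexp_bind _ _ (IsBdd.of_finite g), pexp_coin hp0 hp1, List.toFinset_cons,
      bernSum_insert p (by simpa using hl.1), ← ih hl.2, ← ih hl.2,
      pexp_bind _ _ (IsBdd.of_finite g), pexp_bind _ _ (IsBdd.of_finite g)]
    simp only [pexp_pure, if_true, Bool.false_eq_true, if_false]

theorem pexp_sampleSubset [Fintype V] {p : ℝ} (hp0 : 0 ≤ p) (hp1 : p ≤ 1) (X : Finset V)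
    (g : Finset V → ℝ) : pexp (sampleSubset p X) g = bernSum p X g := by
  rw [sampleSubset, pexp_sampleList hp0 hp1 X.nodup_toList, Finset.toList_toFinset]

theorem sampleList_subset {p : ℝ} {l : List V} {H : Finset V}
    (h : H ∈ (sampleList p l).support) : H ⊆ l.toFinset := by
  induction l generalizing H with
  | nil => simp [sampleList] at h; simp [h]
  | cons x l ih =>
    simp only [sampleList, PMF.mem_support_bind_iff, PMF.mem_support_pure_iff] at h
    obtain ⟨b, -, H', hH', rfl⟩ := h
    have := ih hH'
    rw [List.toFinset_cons]
    split_ifs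
    · exact Finset.insert_subset_insert _ this
    · exact this.trans (Finset.subset_insert _ _)

theorem sampleSubset_subset {p : ℝ} {X H : Finset V}
    (h : H ∈ (sampleSubset p X).support) : H ⊆ X := by
  simpa using sampleList_subset h

/-- A random set that contains no element with probability more than `P` keeps, for a
non-negative submodular function, all but a fraction `P` of the value of the empty set. -/
theorem le_sum_weighted_of_prob_le {ι : Type*} (I : Finset ι) {ω : ι → ℝ} (hω : ∀ i ∈ I, 0 ≤ ω i)
    {h : Finset V → ℝ} (h0 : ∀ S, 0 ≤ h S) (hs : IsSubmodular h) {P : ℝ} (M : Finset V)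
    (R : ι → Finset V) {t : ℝ} (hR : ∀ i ∈ I, R i ⊆ M) (htP : t ≤ P)
    (hπ : ∀ z ∈ M, t ≤ (∑ i ∈ I, if z ∈ R i then ω i else 0) ∧
      (∑ i ∈ I, if z ∈ R i then ω i else 0) ≤ P) :
    ((∑ i ∈ I, ω i) - P) * h ∅ + t * h M ≤ ∑ i ∈ I, ω i * h (R i) := by
  induction hn : M.card generalizing M R t with
  | zero =>
    rw [Finset.card_eq_zero] at hn
    subst hn
    have h1 : ∑ i ∈ I, ω i * h (R i) = (∑ i ∈ I, ω i) * h ∅ := by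
      rw [Finset.sum_mul]
      exact Finset.sum_congr rfl fun i hi => by rw [Finset.subset_empty.1 (hR i hi)]
    rw [h1]
    nlinarith [h0 ∅]
  | succ n ih =>
    have hM : M.Nonempty := Finset.card_pos.1 (by omega)
    -- Peel off the element of least probability `π`. Its marginals are at least the one at `M ∖ z`,
    -- and they occur with weight `π`; with the inductive term `π h(M ∖ z)` they telescope to `π
    -- h(M)`. The parameter `t` serves only this induction.
    obtain ⟨z, hz, hmin⟩ := M.exists_min_image
      (fun z => ∑ i ∈ I, if z ∈ R i then ω i else 0) hM
    set π := ∑ i ∈ I, if z ∈ R i then ω i else 0 with hπdef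
    have h1 := ih (M.erase z) (fun i => (R i).erase z) (t := π)
      (fun i hi => Finset.erase_subset_erase _ (hR i hi)) (hπ z hz).2 (fun y hy => by
        rw [Finset.mem_erase] at hy
        have e : (∑ i ∈ I, if y ∈ (R i).erase z then ω i else 0) =
            ∑ i ∈ I, if y ∈ R i then ω i else 0 :=
          Finset.sum_congr rfl fun i _ => by simp [hy.1]
        rw [e]
        exact ⟨hmin y hy.2, (hπ y hy.2).2⟩) (by rw [Finset.card_erase_of_mem hz]; omega)
    have h2 : ∑ i ∈ I, ω i * h ((R i).erase z) + π * (h M - h (M.erase z)) ≤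
        ∑ i ∈ I, ω i * h (R i) := by
      rw [hπdef, Finset.sum_mul, ← Finset.sum_add_distrib]
      refine Finset.sum_le_sum fun i hi => ?_
      by_cases hzi : z ∈ R i
      · rw [if_pos hzi, ← mul_add]
        refine mul_le_mul_of_nonneg_left ?_ (hω i hi)
        have h3 := hs _ _ (Finset.erase_subset_erase z (hR i hi)) z (Finset.notMem_erase z M)
        rw [marginal, marginal, Finset.insert_erase hz, Finset.insert_erase hzi] at h3
        linarith
      · rw [if_neg hzi, zero_mul, add_zero, Finset.erase_eq_of_notMem hzi]
    have h4 : t * h M ≤ π * h M := mul_le_mul_of_nonneg_right (hπ z hz).1 (h0 M)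
    linarith

/-- Since `R G ⊆ G`, each element lies in `R G` with probability at most `p`, however `R` correlates
them. -/
theorem le_bernSum_of_subset {p : ℝ} (hp0 : 0 ≤ p) (hp1 : p ≤ 1) {h : Finset V → ℝ}
    (h0 : ∀ S, 0 ≤ h S) (hs : IsSubmodular h) (M : Finset V) (R : Finset V → Finset V)
    (hR : ∀ G ⊆ M, R G ⊆ G) :
    (1 - p) * h ∅ ≤ bernSum p M fun G => h (R G) := by
  have h1p : 0 ≤ 1 - p := by linarith
  have hw : ∀ G ∈ M.powerset, 0 ≤ p ^ G.card * (1 - p) ^ (M.card - G.card) :=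
    fun G _ => by positivity
  have hsum : ∑ G ∈ M.powerset, p ^ G.card * (1 - p) ^ (M.card - G.card) = 1 := by
    simpa [bernSum] using bernSum_const p M 1
  have key := le_sum_weighted_of_prob_le M.powerset hw h0 hs (P := p) M R (t := 0)
    (fun G hG => (hR G (Finset.mem_powerset.1 hG)).trans (Finset.mem_powerset.1 hG)) hp0
    (fun z hz => ⟨Finset.sum_nonneg fun G hG => by
      split_ifs
      · exact hw G hG
      · exact le_rfl, by
      refine le_of_le_of_eq ?_ (bernSum_mem p hz)
      refine Finset.sum_le_sum fun G hG => ?_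
      dsimp only
      by_cases h1 : z ∈ R G
      · rw [if_pos h1, if_pos (hR G (Finset.mem_powerset.1 hG) h1), mul_one]
      · rw [if_neg h1]
        have := hw G hG
        split_ifs <;> simp [this]⟩)
  rw [hsum, zero_mul, add_zero] at key
  exact key

/-- If on every sample either the cap is reached or some sampled set cannot be extended by `K`
at a good rate, then the expected value is large. -/
theorem le_bernSum_of_capped_or_saturated {p : ℝ} (hp0 : 0 ≤ p) (hp1 : p ≤ 1)
    {f a : Finset V → ℝ} (hf0 : ∀ S, 0 ≤ f S) (hf : IsSubmodular f) (K M : Finset V)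
    {w cap D μ v : ℝ} (hD : 0 < D) (hw0 : 0 ≤ w) (hw : ∀ G ⊆ M, w ≤ a (K ∪ G))
    (hcov : ∀ G ⊆ M, cap ≤ a (K ∪ G) ∨ ∃ S ⊆ K ∪ G, f (S ∪ K) ≤ a (K ∪ G) * D)
    (hμ0 : 0 ≤ μ) (hμ1 : μ ≤ 1) (hv0 : 0 ≤ v) (hv : v * D ≤ (1 - μ) * f K)
    (hcap : v + μ * w ≤ cap) :
    μ * w + (1 - p) * v ≤ bernSum p M fun G => a (K ∪ G) := by
  rcases hv0.eq_or_lt with h | hvpos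
  · subst h
    refine (?_ : _ ≤ w).trans ((bernSum_const p M w).symm.le.trans (bernSum_mono hp0 hp1 hw))
    rw [mul_zero, add_zero]
    exact mul_le_of_le_one_left hw0 hμ1
  have hfK : 0 < f K := by
    rcases (hf0 K).eq_or_lt with h | h
    · rw [← h, mul_zero] at hv
      nlinarith
    · exact h
  -- In the capped case `S = ∅` turns the left side into `v + μ w ≤ cap`. In the saturated case
  -- split `a = μ a + (1-μ) a` and bound the first `a` by `w`, the second by `f(S ∪ K)/D`; the part
  -- of the saturated set outside `K` lies in `G`.
  have hex : ∀ G, ∃ S : Finset V, (G ⊆ M → S ⊆ G) ∧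
      (G ⊆ M → v / f K * f (K ∪ S) + μ * w ≤ a (K ∪ G)) := by
    intro G
    by_cases hG : G ⊆ M
    · rcases hcov G hG with h | ⟨S, hS, hSa⟩
      · refine ⟨∅, fun _ => Finset.empty_subset _, fun _ => ?_⟩
        rw [Finset.union_empty, div_mul_cancel₀ _ hfK.ne']
        exact hcap.trans h
      · refine ⟨S \ K, fun _ y hy => ?_, fun _ => ?_⟩
        · rw [Finset.mem_sdiff] at hy
          exact (Finset.mem_union.1 (hS hy.1)).resolve_left hy.2
        · rw [Finset.union_sdiff_self_eq_union, Finset.union_comm]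
          have h1 : v / f K ≤ (1 - μ) / D := by
            rw [div_le_div_iff₀ hfK hD]
            exact hv
          have h2 : v / f K * f (S ∪ K) ≤ (1 - μ) / D * (a (K ∪ G) * D) :=
            mul_le_mul h1 hSa (hf0 _) (by have : 0 ≤ 1 - μ := by linarith
                                          positivity)
          have h3 : (1 - μ) / D * (a (K ∪ G) * D) = (1 - μ) * a (K ∪ G) := by field_simp
          have h4 := mul_le_mul_of_nonneg_left (hw G hG) hμ0
          linarith
    · exact ⟨∅, fun h => absurd h hG, fun h => absurd h hG⟩
  choose R hR1 hR2 using hex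
  have hs : IsSubmodular fun T => f (K ∪ T) := by
    intro S T hST x hx
    by_cases hxK : x ∈ K
    · simp [marginal, Finset.union_insert, hxK]
    · have := hf (K ∪ S) (K ∪ T) (Finset.union_subset_union_right hST) x (by simp [hxK, hx])
      simpa [marginal, Finset.union_insert] using this
  have h1 := le_bernSum_of_subset hp0 hp1 (fun S => hf0 (K ∪ S)) hs M R hR1
  rw [Finset.union_empty] at h1
  have h2 : bernSum p M (fun G => v / f K * f (K ∪ R G) + μ * w) ≤
      bernSum p M fun G => a (K ∪ G) := bernSum_mono hp0 hp1 hR2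
  rw [bernSum_add, bernSum_const, bernSum_const_mul] at h2
  have h3 : v / f K * ((1 - p) * f K) = (1 - p) * v := by field_simp
  have h4 := mul_le_mul_of_nonneg_left h1 (by positivity : 0 ≤ v / f K)
  linarith

/-- A submodular function with `f ∅ = 0` dominates an additive function with the same value of
`O`. -/
theorem exists_additive_le {f : Finset V → ℝ} (hf : IsSubmodular f) (h0 : f ∅ = 0)
    (O : Finset V) :
    ∃ φ : V → ℝ, ∑ o ∈ O, φ o = f O ∧ (∀ K ⊆ O, ∑ o ∈ K, φ o ≤ f K) ∧
      ∀ o ∈ O, φ o ≤ f {o} := by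
  induction O using Finset.induction_on with
  | empty => exact ⟨0, by simp [h0], fun K hK => by simp [Finset.subset_empty.1 hK, h0], by simp⟩
  | insert x O hx ih =>
    obtain ⟨φ, h1, h2, h3⟩ := ih
    have hne : ∀ o ∈ O, o ≠ x := fun o ho h => hx (h ▸ ho)
    -- The greedy vertex of the base polytope: each element receives its marginal in the order of
    -- insertion.
    set ψ := Function.update φ x (f (insert x O) - f O) with hψ
    have hsum : ∀ K ⊆ O, ∑ o ∈ K, ψ o = ∑ o ∈ K, φ o := fun K hK =>
      Finset.sum_congr rfl fun o ho => Function.update_of_ne (hne o (hK ho)) _ _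
    have hx' : ψ x = f (insert x O) - f O := Function.update_self _ _ _
    refine ⟨ψ, ?_, fun K hK => ?_, fun o ho => ?_⟩
    · rw [Finset.sum_insert hx, hsum O subset_rfl, h1, hx']
      ring
    · by_cases hxK : x ∈ K
      · have hK' : K.erase x ⊆ O := by
          intro y hy
          rw [Finset.mem_erase] at hy
          exact (Finset.mem_insert.1 (hK hy.2)).resolve_left hy.1
        have h4 := hf _ _ hK' x hx
        rw [marginal, marginal, Finset.insert_erase hxK] at h4
        rw [← Finset.add_sum_erase K ψ hxK, hsum _ hK', hx']
        linarith [h2 _ hK']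
      · have hK' : K ⊆ O := fun y hy => (Finset.mem_insert.1 (hK hy)).resolve_left
          fun h => hxK (h ▸ hy)
        rw [hsum K hK']
        exact h2 K hK'
    · rcases Finset.mem_insert.1 ho with rfl | ho
      · have h4 := hf ∅ O (Finset.empty_subset _) o hx
        rw [marginal, marginal, insert_empty_eq, h0] at h4
        rw [hx']
        linarith
      · rw [hψ, Function.update_of_ne (hne o ho)]
        exact h3 o ho

end Sampling

end

noncomputable section

/-! ## The numerical inequality -/

section Numeric

/-- Concavity. It reduces inequalities over an interval of `w` or of `Z` to the endpoints, where
they can be checked numerically. -/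
theorem concave_nonneg {a b d u v z : ℝ} (hd : 0 ≤ d) (hu : 0 ≤ a + b * u - d * u ^ 2)
    (hv : 0 ≤ a + b * v - d * v ^ 2) (huz : u ≤ z) (hzv : z ≤ v) :
    0 ≤ a + b * z - d * z ^ 2 := by
  rcases huz.eq_or_lt with rfl | h
  · exact hu
  have h1 : 0 < v - u := by linarith
  have h2 : 0 ≤ (v - u) * (a + b * z - d * z ^ 2) := by
    have e : (v - u) * (a + b * z - d * z ^ 2) = (v - z) * (a + b * u - d * u ^ 2) +
        (z - u) * (a + b * v - d * v ^ 2) + d * ((v - u) * ((z - u) * (v - z))) := by ring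
    rw [e]
    have h3 : 0 ≤ v - z := by linarith
    have h4 : 0 ≤ z - u := by linarith
    positivity
  exact nonneg_of_mul_nonneg_right h2 h1

/-- The hypothesis is the discriminant condition, seen by completing the square in `s - Z`. -/
theorem quadratic_le_line {A γ s a b : ℝ} (hγ : 0 < γ) (h : A ≤ a + b * s - b ^ 2 / (4 * γ))
    (Z : ℝ) : A - γ * (s - Z) ^ 2 ≤ a + b * Z := by
  have h1 : 0 ≤ γ * (s - Z - b / (2 * γ)) ^ 2 := by positivity
  have e : γ * (s - Z - b / (2 * γ)) ^ 2 = γ * (s - Z) ^ 2 - b * (s - Z) + b ^ 2 / (4 * γ) := by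
    field_simp
    ring
  linarith

/-- The data of a quadratic minorant of the value of a sample, for densities `θ ∈ [t0, t1]` and
values `w ∈ [w0, w1]`. -/
structure Minorant where
  -- Values are in units of `f(O)`, costs in units of `B`. Elements costing more than `κ` are
  -- dropped; `m` bounds their number and `ζ` is the weight that survives. The certified value is
  -- compared with `w` left of `za`, with a line of slope `b1` up to `z1` (mixed with `w` at weight
  -- `t`), and with a line of slope `b2` from `z1` to `zc`, truncated at `top`. The quadratic is `A0
  -- + A1 w - γ (s - Z)²`.
  t0 : ℝ
  t1 : ℝ
  w0 : ℝ
  w1 : ℝ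
  κ : ℝ
  z1 : ℝ
  za : ℝ
  zc : ℝ
  b1 : ℝ
  b2 : ℝ
  t : ℝ
  s : ℝ
  γ : ℝ
  top : ℝ
  A0 : ℝ
  A1 : ℝ
  m : ℕ
  ζ : ℝ

namespace Minorant

variable (C : Minorant)

/-- The coefficient of `c(K)` in the saturation factor `1 + c(K)/((1-κ)B)`. -/
def lam : ℝ := 1 / (1 - C.κ)
-- The price of the excess cost `e = c - t0 φ` in the weight `Z = F - η e`. With this choice `F/(1 +
-- λ(t0 F + e))` equals `C.phi` at `Z = z1` for every `e`; below `z1` the worst case is `e = 0`,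
-- above it is `e = ebar`.
def eta : ℝ := C.lam * C.z1
def ebar : ℝ := 1 - C.t0
def phi : ℝ := C.z1 / (1 + C.lam * C.t0 * C.z1)
-- The least value of `α(1-κ)/θ` for `θ ≤ t1`. The literals are roundings in the safe direction:
-- `0.26794 ≤ α = 2 - √3`, `0.36602 ≤ p ≤ 0.36603`, `0.63397 ≤ 1 - p`.
def cap : ℝ := 0.26794 * (1 - C.κ) / C.t1
def line₁ (Z : ℝ) : ℝ := C.phi + C.b1 * (Z - C.z1)
def line₂ (Z : ℝ) : ℝ := C.phi + C.b2 * (Z - C.z1)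
def quad (w Z : ℝ) : ℝ := C.A0 + C.A1 * w - C.γ * (C.s - Z) ^ 2
-- Beyond the cap, a bound `G` still yields the extra `p μ w` with `μ = (G - cap)/(G - w)`. As `G -
-- w ≤ top - w0`, this grows at least at the rate `slope w` in `G`.
def slope (w : ℝ) : ℝ := 0.36602 * w / (C.top - C.w0)

/-- The conditions at a value `w`. -/
structure ValidAt (w : ℝ) : Prop where
  -- In `low`, `mid`, `high` the quadratic is put below a line by the discriminant condition, in
  -- `tail` below a constant. In `value`, the mean of the quadratic under sampling reaches the
  -- target; `0.1056625` and `0.211325` are `1/(6 + 2√3)` and `2/(6 + 2√3)` rounded up, and `0.23206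
  -- ≥ p(1-p)`.
  start : C.za = 0 ∨ C.quad w C.za ≤ w
  low : C.A0 + C.A1 * w ≤ C.t * w + (1 - C.t) * 0.63397 * (C.phi - C.b1 * C.z1) +
    (1 - C.t) * 0.63397 * C.b1 * C.s - ((1 - C.t) * 0.63397 * C.b1) ^ 2 / (4 * C.γ)
  mid : C.A0 + C.A1 * w ≤ 0.63397 * (C.phi - C.b2 * C.z1) +
    0.63397 * C.b2 * C.s - (0.63397 * C.b2) ^ 2 / (4 * C.γ)
  high : C.A0 + C.A1 * w ≤ 0.63397 * C.cap + C.slope w * (C.phi - C.cap - C.b2 * C.z1) +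
    C.slope w * C.b2 * C.s - (C.slope w * C.b2) ^ 2 / (4 * C.γ)
  tail : C.A0 + C.A1 * w ≤ 0.63397 * C.cap + C.slope w * (C.top - C.cap)
  value : 0.1056625 + 0.211325 * w ≤
    C.A0 + C.A1 * w - C.γ * (0.23206 * w * C.ζ + (C.s - 0.36602 * C.ζ) ^ 2)

structure Valid : Prop where
  t0_nonneg : 0 ≤ C.t0
  t0_lt : C.t0 < C.t1
  t1_le : C.t1 ≤ 1
  w0_nonneg : 0 ≤ C.w0
  w0_lt : C.w0 < C.w1
  kap_pos : C.t0 * C.w1 < C.κ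
  kap_lt : C.κ < 1
  gam_pos : 0 < C.γ
  t_nonneg : 0 ≤ C.t
  t_le : C.t ≤ 1
  za_nonneg : 0 ≤ C.za
  za_le_s : C.za ≤ C.s
  z1_pos : 0 < C.z1
  z1_le : C.z1 ≤ C.zc
  b1_nonneg : 0 ≤ C.b1
  b2_nonneg : 0 ≤ C.b2
  line₁_le : C.line₁ C.za * (1 + C.lam * C.t0 * C.za) ≤ C.za
  line₂_le : C.line₂ C.zc * (1 + C.lam * C.t0 * (C.zc + C.eta * C.ebar) + C.lam * C.ebar) ≤
    C.zc + C.eta * C.ebar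
  end_le : C.ζ ≤ C.zc ∨ C.top ≤ C.line₂ C.zc
  phi_le_cap : C.phi ≤ C.cap
  cap_le_top : C.cap ≤ C.top
  w1_lt_cap : C.w1 < C.cap
  -- An element dearer than `κ` has excess cost above `κ - t0 w1`. Either the total excess or the
  -- total cost rules out `m + 1` of them.
  count : C.ebar ≤ (C.m + 1) * (C.κ - C.t0 * C.w1) ∨ 1 ≤ (C.m + 1) * C.κ
  zeta_pos : 0 < C.ζ
  zeta_le : C.ζ ≤ 1 - C.eta * C.ebar
  zeta_le' : C.ζ ≤ 1 - C.eta * C.ebar - C.m * (C.w1 - C.eta * (C.κ - C.t0 * C.w1))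
  zeta_le_s : 0.36603 * C.ζ ≤ C.s
  valid₀ : C.ValidAt C.w0
  valid₁ : C.ValidAt C.w1

variable {C}

/-- Every condition is affine in `w`, except `high`, which is concave, so the two endpoints decide.
-/
theorem Valid.validAt (h : C.Valid) {w : ℝ} (h0 : C.w0 ≤ w) (h1 : w ≤ C.w1) : C.ValidAt w := by
  have hγ := h.gam_pos
  have hlin : ∀ a b : ℝ, 0 ≤ a + b * C.w0 → 0 ≤ a + b * C.w1 → 0 ≤ a + b * w := by
    intro a b h2 h3
    have := concave_nonneg (a := a) (b := b) (d := 0) le_rfl (by linarith) (by linarith) h0 h1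
    linarith
  obtain ⟨s0, l0, m0, g0, t0, v0⟩ := h.valid₀
  obtain ⟨s1, l1, m1, g1, t1, v1⟩ := h.valid₁
  refine ⟨?_, ?_, ?_, ?_, ?_, ?_⟩
  · by_cases hz : C.za = 0
    · exact .inl hz
    · right
      have := hlin (C.γ * (C.s - C.za) ^ 2 - C.A0) (1 - C.A1)
        (by have := s0.resolve_left hz; rw [quad] at this; linarith)
        (by have := s1.resolve_left hz; rw [quad] at this; linarith)
      rw [quad]; linarith
  · have := hlin ((1 - C.t) * 0.63397 * (C.phi - C.b1 * C.z1) +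
      (1 - C.t) * 0.63397 * C.b1 * C.s - ((1 - C.t) * 0.63397 * C.b1) ^ 2 / (4 * C.γ) - C.A0)
      (C.t - C.A1) (by linarith) (by linarith)
    linarith
  · have := hlin (0.63397 * (C.phi - C.b2 * C.z1) +
      0.63397 * C.b2 * C.s - (0.63397 * C.b2) ^ 2 / (4 * C.γ) - C.A0)
      (- C.A1) (by linarith) (by linarith)
    linarith
  · set q := 0.36602 / (C.top - C.w0) with hq
    have hs : ∀ u, C.slope u = q * u := fun u => by rw [slope, hq]; ring
    rw [hs] at g0 g1 ⊢
    have := concave_nonneg (a := 0.63397 * C.cap - C.A0)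
      (b := q * (C.phi - C.cap - C.b2 * C.z1) + q * C.b2 * C.s - C.A1)
      (d := (q * C.b2) ^ 2 / (4 * C.γ)) (by positivity)
      (u := C.w0) (v := C.w1) (z := w) (by linarith [show (q * C.w0 * C.b2) ^ 2 / (4 * C.γ) =
        (q * C.b2) ^ 2 / (4 * C.γ) * C.w0 ^ 2 by ring])
      (by linarith [show (q * C.w1 * C.b2) ^ 2 / (4 * C.γ) =
        (q * C.b2) ^ 2 / (4 * C.γ) * C.w1 ^ 2 by ring]) h0 h1
    linarith [show (q * w * C.b2) ^ 2 / (4 * C.γ) =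
        (q * C.b2) ^ 2 / (4 * C.γ) * w ^ 2 by ring]
  · set q := 0.36602 / (C.top - C.w0) with hq
    have hs : ∀ u, C.slope u = q * u := fun u => by rw [slope, hq]; ring
    rw [hs] at t0 t1 ⊢
    have := hlin (0.63397 * C.cap - C.A0) (q * (C.top - C.cap) - C.A1) (by linarith) (by linarith)
    linarith
  · have := hlin (C.A0 - C.γ * (C.s - 0.36602 * C.ζ) ^ 2 - 0.1056625)
      (C.A1 - C.γ * (0.23206 * C.ζ) - 0.211325) (by linarith) (by linarith)
    linarith

theorem Valid.lam_pos (h : C.Valid) : 0 < C.lam := by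
  rw [lam]; have := h.kap_lt; apply div_pos one_pos; linarith

theorem Valid.eta_pos (h : C.Valid) : 0 < C.eta := mul_pos h.lam_pos h.z1_pos

theorem Valid.ebar_nonneg (h : C.Valid) : 0 ≤ C.ebar := by
  rw [ebar]; linarith [h.t0_lt, h.t1_le]

theorem Valid.phi_eq (h : C.Valid) : C.phi * (1 + C.lam * C.t0 * C.z1) = C.z1 := by
  have h1 := h.lam_pos
  have h2 := h.z1_pos
  have h3 := h.t0_nonneg
  exact div_mul_cancel₀ _ (by positivity)

theorem Valid.phi_pos (h : C.Valid) : 0 < C.phi := by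
  have h1 := h.lam_pos
  have h2 := h.z1_pos
  have h3 := h.t0_nonneg
  rw [phi]; positivity

/-- Below `z1` the first line bounds the value of a set from below. -/
theorem Valid.line₁_mul_le (h : C.Valid) {Z e F : ℝ} (hZa : C.za ≤ Z) (hZ1 : Z ≤ C.z1)
    (he : 0 ≤ e) (hF : Z + C.eta * e ≤ F) :
    C.line₁ Z * (1 + C.lam * (C.t0 * F + e)) ≤ F := by
  have hl := h.lam_pos
  have ht0 := h.t0_nonneg
  have hZ0 : 0 ≤ Z := h.za_nonneg.trans hZa
  have h1 : C.line₁ Z * (1 + C.lam * C.t0 * Z) ≤ Z := by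
    have hb := h.b1_nonneg
    have := concave_nonneg (a := -(C.phi - C.b1 * C.z1))
      (b := 1 - C.b1 - (C.phi - C.b1 * C.z1) * (C.lam * C.t0))
      (d := C.b1 * (C.lam * C.t0)) (by positivity) (u := C.za) (v := C.z1) (z := Z)
      (by have := h.line₁_le; rw [line₁] at this; linarith)
      (by have := h.phi_eq; linarith) hZa hZ1
    rw [line₁]; linarith
  have hd : 0 < 1 + C.lam * C.t0 * Z := by positivity
  have hF0 : 0 ≤ F := le_trans (by have := h.eta_pos; positivity) hF
  have h2 : Z * (1 + C.lam * e) ≤ F := by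
    refine le_trans ?_ hF
    have : Z * (C.lam * e) ≤ C.z1 * (C.lam * e) := mul_le_mul_of_nonneg_right hZ1 (by positivity)
    rw [eta]; linarith
  have h3 : C.line₁ Z * (1 + C.lam * (C.t0 * F + e)) * (1 + C.lam * C.t0 * Z) ≤
      F * (1 + C.lam * C.t0 * Z) := by
    have := mul_le_mul_of_nonneg_right h1 (by positivity : 0 ≤ 1 + C.lam * (C.t0 * F + e))
    linarith
  exact le_of_mul_le_mul_right h3 hd

/-- For `Z ≥ z1` the ratio `F/(1 + λ(t0 F + e))` at `F = Z + η e` decreases in `e`, so it is enough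
to test `e = ebar`. -/
theorem Valid.mul_le_of_z1_le (h : C.Valid) {G Z e F : ℝ} (hZ1 : C.z1 ≤ Z)
    (he : 0 ≤ e) (he1 : e ≤ C.ebar) (hF : Z + C.eta * e ≤ F)
    (hG : G * (1 + C.lam * C.t0 * (Z + C.eta * C.ebar) + C.lam * C.ebar) ≤
      Z + C.eta * C.ebar) :
    G * (1 + C.lam * (C.t0 * F + e)) ≤ F := by
  have hl := h.lam_pos
  have ht0 := h.t0_nonneg
  have hη := h.eta_pos
  have heb := h.ebar_nonneg
  have hZ0 : 0 < Z := h.z1_pos.trans_le hZ1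
  have hF0 : 0 ≤ F := le_trans (by positivity) hF
  set Y := Z + C.eta * C.ebar with hY
  have hY0 : 0 ≤ Y := by positivity
  have hd : 0 < 1 + C.lam * C.t0 * Y + C.lam * C.ebar := by positivity
  have h1 : Y * (1 + C.lam * e) ≤ F * (1 + C.lam * C.ebar) := by
    have h2 : (Z + C.eta * e) * (1 + C.lam * C.ebar) ≤ F * (1 + C.lam * C.ebar) :=
      mul_le_mul_of_nonneg_right hF (by positivity)
    have h3 : 0 ≤ (C.ebar - e) * (C.lam * (Z - C.z1)) := by
      have : 0 ≤ C.ebar - e := by linarith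
      have : 0 ≤ Z - C.z1 := by linarith
      positivity
    rw [eta] at h2
    rw [hY, eta]
    linarith
  have h3 : G * (1 + C.lam * (C.t0 * F + e)) * (1 + C.lam * C.t0 * Y + C.lam * C.ebar) ≤
      F * (1 + C.lam * C.t0 * Y + C.lam * C.ebar) := by
    have := mul_le_mul_of_nonneg_right hG (by positivity : 0 ≤ 1 + C.lam * (C.t0 * F + e))
    linarith
  exact le_of_mul_le_mul_right h3 hd

theorem Valid.line₂_mul_le (h : C.Valid) {Z e F : ℝ} (hZ1 : C.z1 ≤ Z) (hZc : Z ≤ C.zc)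
    (he : 0 ≤ e) (he1 : e ≤ C.ebar) (hF : Z + C.eta * e ≤ F) :
    C.line₂ Z * (1 + C.lam * (C.t0 * F + e)) ≤ F := by
  refine h.mul_le_of_z1_le hZ1 he he1 hF ?_
  have hl := h.lam_pos
  have ht0 := h.t0_nonneg
  have hb := h.b2_nonneg
  set k := 1 + C.lam * C.t0 * (C.eta * C.ebar) + C.lam * C.ebar with hk
  have := concave_nonneg (a := C.eta * C.ebar - (C.phi - C.b2 * C.z1) * k)
      (b := 1 - C.b2 * k - (C.phi - C.b2 * C.z1) * (C.lam * C.t0))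
      (d := C.b2 * (C.lam * C.t0)) (by positivity) (u := C.z1) (v := C.zc) (z := Z)
      (by
        have h1 := h.phi_eq
        have h2 : C.phi * (1 + C.lam * C.t0 * C.z1) * (1 + C.lam * C.ebar) =
          C.z1 * (1 + C.lam * C.ebar) := by rw [h1]
        rw [hk, eta]
        linarith)
      (by have := h.line₂_le; rw [line₂] at this; rw [hk]; linarith) hZ1 hZc
  rw [hk] at this
  rw [line₂]; linarith

theorem Valid.top_mul_le (h : C.Valid) {Z e F : ℝ} (hZc : C.zc ≤ Z) (htop : C.top ≤ C.line₂ C.zc)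
    (he : 0 ≤ e) (he1 : e ≤ C.ebar) (hF : Z + C.eta * e ≤ F) :
    C.top * (1 + C.lam * (C.t0 * F + e)) ≤ F := by
  refine h.mul_le_of_z1_le (h.z1_le.trans hZc) he he1 hF ?_
  have hl := h.lam_pos
  have ht0 := h.t0_nonneg
  have hη := h.eta_pos
  have heb := h.ebar_nonneg
  have hz := h.z1_pos.trans_le h.z1_le
  have h1 : C.top * (1 + C.lam * C.t0 * (C.zc + C.eta * C.ebar) + C.lam * C.ebar) ≤
      C.zc + C.eta * C.ebar :=
    (mul_le_mul_of_nonneg_right htop (by positivity)).trans h.line₂_le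
  have htop0 : 0 ≤ C.top := (h.phi_pos.le.trans h.phi_le_cap).trans h.cap_le_top
  have h2 : C.top * (C.lam * C.t0) ≤ 1 := by
    have h3 : C.top * (C.lam * C.t0) * (C.zc + C.eta * C.ebar) ≤ 1 * (C.zc + C.eta * C.ebar) := by
      have : 0 ≤ C.top * (1 + C.lam * C.ebar) := by positivity
      linarith
    exact le_of_mul_le_mul_right h3 (by positivity)
  have h4 : C.top * (C.lam * C.t0) * (Z - C.zc) ≤ 1 * (Z - C.zc) :=
    mul_le_mul_of_nonneg_right h2 (by linarith)
  linarith

/-- The quadratic function is a minorant of the values that can be certified. -/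
theorem Valid.exists_certificate (h : C.Valid) {w Z e F p cap : ℝ} (hw0 : C.w0 ≤ w) (hw1 : w ≤ C.w1)
    (hp0 : 0.36602 ≤ p) (hp1 : p ≤ 0.36603) (hcap : C.cap ≤ cap)
    (hZ0 : 0 ≤ Z) (hZ : Z ≤ C.ζ) (he : 0 ≤ e) (he1 : e ≤ C.ebar) (hF : Z + C.eta * e ≤ F) :
    ∃ μ v : ℝ, 0 ≤ μ ∧ μ ≤ 1 ∧ 0 ≤ v ∧ v * (1 + C.lam * (C.t0 * F + e)) ≤ (1 - μ) * F ∧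
      v + μ * w ≤ cap ∧ C.quad w Z ≤ μ * w + (1 - p) * v := by
  have hv := h.validAt hw0 hw1
  have hγ := h.gam_pos
  have hl := h.lam_pos
  have ht0 := h.t0_nonneg
  have hη := h.eta_pos
  have hw : 0 ≤ w := h.w0_nonneg.trans hw0
  have hwc : w < C.cap := hw1.trans_lt h.w1_lt_cap
  have hF0 : 0 ≤ F := le_trans (by positivity) hF
  have trivialCase : C.quad w Z ≤ w → ∃ μ v : ℝ, 0 ≤ μ ∧ μ ≤ 1 ∧ 0 ≤ v ∧
      v * (1 + C.lam * (C.t0 * F + e)) ≤ (1 - μ) * F ∧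
      v + μ * w ≤ cap ∧ C.quad w Z ≤ μ * w + (1 - p) * v := fun hq =>
    ⟨1, 0, zero_le_one, le_rfl, le_rfl, by simp, by linarith, by linarith⟩
  have lineCase : ∀ G, 0 ≤ G → G ≤ C.cap → G * (1 + C.lam * (C.t0 * F + e)) ≤ F →
      C.quad w Z ≤ 0.63397 * G → ∃ μ v : ℝ, 0 ≤ μ ∧ μ ≤ 1 ∧ 0 ≤ v ∧
      v * (1 + C.lam * (C.t0 * F + e)) ≤ (1 - μ) * F ∧
      v + μ * w ≤ cap ∧ C.quad w Z ≤ μ * w + (1 - p) * v := fun G hG0 hGc hGF hq => by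
    refine ⟨0, G, le_rfl, zero_le_one, hG0, by linarith, by linarith, ?_⟩
    have : 0.63397 * G ≤ (1 - p) * G := mul_le_mul_of_nonneg_right (by linarith) hG0
    linarith
  -- The witnesses solve `v = (1-μ) G` and `v + μ w = C.cap`: what exceeds the cap is traded for the
  -- sure value `w`.
  have capCase : ∀ G, C.cap ≤ G → G ≤ C.top → G * (1 + C.lam * (C.t0 * F + e)) ≤ F →
      C.quad w Z ≤ 0.63397 * C.cap + C.slope w * (G - C.cap) → ∃ μ v : ℝ, 0 ≤ μ ∧ μ ≤ 1 ∧
      0 ≤ v ∧ v * (1 + C.lam * (C.t0 * F + e)) ≤ (1 - μ) * F ∧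
      v + μ * w ≤ cap ∧ C.quad w Z ≤ μ * w + (1 - p) * v := fun G hGc hGt hGF hq => by
    have hGw : 0 < G - w := by linarith
    have hμ0 : 0 ≤ (G - C.cap) / (G - w) := div_nonneg (by linarith) hGw.le
    have hv0 : 0 ≤ G * (C.cap - w) / (G - w) :=
      div_nonneg (mul_nonneg (by linarith) (by linarith)) hGw.le
    have e1 : 1 - (G - C.cap) / (G - w) = (C.cap - w) / (G - w) := by field_simp; ring
    have e2 : G * (C.cap - w) / (G - w) = C.cap - (G - C.cap) / (G - w) * w := by
      field_simp; ring
    refine ⟨(G - C.cap) / (G - w), G * (C.cap - w) / (G - w), hμ0, ?_, hv0, ?_, ?_, ?_⟩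
    · rw [div_le_one hGw]; linarith
    · rw [e1]
      have h1 : 0 ≤ (C.cap - w) / (G - w) := div_nonneg (by linarith) hGw.le
      have := mul_le_mul_of_nonneg_left hGF h1
      calc _ = (C.cap - w) / (G - w) * (G * (1 + C.lam * (C.t0 * F + e))) := by ring
        _ ≤ _ := this
    · rw [e2]; linarith
    · have h2 : C.slope w * (G - C.cap) ≤ p * ((G - C.cap) / (G - w) * w) := by
        have h3 : (G - C.cap) / (C.top - C.w0) ≤ (G - C.cap) / (G - w) :=
          div_le_div_of_nonneg_left (by linarith) hGw (by linarith)
        have h4 : 0 ≤ (G - C.cap) / (C.top - C.w0) :=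
          div_nonneg (by linarith) (by linarith)
        calc C.slope w * (G - C.cap) = 0.36602 * ((G - C.cap) / (C.top - C.w0) * w) := by
              rw [slope]; ring
          _ ≤ p * ((G - C.cap) / (G - w) * w) :=
              mul_le_mul hp0 (mul_le_mul_of_nonneg_right h3 hw) (mul_nonneg h4 hw) (by linarith)
      have h5 : 0.63397 * C.cap ≤ (1 - p) * C.cap :=
        mul_le_mul_of_nonneg_right (by linarith) (by linarith)
      have h6 : (G - C.cap) / (G - w) * w + (1 - p) * (G * (C.cap - w) / (G - w)) =
          (1 - p) * C.cap + p * ((G - C.cap) / (G - w) * w) := by rw [e2]; ring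
      linarith
  have htail : C.quad w Z ≤ 0.63397 * C.cap + C.slope w * (C.top - C.cap) := by
    have := hv.tail
    have h1 : 0 ≤ C.γ * (C.s - Z) ^ 2 := by positivity
    rw [quad]; linarith
  rcases lt_or_ge Z C.za with hZa | hZa
  · refine trivialCase ?_
    have h1 := hv.start.resolve_left (by linarith)
    refine le_trans ?_ h1
    rw [quad, quad]
    have h2 : (C.s - C.za) ^ 2 ≤ (C.s - Z) ^ 2 :=
      pow_le_pow_left₀ (by linarith [h.za_le_s]) (by linarith) 2
    linarith [mul_le_mul_of_nonneg_left h2 hγ.le]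
  rcases le_or_gt Z C.z1 with hZ1 | hZ1
  · have hGF := h.line₁_mul_le hZa hZ1 he hF
    have hG : C.line₁ Z ≤ C.phi := by
      have := mul_nonneg h.b1_nonneg (sub_nonneg.2 hZ1)
      rw [line₁]; linarith
    have hq : C.quad w Z ≤ C.t * w + (1 - C.t) * (0.63397 * C.line₁ Z) := by
      have := quadratic_le_line hγ hv.low Z
      rw [quad, line₁]; linarith
    have ht := h.t_nonneg
    have ht1 : 0 ≤ 1 - C.t := by linarith [h.t_le]
    -- A convex combination is at most the larger of its two ends, and each end has its own
    -- certificate.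
    rcases le_or_gt (0.63397 * C.line₁ Z) w with hlw | hlw
    · refine trivialCase (hq.trans ?_)
      have := mul_le_mul_of_nonneg_left hlw ht1
      linarith
    · refine lineCase _ (by linarith) (hG.trans h.phi_le_cap) hGF (hq.trans ?_)
      have := mul_le_mul_of_nonneg_left hlw.le ht
      linarith
  · have hm := quadratic_le_line hγ hv.mid Z
    have hh := quadratic_le_line hγ hv.high Z
    have hGphi : C.phi ≤ C.line₂ Z := by
      have := mul_nonneg h.b2_nonneg (sub_nonneg.2 hZ1.le)
      rw [line₂]; linarith
    rcases le_or_gt C.zc Z with hZc | hZc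
    · rcases h.end_le with h1 | h1
      · have hZc' : Z ≤ C.zc := hZ.trans h1
        have hGF := h.line₂_mul_le hZ1.le hZc' he he1 hF
        rcases le_or_gt (C.line₂ Z) C.cap with h2 | h2
        · exact lineCase _ (h.phi_pos.le.trans hGphi) h2 hGF (by rw [quad, line₂]; linarith)
        rcases le_or_gt (C.line₂ Z) C.top with h3 | h3
        · exact capCase _ h2.le h3 hGF (by rw [quad, line₂]; linarith)
        · refine capCase _ h.cap_le_top le_rfl ((mul_le_mul_of_nonneg_right h3.le ?_).trans hGF)
            htail
          positivity
      · exact capCase _ h.cap_le_top le_rfl (h.top_mul_le hZc h1 he he1 hF) htail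
    · have hGF := h.line₂_mul_le hZ1.le hZc.le he he1 hF
      rcases le_or_gt (C.line₂ Z) C.cap with h2 | h2
      · exact lineCase _ (h.phi_pos.le.trans hGphi) h2 hGF (by rw [quad, line₂]; linarith)
      rcases le_or_gt (C.line₂ Z) C.top with h3 | h3
      · exact capCase _ h2.le h3 hGF (by rw [quad, line₂]; linarith)
      · refine capCase _ h.cap_le_top le_rfl ((mul_le_mul_of_nonneg_right h3.le ?_).trans hGF)
          htail
        positivity

end Minorant

end Numeric

end

noncomputable section

/-! ### The table of minorants and its numerical verification. -/

namespace Minorant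

/-- Minorants for all densities in `[0, 1]` and all values in `[0, 0.134]`. The entries are
`t0 t1 w0 w1 κ z1 za zc b1 b2 t s γ top A0 A1 m ζ`. -/
def table : List Minorant := [
  ⟨0, 0.45, 0, 0.11, 0.3189, 0.235, 0, 0.6549, 1, 0.4051, 0.2723, 0.7648, 0.3757, 0.451, 0.2112,
    0.2723, 3, 0.6549⟩,
  ⟨0, 0.45, 0.11, 0.122, 0.3687, 0.2089, 0, 0.669, 1, 0.3869, 0.46, 0.9578, 0.2182, 0.5556,
    0.2169, 0.2483, 2, 0.669⟩,
  ⟨0, 0.45, 0.122, 0.134, 0.3982, 0.2025, 0, 0.6634, 1, 0.3757, 0.5835, 1.1141, 0.1433, 0.5165,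
    0.2152, 0.2338, 2, 0.6634⟩,
  ⟨0.45, 0.55, 0, 0.11, 0.3246, 0.2561, 0.0301, 0.5674, 0.8375, 0.3664, 0.2658, 0.7096, 0.3841,
    0.3318, 0.17734, 0.287, 1, 0.7857⟩,
  ⟨0.45, 0.55, 0.11, 0.134, 0.3353, 0.2774, 0.1965, 0.7217, 0.7431, 0.3406, 0.2652, 0.7712,
    0.3022, 0.3848, 0.18069, 0.2643, 1, 0.7512⟩,
  ⟨0.55, 0.65, 0, 0.11, 0.2856, 0.2455, 0.0363, 0.6045, 0.8182, 0.3798, 0.2648, 0.6371, 0.4416,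
    0.3428, 0.1594, 0.2997, 1, 0.8127⟩,
  ⟨0.55, 0.65, 0.11, 0.131, 0.2971, 0.2606, 0.2007, 0.6368, 0.7179, 0.366, 0.2763, 0.6775,
    0.3517, 0.3505, 0.15958, 0.2756, 1, 0.7855⟩,
  ⟨0.55, 0.65, 0.131, 0.134, 0.2988, 0.2499, 0.2286, 0.7787, 0.709, 0.3515, 0.5057, 0.8874,
    0.1734, 0.3948, 0.17094, 0.2385, 1, 0.7858⟩,
  ⟨0.65, 0.7, 0, 0.11, 0.2466, 0.2418, 0.0373, 0.6147, 0.8016, 0.3955, 0.2657, 0.6345, 0.4381,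
    0.3449, 0.15624, 0.3016, 1, 0.8338⟩,
  ⟨0.65, 0.7, 0.11, 0.131, 0.2604, 0.2578, 0.2046, 0.6308, 0.6911, 0.3818, 0.2747, 0.688,
    0.3317, 0.3525, 0.15739, 0.2733, 1, 0.808⟩,
  ⟨0.65, 0.7, 0.131, 0.134, 0.2623, 0.2606, 0.2285, 0.8042, 0.677, 0.3548, 0.5287, 0.9509,
    0.145, 0.4201, 0.17117, 0.2328, 1, 0.8042⟩,
  ⟨0.7, 0.75, 0, 0.11, 0.227, 0.2294, 0.0321, 0.5873, 0.8047, 0.4138, 0.2993, 0.6152, 0.4391,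
    0.3379, 0.14929, 0.3012, 1, 0.8454⟩,
  ⟨0.7, 0.75, 0.11, 0.128, 0.2396, 0.2525, 0.2064, 0.5967, 0.6819, 0.3986, 0.2814, 0.65, 0.3626,
    0.3415, 0.15038, 0.2805, 1, 0.8221⟩,
  ⟨0.7, 0.75, 0.128, 0.134, 0.2439, 0.2591, 0.2481, 0.7996, 0.6559, 0.3613, 0.4956, 0.8624,
    0.1707, 0.3913, 0.16141, 0.2418, 1, 0.8146⟩,
  ⟨0.75, 0.8, 0, 0.11, 0.2075, 0.2247, 0.0264, 0.5525, 0.8046, 0.4327, 0.3027, 0.5802, 0.4808,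
    0.3271, 0.14257, 0.3026, 1, 0.8545⟩,
  ⟨0.75, 0.8, 0.11, 0.122, 0.2165, 0.2385, 0.208, 0.5893, 0.679, 0.4162, 0.2834, 0.6414, 0.3613,
    0.3384, 0.14674, 0.2826, 1, 0.8399⟩,
  ⟨0.75, 0.8, 0.122, 0.128, 0.2211, 0.2458, 0.236, 0.6435, 0.6589, 0.4009, 0.3884, 0.7125,
    0.2682, 0.3559, 0.15097, 0.2612, 1, 0.8325⟩,
  ⟨0.75, 0.8, 0.128, 0.134, 0.2255, 0.2685, 0.2431, 0.7219, 0.6425, 0.3768, 0.4939, 0.8205,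
    0.1814, 0.3835, 0.15572, 0.2429, 1, 0.8226⟩,
  ⟨0.8, 0.85, 0, 0.11, 0.188, 0.2182, 0.0339, 0.5334, 0.7965, 0.451, 0.3054, 0.5629, 0.4877,
    0.3217, 0.13647, 0.3093, 1, 0.8631⟩,
  ⟨0.8, 0.85, 0.11, 0.12, 0.1961, 0.2333, 0.2057, 0.5649, 0.6737, 0.4342, 0.2858, 0.6222,
    0.3737, 0.3333, 0.14255, 0.2818, 1, 0.851⟩,
  ⟨0.8, 0.85, 0.12, 0.122, 0.1977, 0.2371, 0.2332, 0.5923, 0.6562, 0.4259, 0.3464, 0.6593,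
    0.3189, 0.343, 0.14741, 0.2538, 1, 0.8484⟩,
  ⟨0.8, 0.85, 0.122, 0.125, 0.2, 0.2454, 0.238, 0.6549, 0.6486, 0.4083, 0.4139, 0.7138, 0.2539,
    0.3562, 0.1475, 0.2615, 1, 0.8443⟩,
  ⟨0.8, 0.85, 0.125, 0.128, 0.3024, 0.282, 0.2543, 0.8002, 0.5851, 0.3289, 0.5717, 0.7335,
    0.1662, 0.3231, 0.13264, 0.2435, 0, 0.9191⟩,
  ⟨0.8, 0.85, 0.128, 0.134, 0.3072, 0.2918, 0.177, 0.8543, 0.6211, 0.3152, 0.6035, 0.7202,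
    0.1654, 0.3136, 0.13102, 0.2432, 0, 0.9157⟩,
  ⟨0.85, 0.9, 0, 0.106, 0.1651, 0.207, 0.0305, 0.5248, 0.8011, 0.4714, 0.31, 0.5538, 0.4883,
    0.3207, 0.13344, 0.31, 1, 0.8754⟩,
  ⟨0.85, 0.9, 0.106, 0.113, 0.2461, 0.2225, 0.2059, 0.4999, 0.6489, 0.441, 0.3051, 0.5537,
    0.4148, 0.2988, 0.12418, 0.3014, 0, 0.9557⟩,
  ⟨0.85, 0.9, 0.113, 0.118, 0.2503, 0.2377, 0.2221, 0.5259, 0.6293, 0.4257, 0.3815, 0.5963,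
    0.3315, 0.3099, 0.12695, 0.2844, 0, 0.9524⟩,
  ⟨0.85, 0.9, 0.118, 0.125, 0.2563, 0.2626, 0.2363, 0.5858, 0.6056, 0.3981, 0.4484, 0.6365,
    0.2648, 0.3163, 0.12875, 0.268, 0, 0.947⟩,
  ⟨0.85, 0.9, 0.125, 0.134, 0.2639, 0.2893, 0.2549, 0.7688, 0.5792, 0.347, 0.5323, 0.6697,
    0.2085, 0.3108, 0.12872, 0.2566, 0, 0.941⟩,
  ⟨0.9, 0.95, 0, 0.108, 0.1972, 0.2039, 0.0213, 0.4902, 0.795, 0.478, 0.3191, 0.5231, 0.4741,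
    0.3028, 0.11908, 0.3188, 0, 0.9746⟩,
  ⟨0.9, 0.95, 0.108, 0.128, 0.2152, 0.2676, 0.2116, 0.5889, 0.6158, 0.4154, 0.4262, 0.6583,
    0.2507, 0.3309, 0.12907, 0.2678, 0, 0.9659⟩,
  ⟨0.9, 0.95, 0.128, 0.134, 0.2206, 0.2943, 0.2453, 0.9413, 0.5817, 0.3304, 0.5786, 0.697,
    0.1846, 0.3137, 0.13001, 0.2547, 0, 0.9622⟩,
  ⟨0.95, 1, 0, 0.11, 0.1545, 0.2104, 0.0239, 0.4895, 0.7877, 0.4982, 0.3218, 0.5231, 0.4774,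
    0.309, 0.11896, 0.3218, 0, 0.9875⟩,
  ⟨0.95, 1, 0.11, 0.134, 0.1774, 0.2947, 0.2172, 0.5558, 0.5965, 0.4329, 0.4129, 0.6186, 0.2899,
    0.3229, 0.12608, 0.2779, 0, 0.982⟩]

set_option maxHeartbeats 8000000 in
theorem valid_of_mem_table : ∀ C ∈ table, C.Valid := by
  simp only [table, List.forall_mem_cons, List.not_mem_nil, false_imp_iff, implies_true, and_true]
  refine ⟨?_, ?_, ?_, ?_, ?_, ?_, ?_, ?_, ?_, ?_, ?_, ?_, ?_, ?_, ?_, ?_, ?_, ?_, ?_, ?_, ?_, ?_,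
    ?_, ?_, ?_, ?_, ?_, ?_, ?_, ?_, ?_, ?_, ?_, ?_⟩ <;> constructor <;>
    first
    | (norm_num [lam, eta, ebar, phi, cap, line₁, line₂, quad, slope]; done)
    | (constructor <;> norm_num [lam, eta, ebar, phi, cap, line₁, line₂, quad, slope])

/-- The strips in `θ` abut, and within each strip so do the intervals in `w`. If no row contained
the point, walking along its strip would push `w` past `0.134`. -/
theorem exists_mem_table {θ w : ℝ} (hθ0 : 0 ≤ θ) (hθ1 : θ ≤ 1) (hw0 : 0 ≤ w) (hw1 : w ≤ 0.134) :
    ∃ C ∈ table, C.t0 ≤ θ ∧ θ ≤ C.t1 ∧ C.w0 ≤ w ∧ w ≤ C.w1 := by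
  by_contra! hcon
  simp only [table, List.forall_mem_cons, List.not_mem_nil, false_imp_iff, implies_true,
    and_true] at hcon
  obtain ⟨h0, h1, h2, h3, h4, h5, h6, h7, h8, h9, h10, h11, h12, h13, h14, h15, h16, h17, h18, h19,
    h20, h21, h22, h23, h24, h25, h26, h27, h28, h29, h30, h31, h32, h33⟩ := hcon
  rcases le_total θ 0.45 with u0 | u0
  · have v0 := (h0 hθ0 u0 hw0).le
    have v1 := (h1 hθ0 u0 v0).le
    exact absurd hw1 (h2 hθ0 u0 v1).not_ge
  rcases le_total θ 0.55 with u1 | u1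
  · have v3 := (h3 u0 u1 hw0).le
    exact absurd hw1 (h4 u0 u1 v3).not_ge
  rcases le_total θ 0.65 with u2 | u2
  · have v5 := (h5 u1 u2 hw0).le
    have v6 := (h6 u1 u2 v5).le
    exact absurd hw1 (h7 u1 u2 v6).not_ge
  rcases le_total θ 0.7 with u3 | u3
  · have v8 := (h8 u2 u3 hw0).le
    have v9 := (h9 u2 u3 v8).le
    exact absurd hw1 (h10 u2 u3 v9).not_ge
  rcases le_total θ 0.75 with u4 | u4
  · have v11 := (h11 u3 u4 hw0).le
    have v12 := (h12 u3 u4 v11).le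
    exact absurd hw1 (h13 u3 u4 v12).not_ge
  rcases le_total θ 0.8 with u5 | u5
  · have v14 := (h14 u4 u5 hw0).le
    have v15 := (h15 u4 u5 v14).le
    have v16 := (h16 u4 u5 v15).le
    exact absurd hw1 (h17 u4 u5 v16).not_ge
  rcases le_total θ 0.85 with u6 | u6
  · have v18 := (h18 u5 u6 hw0).le
    have v19 := (h19 u5 u6 v18).le
    have v20 := (h20 u5 u6 v19).le
    have v21 := (h21 u5 u6 v20).le
    have v22 := (h22 u5 u6 v21).le
    exact absurd hw1 (h23 u5 u6 v22).not_ge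
  rcases le_total θ 0.9 with u7 | u7
  · have v24 := (h24 u6 u7 hw0).le
    have v25 := (h25 u6 u7 v24).le
    have v26 := (h26 u6 u7 v25).le
    have v27 := (h27 u6 u7 v26).le
    exact absurd hw1 (h28 u6 u7 v27).not_ge
  rcases le_total θ 0.95 with u8 | u8
  · have v29 := (h29 u7 u8 hw0).le
    have v30 := (h30 u7 u8 v29).le
    exact absurd hw1 (h31 u7 u8 v30).not_ge
  have v32 := (h32 u8 hθ1 hw0).le
  exact absurd hw1 (h33 u8 hθ1 v32).not_ge

end Minorant

end

noncomputable section

/-! ### The expected value over the sample. -/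

section Value

variable {V : Type} [DecidableEq V]

/-- A valid minorant bounds the expected value of a certified function of the sampled set. -/
theorem Minorant.Valid.lower_bound {C : Minorant} (h : C.Valid) {p : ℝ} (hp0 : 0.36602 ≤ p)
    (hp1 : p ≤ 0.36603) {θ w cap : ℝ} (hθ0 : C.t0 ≤ θ) (hw0 : C.w0 ≤ w)
    (hw1 : w ≤ C.w1) (hcap : C.cap ≤ cap) {O : Finset V} {φ c : V → ℝ}
    (hφ : ∑ o ∈ O, φ o = 1) (hφw : ∀ o ∈ O, φ o ≤ w) (hc0 : ∀ o ∈ O, 0 ≤ c o)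
    (hcφ : ∀ o ∈ O, θ * φ o ≤ c o) (hc1 : ∑ o ∈ O, c o ≤ 1) :
    ∃ O' ⊆ O, (∀ o ∈ O', c o ≤ C.κ) ∧ ∀ Ψ : Finset V → ℝ,
      (∀ K ⊆ O', ∀ μ v : ℝ, 0 ≤ μ → μ ≤ 1 → 0 ≤ v →
        v * (1 + C.lam * ∑ o ∈ K, c o) ≤ (1 - μ) * ∑ o ∈ K, φ o → v + μ * w ≤ cap →
        μ * w + (1 - p) * v ≤ Ψ K) →
      0.1056625 + 0.211325 * w ≤ bernSum p O' Ψ := by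
  have hη := h.eta_pos
  have hζ := h.zeta_pos
  have hγ := h.gam_pos
  have ht0 := h.t0_nonneg
  have hwn : 0 ≤ w := h.w0_nonneg.trans hw0
  set e : V → ℝ := fun o => c o - C.t0 * φ o with he
  have he0 : ∀ o ∈ O, 0 ≤ e o := by
    intro o ho
    have h1 : C.t0 * φ o ≤ c o := by
      rcases le_total 0 (φ o) with h2 | h2
      · exact (mul_le_mul_of_nonneg_right hθ0 h2).trans (hcφ o ho)
      · exact (mul_nonpos_of_nonneg_of_nonpos ht0 h2).trans (hc0 o ho)
    rw [he]; dsimp only; linarith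
  have hesum : ∀ K : Finset V, ∑ o ∈ K, e o = ∑ o ∈ K, c o - C.t0 * ∑ o ∈ K, φ o := fun K => by
    rw [he, Finset.sum_sub_distrib, Finset.mul_sum]
  have heO : ∑ o ∈ O, e o ≤ C.ebar := by
    rw [hesum, hφ, Minorant.ebar]; linarith
  set z : V → ℝ := fun o => φ o - C.eta * e o with hz
  have hzsum : ∀ K : Finset V, ∑ o ∈ K, z o = ∑ o ∈ K, φ o - C.eta * ∑ o ∈ K, e o := fun K => by
    rw [hz, Finset.sum_sub_distrib, Finset.mul_sum]
  set O' := O.filter fun o => 0 < z o ∧ c o ≤ C.κ with hO'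
  have hsub : O' ⊆ O := Finset.filter_subset _ _
  have hpos : ∀ o ∈ O', 0 < z o := fun o ho => (Finset.mem_filter.1 ho).2.1
  set big := O.filter fun o => C.κ < c o with hbig
  -- The most weight that a dropped element dearer than `κ` can have carried.
  set L := max 0 (C.w1 - C.eta * (C.κ - C.t0 * C.w1)) with hL
  have hL0 : 0 ≤ L := le_max_left _ _
  have hebig : ∀ o ∈ big, C.κ - C.t0 * C.w1 ≤ e o := by
    intro o ho
    rw [hbig, Finset.mem_filter] at ho
    have := mul_le_mul_of_nonneg_left ((hφw o ho.1).trans hw1) ht0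
    rw [he]; dsimp only; linarith [ho.2]
  have hcard : (big.card : ℝ) ≤ C.m := by
    by_contra hcon
    rw [not_le] at hcon
    have h1 : C.m + 1 ≤ big.card := by exact_mod_cast hcon
    have h2 : (C.m + 1 : ℝ) ≤ big.card := by exact_mod_cast h1
    have hne : big.Nonempty := Finset.card_pos.1 (by omega)
    have hk0 : 0 < C.κ - C.t0 * C.w1 := by linarith [h.kap_pos]
    have hκ0 : 0 < C.κ := by
      have := mul_nonneg ht0 (hwn.trans hw1)
      linarith
    have h3 : big.card * C.κ < ∑ o ∈ big, c o := by
      rw [← nsmul_eq_mul, ← Finset.sum_const]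
      exact Finset.sum_lt_sum_of_nonempty hne fun o ho => (Finset.mem_filter.1 ho).2
    have h3' : ∑ o ∈ big, c o ≤ ∑ o ∈ O, c o :=
      Finset.sum_le_sum_of_subset_of_nonneg (Finset.filter_subset _ _) fun o ho _ => hc0 o ho
    have h4 : big.card * (C.κ - C.t0 * C.w1) < ∑ o ∈ big, e o := by
      rw [← nsmul_eq_mul, ← Finset.sum_const]
      refine Finset.sum_lt_sum_of_nonempty hne fun o ho => ?_
      rw [hbig, Finset.mem_filter] at ho
      have := mul_le_mul_of_nonneg_left ((hφw o ho.1).trans hw1) ht0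
      rw [he]; dsimp only; linarith [ho.2]
    have h4' : ∑ o ∈ big, e o ≤ ∑ o ∈ O, e o :=
      Finset.sum_le_sum_of_subset_of_nonneg (Finset.filter_subset _ _) fun o ho _ => he0 o ho
    rcases h.count with h5 | h5
    · have := mul_le_mul_of_nonneg_right h2 hk0.le
      linarith
    · have := mul_le_mul_of_nonneg_right h2 hκ0.le
      linarith
  have hzO : ∑ o ∈ O, z o ≤ ∑ o ∈ O', z o + big.card * L := by
    have h1 : ∀ o ∈ O, z o ≤ (if 0 < z o ∧ c o ≤ C.κ then z o else 0) +
        if C.κ < c o then L else 0 := by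
      intro o ho
      by_cases h2 : C.κ < c o
      · rw [if_neg fun h => absurd h2 h.2.not_gt, if_pos h2, zero_add]
        refine le_trans ?_ (le_max_right _ _)
        have h3 := mul_le_mul_of_nonneg_left (hebig o (Finset.mem_filter.2 ⟨ho, h2⟩)) hη.le
        have h4 := hφw o ho
        rw [hz]; dsimp only; linarith
      · rw [if_neg h2, add_zero]
        split_ifs with h3
        · exact le_rfl
        · exact not_lt.1 fun h4 => h3 ⟨h4, not_lt.1 h2⟩
    refine (Finset.sum_le_sum h1).trans ?_
    rw [Finset.sum_add_distrib, ← Finset.sum_filter, ← Finset.sum_filter, Finset.sum_const,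
      nsmul_eq_mul]
  set σ := ∑ o ∈ O', z o with hσ
  have hζσ : C.ζ ≤ σ := by
    have h1 : 1 - C.eta * C.ebar ≤ ∑ o ∈ O, z o := by
      rw [hzsum, hφ]
      linarith [mul_le_mul_of_nonneg_left heO hη.le]
    have h2 : (big.card : ℝ) * L ≤ C.m * L := mul_le_mul_of_nonneg_right hcard hL0
    have h3 : C.ζ ≤ 1 - C.eta * C.ebar - C.m * L := by
      rcases max_choice 0 (C.w1 - C.eta * (C.κ - C.t0 * C.w1)) with h4 | h4
      · rw [hL, h4]; linarith [h.zeta_le]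
      · rw [hL, h4]; exact h.zeta_le'
    linarith
  have hσ0 : 0 < σ := hζ.trans_le hζσ
  -- Scaling the weights down to total exactly `ζ` fixes the mean of the quadratic's argument at `p
  -- ζ`. It is harmless because the certificate only needs `Z + η e ≤ F`.
  set ρ := C.ζ / σ with hρ
  have hρ0 : 0 < ρ := div_pos hζ hσ0
  have hρ1 : ρ ≤ 1 := (div_le_one hσ0).2 hζσ
  set z' : V → ℝ := fun o => ρ * z o with hz'
  have hz'sum : ∀ K : Finset V, ∑ o ∈ K, z' o = ρ * ∑ o ∈ K, z o := fun K =>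
    (Finset.mul_sum _ _ _).symm
  have hz'O : ∑ o ∈ O', z' o = C.ζ := by
    rw [hz'sum, ← hσ, hρ, div_mul_cancel₀ _ hσ0.ne']
  refine ⟨O', hsub, fun o ho => (Finset.mem_filter.1 ho).2.2, fun Ψ hΨ => ?_⟩
  have hp0' : 0 ≤ p := by linarith
  have hp1' : p ≤ 1 := by linarith
  have key : ∀ K ⊆ O', C.quad w (∑ o ∈ K, z' o) ≤ Ψ K := by
    intro K hK
    have hzK : 0 ≤ ∑ o ∈ K, z o := Finset.sum_nonneg fun o ho => (hpos o (hK ho)).le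
    have heK : ∑ o ∈ K, e o ≤ ∑ o ∈ O, e o :=
      Finset.sum_le_sum_of_subset_of_nonneg (hK.trans hsub) fun o ho _ => he0 o ho
    have hzKO : ∑ o ∈ K, z' o ≤ C.ζ := by
      rw [← hz'O]
      exact Finset.sum_le_sum_of_subset_of_nonneg hK fun o ho _ =>
        mul_nonneg hρ0.le (hpos o ho).le
    obtain ⟨μ, v, hμ0, hμ1, hv0, hvF, hvc, hq⟩ := h.exists_certificate (w := w)
      (Z := ∑ o ∈ K, z' o) (e := ∑ o ∈ K, e o) (F := ∑ o ∈ K, φ o) hw0 hw1 hp0 hp1 hcap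
      (by rw [hz'sum]; positivity) hzKO
      (Finset.sum_nonneg fun o ho => he0 o (hsub (hK ho))) (heK.trans heO) (by
        have h1 : ρ * ∑ o ∈ K, z o ≤ 1 * ∑ o ∈ K, z o := mul_le_mul_of_nonneg_right hρ1 hzK
        rw [hz'sum]
        have h2 := hzsum K
        linarith)
    refine hq.trans (hΨ K hK μ v hμ0 hμ1 hv0 ?_ hvc)
    have h1 : C.t0 * ∑ o ∈ K, φ o + ∑ o ∈ K, e o = ∑ o ∈ K, c o := by rw [hesum]; ring
    rwa [h1] at hvF
  refine le_trans ?_ (bernSum_mono hp0' hp1' key)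
  have e1 : bernSum p O' (fun K => C.quad w (∑ o ∈ K, z' o)) =
      bernSum p O' fun K => (C.A0 + C.A1 * w - C.γ * C.s ^ 2) +
        (2 * C.γ * C.s * (∑ o ∈ K, z' o) + -C.γ * (∑ o ∈ K, z' o) ^ 2) :=
    bernSum_congr fun K _ => by rw [Minorant.quad]; ring
  obtain ⟨m1, m2⟩ := bernSum_moments p O' z'
  rw [e1, bernSum_add, bernSum_const, bernSum_add, bernSum_const_mul, bernSum_const_mul, m1, m2,
    hz'O]
  have hsq : ∑ o ∈ O', z' o ^ 2 ≤ w * C.ζ := by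
    rw [← hz'O, Finset.mul_sum]
    refine Finset.sum_le_sum fun o ho => ?_
    have h1 : 0 ≤ z' o := mul_nonneg hρ0.le (hpos o ho).le
    have h2 : z' o ≤ w := by
      have h3 : ρ * z o ≤ 1 * z o := mul_le_mul_of_nonneg_right hρ1 (hpos o ho).le
      have h4 := mul_nonneg hη.le (he0 o (hsub ho))
      have h5 := hφw o (hsub ho)
      have h6 : z o = φ o - C.eta * e o := rfl
      have h7 : z' o = ρ * z o := rfl
      linarith
    rw [sq]
    exact mul_le_mul_of_nonneg_right h2 h1
  have hpr : p * (1 - p) ≤ 0.23206 := by nlinarith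
  have hvar : p * (1 - p) * ∑ o ∈ O', z' o ^ 2 ≤ 0.23206 * (w * C.ζ) :=
    mul_le_mul hpr hsq (Finset.sum_nonneg fun o _ => sq_nonneg _) (by norm_num)
  -- The mean `p ζ` lies left of the vertex `s`, so the bias is worst for the smallest `p`.
  have hbias : (C.s - p * C.ζ) ^ 2 ≤ (C.s - 0.36602 * C.ζ) ^ 2 := by
    have h1 := h.zeta_le_s
    have h2 := mul_le_mul_of_nonneg_right hp1 hζ.le
    have h3 := mul_le_mul_of_nonneg_right hp0 hζ.le
    exact pow_le_pow_left₀ (by linarith) (by linarith) 2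
  have hval := (h.validAt hw0 hw1).value
  have h1 := mul_le_mul_of_nonneg_left (add_le_add hvar hbias) hγ.le
  linarith

/-- The expected value of the best set found on the sample, compared with any feasible set of
large elements. -/
theorem le_bernSum_sample {f : Finset V → ℝ} (hf0 : ∀ S, 0 ≤ f S) (hf : IsSubmodular f)
    (hfe : f ∅ = 0) {c : V → ℝ} (hc : ∀ x, 0 < c x) {B n x w α p : ℝ} (hB : 0 < B) (hn : 0 < n)
    (hα : 0.26794 ≤ α) (hp0 : 0.36602 ≤ p) (hp1 : p ≤ 0.36603) {O L : Finset V} (hOL : O ⊆ L)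
    (hx : ∀ o ∈ O, f {o} ≤ x) (hcn : ∀ o ∈ O, B / n ≤ c o) (hcB : setCost c O ≤ B)
    (hcard : (O.card : ℝ) ≤ n) (hx0 : 0 ≤ x) (hxw : x ≤ w) {a : Finset V → ℝ}
    (haw : ∀ H ⊆ L, w ≤ a H)
    (hcov : ∀ κ, 0 < κ → κ < 1 → ∀ H ⊆ L, α * (1 - κ) * n * x ≤ a H ∨
      ∃ S ⊆ H, ∀ K ⊆ H, (∀ y ∈ K, c y ≤ κ * B) →
        f (S ∪ K) ≤ a H * (1 + setCost c K / ((1 - κ) * B))) :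
    f O + 2 * w ≤ (6 + 2 * √3) * bernSum p L a := by
  have hs : 1.73205 ≤ √3 := Real.le_sqrt_of_sq_le (by norm_num)
  have hw0 : 0 ≤ w := hx0.trans hxw
  have hp0' : 0 ≤ p := by linarith
  have hp1' : p ≤ 1 := by linarith
  have hwE : w ≤ bernSum p L a := by
    have := bernSum_mono hp0' hp1' haw
    rwa [bernSum_const] at this
  have hE0 : 0 ≤ bernSum p L a := hw0.trans hwE
  have hM : 9.4641 * bernSum p L a ≤ (6 + 2 * √3) * bernSum p L a :=
    mul_le_mul_of_nonneg_right (by linarith) hE0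
  set v₀ := f O with hv₀
  -- For large `w` the bound `w ≤ E` suffices, as `1/0.134 + 2 < 9.4641`.
  rcases le_or_gt (0.134 * v₀) w with hbig | hlt
  · linarith
  have hvpos : 0 < v₀ := by linarith
  obtain ⟨φ, hφ1, hφ2, hφ3⟩ := exists_additive_le hf hfe O
  rw [← hv₀] at hφ1
  have hφx : ∀ o ∈ O, φ o ≤ x := fun o ho => (hφ3 o ho).trans (hx o ho)
  have hvn : v₀ ≤ n * x := by
    rw [← hφ1]
    refine (Finset.sum_le_sum hφx).trans ?_
    rw [Finset.sum_const, nsmul_eq_mul]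
    exact mul_le_mul_of_nonneg_right hcard hx0
  have hnx : 0 < n * x := hvpos.trans_le hvn
  have hxpos : 0 < x := pos_of_mul_pos_right hnx hn.le
  -- Elements of `O` cost at least `B/n` and have `φ` at most `x`, so in normalised units cost is at
  -- least `θ` times value, while the cap becomes `α(1-κ)/θ`. High density weakens the cap but makes
  -- value expensive.
  set θ := v₀ / (n * x) with hθ
  have hθ0 : 0 < θ := div_pos hvpos hnx
  have hθ1 : θ ≤ 1 := (div_le_one hnx).2 hvn
  obtain ⟨C, hC, ht0, ht1, hcw0, hcw1⟩ := Minorant.exists_mem_table hθ0.le hθ1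
    (div_nonneg hw0 hvpos.le : 0 ≤ w / v₀) (by rw [div_le_iff₀ hvpos]; exact hlt.le)
  have hval := Minorant.valid_of_mem_table C hC
  have hκ1 := hval.kap_lt
  have hκ0 : 0 < C.κ := (mul_nonneg hval.t0_nonneg (hval.w0_nonneg.trans hval.w0_lt.le)).trans_lt
    hval.kap_pos
  obtain ⟨O', hO', hκ, hΨ⟩ := hval.lower_bound (θ := θ) (w := w / v₀)
    (cap := α * (1 - C.κ) / θ) (O := O) (φ := fun o => φ o / v₀) (c := fun o => c o / B)
    hp0 hp1 ht0 hcw0 hcw1 (by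
      rw [Minorant.cap]
      refine div_le_div₀ (mul_nonneg (by linarith) (by linarith))
        (mul_le_mul_of_nonneg_right hα (by linarith)) hθ0 ht1)
    (by rw [← Finset.sum_div, hφ1, div_self hvpos.ne'])
    (fun o ho => div_le_div_of_nonneg_right ((hφx o ho).trans hxw) hvpos.le)
    (fun o _ => div_nonneg (hc o).le hB.le)
    (fun o ho => by
      have h1 : θ * (φ o / v₀) = φ o / x * (1 / n) := by rw [hθ]; field_simp
      rw [h1, le_div_iff₀ hB]
      have h2 : φ o / x ≤ 1 := (div_le_one hxpos).2 (hφx o ho)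
      have h3 := hcn o ho
      have h4 : φ o / x * (B / n) ≤ 1 * (B / n) := mul_le_mul_of_nonneg_right h2 (by positivity)
      calc φ o / x * (1 / n) * B = φ o / x * (B / n) := by ring
        _ ≤ c o := by linarith)
    (by rw [← Finset.sum_div, div_le_one hB]; exact hcB)
  -- The samples inside and outside `O'` are independent; condition on the inside.
  have hsplit : bernSum p L a = bernSum p O' fun K => bernSum p (L \ O') fun G => a (K ∪ G) := by
    rw [← bernSum_union p Finset.disjoint_sdiff, Finset.union_sdiff_of_subset (hO'.trans hOL)]
  have hκB : 0 < (1 - C.κ) * B := mul_pos (by linarith) hB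
  have main := hΨ (fun K => 1 / v₀ * bernSum p (L \ O') fun G => a (K ∪ G)) (by
    intro K hK μ v hμ0 hμ1 hv0 hvF hvc
    have hsub : ∀ G ⊆ L \ O', K ∪ G ⊆ L := fun G hG =>
      Finset.union_subset (hK.trans (hO'.trans hOL)) (hG.trans Finset.sdiff_subset)
    have hD : 0 < 1 + setCost c K / ((1 - C.κ) * B) := by
      have := setCost_nonneg hc K
      positivity
    have h1 := le_bernSum_of_capped_or_saturated hp0' hp1' hf0 hf K (L \ O') (a := a) (w := w)
      (cap := α * (1 - C.κ) * n * x) (D := 1 + setCost c K / ((1 - C.κ) * B)) (μ := μ)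
      (v := v * v₀) hD hw0
      (fun G hG => haw _ (hsub G hG)) (fun G hG => by
        rcases hcov C.κ hκ0 hκ1 _ (hsub G hG) with h2 | ⟨S, hS, h2⟩
        · exact .inl h2
        · refine .inr ⟨S, hS, h2 K Finset.subset_union_left fun y hy => ?_⟩
          have := hκ y (hK hy)
          rwa [div_le_iff₀ hB] at this)
      hμ0 hμ1 (mul_nonneg hv0 hvpos.le) (by
        have e1 : C.lam * ∑ o ∈ K, c o / B = setCost c K / ((1 - C.κ) * B) := by
          rw [Minorant.lam, ← Finset.sum_div, setCost, div_mul_div_comm, one_mul]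
        rw [e1, ← Finset.sum_div] at hvF
        have h2 := mul_le_mul_of_nonneg_right hvF hvpos.le
        have e2 : (1 - μ) * ((∑ o ∈ K, φ o) / v₀) * v₀ = (1 - μ) * ∑ o ∈ K, φ o := by
          field_simp
        rw [e2] at h2
        have h3 := mul_le_mul_of_nonneg_left (hφ2 K (hK.trans hO')) (by linarith : 0 ≤ 1 - μ)
        linarith) (by
        have h2 := mul_le_mul_of_nonneg_right hvc hvpos.le
        have e1 : α * (1 - C.κ) / θ * v₀ = α * (1 - C.κ) * n * x := by
          rw [hθ]; field_simp
        have e2 : (v + μ * (w / v₀)) * v₀ = v * v₀ + μ * w := by field_simp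
        rwa [e1, e2] at h2)
    have e3 : μ * (w / v₀) + (1 - p) * v = 1 / v₀ * (μ * w + (1 - p) * (v * v₀)) := by
      field_simp
    rw [e3]
    exact mul_le_mul_of_nonneg_left h1 (by positivity))
  rw [bernSum_const_mul, ← hsplit] at main
  have h2 := mul_le_mul_of_nonneg_right main hvpos.le
  have e1 : 1 / v₀ * bernSum p L a * v₀ = bernSum p L a := by field_simp
  have e2 : (0.1056625 + 0.211325 * (w / v₀)) * v₀ = 0.1056625 * v₀ + 0.211325 * w := by
    field_simp
  rw [e1, e2] at h2
  linarith

end Value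

end

noncomputable section

/-! ### Feasibility, cost and approximation guarantee of the whole algorithm. -/

section Knapsack

variable {V : Type} [Fintype V] [DecidableEq V]

theorem pexp_parKnapsack {f : Finset V → ℝ} (c : V → ℝ) {ε α p B : ℝ}
    (sub : ℝ → Finset V → Prog V (Finset V)) (hp0 : 0 ≤ p) (hp1 : p ≤ 1)
    (h : (largeSet c B).Nonempty) :
    ∃ x ∈ largeSet c B, (∀ y ∈ largeSet c B, f {y} ≤ f {x}) ∧
      pexp ((parKnapsack sub c ε α p B).law f) f =
        pexp ((sub (ε / 125) (smallSet c B)).law f) fun Sm =>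
          bernSum p (largeSet c B) fun H =>
            pexp ((threshRuns c B (α * (Fintype.card V : ℝ) * (f {x} / B)) (ε / 125)
              ((ε / 125) ^ 2)⁻¹ ⌈(ε / 125)⁻¹ * Real.log (Fintype.card V : ℝ)⌉₊
              ⌈(ε / 125)⁻¹ * Real.log (ε / 125)⁻¹⌉₊ H).law f) (bestValue f x Sm) := by
  set g : Finset V → ℝ := fun S => if S ∈ (largeSet c B).image fun x => ({x} : Finset V) then f S
    else 0 with hg
  have hgx : ∀ y ∈ largeSet c B, g {y} = f {y} := fun y hy =>
    if_pos (Finset.mem_image_of_mem _ hy)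
  set x := maximizer (fun y => g {y}) (largeSet c B) h with hx
  have hxm : x ∈ largeSet c B := maximizer_mem _ _ _
  refine ⟨x, hxm, fun y hy => ?_, ?_⟩
  · rw [← hgx y hy, ← hgx x hxm]
    exact le_maximizer (fun y => g {y}) _ h hy
  · rw [parKnapsack, Prog.law_bind, pexp_bind _ _ (IsBdd.of_finite f)]
    refine pexp_congr fun Sm _ => ?_
    rw [dif_pos h, Prog.law_ask_bind, Prog.law_bind, Prog.law_draw,
      pexp_bind _ _ (IsBdd.of_finite f), pexp_sampleSubset hp0 hp1]
    refine bernSum_congr fun H _ => ?_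
    rw [Prog.law_bind, pexp_bind _ _ (IsBdd.of_finite f)]
    change pexp ((threshRuns c B (α * (Fintype.card V : ℝ) * (g {x} / B)) (ε / 125)
      ((ε / 125) ^ 2)⁻¹ ⌈(ε / 125)⁻¹ * Real.log (Fintype.card V : ℝ)⌉₊
      ⌈(ε / 125)⁻¹ * Real.log (ε / 125)⁻¹⌉₊ H).law f) (fun L =>
        pexp ((bestOf (insert {x} (insert Sm L.toFinset)) (Finset.insert_nonempty _ _)).law f) f) =
      _
    rw [hgx x hxm]
    refine pexp_congr fun L _ => ?_
    rw [pexp_bestOf]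
    rfl

theorem setCost_smallSet_le {c : V → ℝ} {B : ℝ} (hB : 0 < B) {S : Finset V}
    (hS : S ⊆ smallSet c B) : setCost c S ≤ B := by
  rcases isEmpty_or_nonempty V with h | h
  · rw [Subsingleton.elim S ∅, setCost_empty]
    exact hB.le
  · have hn : (0 : ℝ) < Fintype.card V := by exact_mod_cast Fintype.card_pos
    calc setCost c S ≤ ∑ _x ∈ S, B / (Fintype.card V : ℝ) :=
          Finset.sum_le_sum fun x hx => (Finset.mem_filter.1 (hS hx)).2.le
      _ = S.card * (B / (Fintype.card V : ℝ)) := by rw [Finset.sum_const, nsmul_eq_mul]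
      _ ≤ (Fintype.card V : ℝ) * (B / (Fintype.card V : ℝ)) :=
          mul_le_mul_of_nonneg_right (by exact_mod_cast Finset.card_le_univ S) (by positivity)
      _ = B := by field_simp

theorem le_cost_of_mem_largeSet {c : V → ℝ} {B : ℝ} {x : V} (hx : x ∈ largeSet c B) :
    B / (Fintype.card V : ℝ) ≤ c x := by
  simpa [largeSet, smallSet] using hx

/-- The output is feasible, and the rounds and queries are those of the subroutine and of the
parallel runs. -/
theorem mem_support_parKnapsack {f : Finset V → ℝ} (hf0 : ∀ S, 0 ≤ f S) (hf : IsSubmodular f)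
    {c : V → ℝ} (hc : ∀ x, 0 < c x) {B ε α p : ℝ} (hB : 0 < B) (hcB : ∀ x, c x ≤ B)
    (hα : 0 ≤ α) (hε0 : 0 < ε) (hε : ε < 1) {sub : ℝ → Finset V → Prog V (Finset V)}
    (hsub : ∀ o ∈ ((sub (ε / 125) (smallSet c B)).run f).support, o.out ⊆ smallSet c B)
    {k r t : ℕ} (hk : k = ⌈(ε / 125)⁻¹ * Real.log (Fintype.card V : ℝ)⌉₊)
    (hr : r = ⌈(ε / 125)⁻¹ * Real.log (ε / 125)⁻¹⌉₊)
    (ht : (1 - ε / 125) ^ t * (Fintype.card V : ℝ) ^ 2 < 1)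
    {o : Outcome (Finset V)} (ho : o ∈ ((parKnapsack sub c ε α p B).run f).support) :
    setCost c o.out ≤ B ∧ ∃ o₁ ∈ ((sub (ε / 125) (smallSet c B)).run f).support,
      o.rounds ≤ o₁.rounds + (t + ⌈((ε / 125) ^ 2)⁻¹⌉₊ + 3) ∧
      o.queries ≤ o₁.queries + (Fintype.card V + ((k + 1) * r *
        ((t + ⌈((ε / 125) ^ 2)⁻¹⌉₊) * (Fintype.card V * Fintype.card V) + Fintype.card V) +
        ((k + 1) * r + 2))) := by
  set δ := ε / 125 with hδ
  have hδ0 : 0 < δ := by positivity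
  have hδ1 : δ < 1 := by rw [hδ]; linarith
  rw [parKnapsack, Prog.mem_support_run_bind] at ho
  obtain ⟨o₁, ho₁, o₂, ho₂, rfl⟩ := ho
  have hSm : setCost c o₁.out ≤ B := setCost_smallSet_le hB (hsub o₁ ho₁)
  by_cases h : (largeSet c B).Nonempty
  · rw [dif_pos h, Prog.mem_support_run_ask_bind] at ho₂
    obtain ⟨o₃, ho₃, rfl⟩ := ho₂
    rw [Prog.mem_support_run_draw_bind] at ho₃
    obtain ⟨H, hH, ho₃⟩ := ho₃
    have hHl := sampleSubset_subset hH
    rw [Prog.mem_support_run_bind] at ho₃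
    obtain ⟨o₄, ho₄, o₅, ho₅, rfl⟩ := ho₃
    rw [bestOf, Prog.mem_support_run_ask_bind] at ho₅
    obtain ⟨o₆, ho₆, rfl⟩ := ho₅
    rw [Prog.mem_support_run_ret] at ho₆
    subst ho₆
    dsimp only at ho₄ ⊢
    set g : Finset V → ℝ := fun S => if S ∈ (largeSet c B).image fun x => ({x} : Finset V) then f S
      else 0 with hg
    set x := maximizer (fun y => g {y}) (largeSet c B) h with hx
    have hxm : x ∈ largeSet c B := maximizer_mem _ _ _
    have hgx : g {x} = f {x} := if_pos (Finset.mem_image_of_mem _ hxm)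
    change o₄ ∈ ((threshRuns c B (α * (Fintype.card V : ℝ) * (g {x} / B)) δ
      (δ ^ 2)⁻¹ ⌈δ⁻¹ * Real.log (Fintype.card V : ℝ)⌉₊ ⌈δ⁻¹ * Real.log δ⁻¹⌉₊ H).run f).support
      at ho₄
    rw [hgx, ← hk, ← hr] at ho₄
    have hn : (0 : ℝ) < Fintype.card V := by
      exact_mod_cast Fintype.card_pos_iff.2 ⟨x⟩
    have hτ0 : 0 ≤ α * (Fintype.card V : ℝ) * (f {x} / B) := by
      have := hf0 {x}
      positivity
    set τ₀ := α * (Fintype.card V : ℝ) * (f {x} / B) with hτ₀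
    have hrun : ∀ τ, (threshSeq c H τ δ (δ ^ 2)⁻¹ B).run f =
        (threshSeq c H τ δ (δ ^ 2)⁻¹ B).run (zeroAtEmpty f) := fun τ =>
      run_threshSeq_congr (fun T hT => (zeroAtEmpty_of_ne f hT).symm) c H τ δ _ B
    have hout := mem_support_parAll (p := fun S => setCost c S ≤ B) _ (fun P hP o ho => by
      obtain ⟨i, -, rfl⟩ := threshRuns_mem_list hP
      rw [hrun] at ho
      exact (threshSeq_union_le (zeroAtEmpty_nonneg hf0) (hf.zeroAtEmpty hf0)
        (zeroAtEmpty_empty f) hc hB.le hcB (mul_nonneg hτ0 (pow_nonneg (by linarith) i))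
        hδ0 hδ1.le ho).2.1) ho₄
    have hlen : ((List.range (k + 1)).flatMap fun i => List.replicate r
        (threshSeq c H (τ₀ * (1 - δ) ^ i) δ (δ ^ 2)⁻¹ B)).length = (k + 1) * r := by
      simp [List.length_flatMap]
    have hrounds := rounds_parAll (R := t + ⌈(δ ^ 2)⁻¹⌉₊ + 1) (Q := (t + ⌈(δ ^ 2)⁻¹⌉₊) *
        (Fintype.card V * Fintype.card V) + Fintype.card V) _ (fun P hP o ho => by
      obtain ⟨i, -, rfl⟩ := threshRuns_mem_list hP
      rw [hrun] at ho
      refine rounds_threshSeq (zeroAtEmpty_empty f) hc (b := B / Fintype.card V) hB.le hcB hδ1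
        (fun y hy => le_cost_of_mem_largeSet (hHl hy)) ?_ ho
      -- Initially `c(X) ≤ nB`, and a single large element costs at least `B/n`; this is the source
      -- of the factor `n²` in the condition on `t`.
      have h1 : setCost c H ≤ Fintype.card V * B := by
        calc setCost c H ≤ ∑ _x ∈ H, B := Finset.sum_le_sum fun x _ => hcB x
          _ = H.card * B := by rw [Finset.sum_const, nsmul_eq_mul]
          _ ≤ _ := mul_le_mul_of_nonneg_right (by exact_mod_cast Finset.card_le_univ H) hB.le
      have h2 : 0 ≤ (1 - δ) ^ t := pow_nonneg (by linarith) t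
      rw [lt_div_iff₀ hn]
      calc (1 - δ) ^ t * setCost c H * Fintype.card V ≤
            (1 - δ) ^ t * (Fintype.card V * B) * Fintype.card V := by gcongr
        _ = ((1 - δ) ^ t * (Fintype.card V : ℝ) ^ 2) * B := by ring
        _ < 1 * B := mul_lt_mul_of_pos_right ht hB
        _ = B := one_mul B) ho₄
    rw [hlen] at hrounds hout
    refine ⟨?_, o₁, ho₁, ?_, ?_⟩
    · have h1 := maximizer_mem (fun S => if S ∈ insert {x} (insert o₁.out o₄.out.toFinset) then f S
        else 0) _ (Finset.insert_nonempty {x} (insert o₁.out o₄.out.toFinset))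
      change setCost c (maximizer (fun S => if S ∈ insert {x} (insert o₁.out o₄.out.toFinset)
        then f S else 0) _ (Finset.insert_nonempty {x} (insert o₁.out o₄.out.toFinset))) ≤ B
      rw [Finset.mem_insert, Finset.mem_insert, List.mem_toFinset] at h1
      rcases h1 with h1 | h1 | h1
      · rw [h1, setCost, Finset.sum_singleton]
        exact hcB x
      · rw [h1]
        exact hSm
      · exact hout.1 _ h1
    -- The three extra rounds are the singletons queried for `x*`, the initial filter of
    -- `ThreshSeq`, and the final comparison.
    · have := hrounds.1
      omega
    · have h1 := hrounds.2
      have h2 : ((largeSet c B).image fun x => ({x} : Finset V)).card ≤ Fintype.card V :=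
        Finset.card_image_le.trans (Finset.card_le_univ _)
      have h3 : (insert {x} (insert o₁.out o₄.out.toFinset)).card ≤ (k + 1) * r + 2 := by
        refine (Finset.card_insert_le _ _).trans ?_
        have h4 := Finset.card_insert_le o₁.out o₄.out.toFinset
        have h5 := List.toFinset_card_le o₄.out
        rw [hout.2] at h5
        omega
      change o₁.queries + (((largeSet c B).image fun x => ({x} : Finset V)).card + (o₄.queries +
        ((insert {x} (insert o₁.out o₄.out.toFinset)).card + 0))) ≤ _
      omega
  · rw [dif_neg h, Prog.mem_support_run_ret] at ho₂
    subst ho₂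
    exact ⟨hSm, o₁, ho₁, by dsimp only; omega, by dsimp only; omega⟩

theorem one_sub_pow_le_exp {δ : ℝ} (hδ : δ ≤ 1) (t : ℕ) : (1 - δ) ^ t ≤ Real.exp (-(δ * t)) := by
  calc (1 - δ) ^ t ≤ Real.exp (-δ) ^ t :=
        pow_le_pow_left₀ (by linarith) (by linarith [Real.add_one_le_exp (-δ)]) t
    _ = Real.exp (-(δ * t)) := by rw [← Real.exp_nat_mul]; congr 1; ring

/-- The value of the union of two sets is at most the sum of the values. -/
theorem IsSubmodular.le_add_of_zero {f : Finset V → ℝ} (hf : IsSubmodular f) (h0 : f ∅ = 0)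
    {S T U : Finset V} (hST : Disjoint S T) (hU : U = S ∪ T) : f U ≤ f S + f T := by
  obtain ⟨φ, h1, h2, -⟩ := exists_additive_le hf h0 U
  subst hU
  rw [← h1, Finset.sum_union hST]
  exact add_le_add (h2 S Finset.subset_union_left) (h2 T Finset.subset_union_right)

/-- The approximation guarantee. -/
theorem le_expectedValue_parKnapsack {f : Finset V → ℝ} (hf0 : ∀ S, 0 ≤ f S) (hf : IsSubmodular f)
    {c : V → ℝ} (hc : ∀ x, 0 < c x) {B ε : ℝ} (hB : 0 < B) (hcB : ∀ x, c x ≤ B)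
    (hε0 : 0 < ε) (hε : ε < 1 / 3) {sub : ℝ → Finset V → Prog V (Finset V)}
    (hsub : ∀ T ⊆ smallSet c B, f T ≤ (2 + ε / 125) *
      (sub (ε / 125) (smallSet c B)).expectedValue f) {T : Finset V} (hT : setCost c T ≤ B) :
    f T ≤ (9.465 + ε) *
      (parKnapsack sub c ε (2 - √3) ((1 - (2 - √3)) / 2) B).expectedValue f := by
  simp only [Prog.expectedValue_eq] at hsub ⊢
  set δ := ε / 125 with hδ
  have hεδ : ε = 125 * δ := by rw [hδ]; ring
  have hδ0 : 0 < δ := by positivity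
  have hδ1 : δ < 1 / 375 := by rw [hδ]; linarith
  have hs1 : 1.732050 ≤ √3 := Real.le_sqrt_of_sq_le (by norm_num)
  have hs2 : √3 ≤ 1.732051 := Real.sqrt_le_iff.2 ⟨by norm_num, by norm_num⟩
  set α := 2 - √3 with hα
  set p := (1 - α) / 2 with hp
  have hα1 : 0.26794 ≤ α := by rw [hα]; linarith
  have hp1 : 0.36602 ≤ p := by rw [hp, hα]; linarith
  have hp2 : p ≤ 0.36603 := by rw [hp, hα]; linarith
  set y := pexp ((sub δ (smallSet c B)).law f) f with hy
  have hy0 : 0 ≤ y := le_pexp (IsBdd.of_finite f) fun S _ => hf0 S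
  by_cases h : (largeSet c B).Nonempty
  · obtain ⟨x, hxm, hmax, he⟩ := pexp_parKnapsack (f := f) c (ε := ε) (α := α) (B := B) sub
      (by linarith : 0 ≤ p) (by linarith) h
    rw [he, ← hδ]
    set n : ℝ := (Fintype.card V : ℝ) with hn
    have hn0 : 0 < n := by rw [hn]; exact_mod_cast Fintype.card_pos_iff.2 ⟨x⟩
    have hn1 : 1 ≤ n := by rw [hn]; exact_mod_cast Fintype.card_pos_iff.2 ⟨x⟩
    set k := ⌈δ⁻¹ * Real.log n⌉₊ with hk
    set r := ⌈δ⁻¹ * Real.log δ⁻¹⌉₊ with hr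
    have hkn : (1 - δ) ^ k * n ≤ 1 := by
      have h1 : Real.log n ≤ δ * k := by
        have := mul_le_mul_of_nonneg_left (Nat.le_ceil (δ⁻¹ * Real.log n)) hδ0.le
        rwa [← mul_assoc, mul_inv_cancel₀ hδ0.ne', one_mul] at this
      have h2 := (one_sub_pow_le_exp (by linarith : δ ≤ 1) k).trans
        (Real.exp_le_exp.2 (neg_le_neg h1))
      rw [Real.exp_neg, Real.exp_log hn0] at h2
      calc (1 - δ) ^ k * n ≤ n⁻¹ * n := mul_le_mul_of_nonneg_right h2 hn0.le
        _ = 1 := inv_mul_cancel₀ hn0.ne'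
    have hrδ : (1 - δ) ^ r ≤ δ := by
      have h1 : Real.log δ⁻¹ ≤ δ * r := by
        have := mul_le_mul_of_nonneg_left (Nat.le_ceil (δ⁻¹ * Real.log δ⁻¹)) hδ0.le
        rwa [← mul_assoc, mul_inv_cancel₀ hδ0.ne', one_mul] at this
      have h2 := (one_sub_pow_le_exp (by linarith : δ ≤ 1) r).trans
        (Real.exp_le_exp.2 (neg_le_neg h1))
      rwa [Real.exp_neg, Real.exp_log (inv_pos.2 hδ0), inv_inv] at h2
    set O := T ∩ largeSet c B with hO
    have hp4 : 0 < (1 - δ) ^ 4 := pow_pos (by linarith) 4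
    have hp4' : (1 - δ) ^ 4 ≤ 1 := pow_le_one₀ (by linarith) (by linarith)
    set a : Finset V → Finset V → ℝ := fun Sm H =>
      pexp ((threshRuns c B (α * n * (f {x} / B)) δ (δ ^ 2)⁻¹ k r H).law f)
        (bestValue f x Sm) with ha
    -- Conditionally on the small set, `max (f {x}) (f Sm)` is a lower bound for every sample, and
    -- the loss `(1-δ)⁻⁴` is absorbed by rescaling `a`.
    have hstep : ∀ Sm : Finset V, zeroAtEmpty f O + 2 * f Sm ≤
        (6 + 2 * √3) / (1 - δ) ^ 4 * bernSum p (largeSet c B) (a Sm) := by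
      intro Sm
      have hax : ∀ H, f {x} ≤ a Sm H := fun H =>
        le_pexp (isBdd_bestValue f x Sm) fun L _ => singleton_le_bestValue
      have hay : ∀ H, f Sm ≤ a Sm H := fun H =>
        le_pexp (isBdd_bestValue f x Sm) fun L _ => small_le_bestValue
      have hle : ∀ H, a Sm H ≤ a Sm H / (1 - δ) ^ 4 := fun H => by
        rw [le_div_iff₀ hp4]
        exact mul_le_of_le_one_right ((hf0 _).trans (hax H)) hp4'
      have h1 := le_bernSum_sample (f := zeroAtEmpty f) (zeroAtEmpty_nonneg hf0)
        (hf.zeroAtEmpty hf0) (zeroAtEmpty_empty f) hc (n := n) (x := f {x})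
        (w := max (f {x}) (f Sm)) (α := α) (p := p) (O := O) (L := largeSet c B)
        (a := fun H => a Sm H / (1 - δ) ^ 4) hB hn0 hα1 hp1 hp2
        Finset.inter_subset_right
        (fun o ho => (zeroAtEmpty_le hf0 _).trans (hmax o (Finset.mem_inter.1 ho).2))
        (fun o ho => le_cost_of_mem_largeSet (Finset.mem_inter.1 ho).2)
        ((setCost_mono hc Finset.inter_subset_left).trans hT)
        (by rw [hn]; exact_mod_cast Finset.card_le_univ O) (hf0 _) (le_max_left _ _)
        (fun H _ => (max_le (hax H) (hay H)).trans (hle H))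
        (fun κ hκ0 hκ1 H _ => by
          have h2 := threshRuns_capped_or_saturated hf0 hf hc (σ := 1 - κ) (n := n) hB hcB
            (by linarith : 0 ≤ α) (by linarith) hn0 hδ0 (by linarith) (by linarith) (by linarith)
            hrδ hkn x Sm H (a := a Sm H) rfl
          rw [sub_sub_cancel] at h2
          exact h2)
      have h2 : (bernSum p (largeSet c B) fun H => a Sm H / (1 - δ) ^ 4) =
          1 / (1 - δ) ^ 4 * bernSum p (largeSet c B) (a Sm) := by
        rw [← bernSum_const_mul]
        exact bernSum_congr fun H _ => by ring
      rw [h2] at h1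
      have h3 := le_max_right (f {x}) (f Sm)
      calc zeroAtEmpty f O + 2 * f Sm ≤ zeroAtEmpty f O + 2 * max (f {x}) (f Sm) := by linarith
        _ ≤ _ := h1
        _ = _ := by ring
    set E := pexp ((sub δ (smallSet c B)).law f) fun Sm => bernSum p (largeSet c B) (a Sm) with hE
    have hE0 : 0 ≤ E := le_pexp (IsBdd.of_finite _) fun Sm _ => by
      have : bernSum p (largeSet c B) (fun _ => (0 : ℝ)) ≤ bernSum p (largeSet c B) (a Sm) :=
        bernSum_mono (by linarith) (by linarith) fun H _ =>
          (hf0 {x}).trans (le_pexp (isBdd_bestValue f x Sm) fun L _ => singleton_le_bestValue)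
      rwa [bernSum_const] at this
    have hmain : zeroAtEmpty f O + 2 * y ≤ (6 + 2 * √3) / (1 - δ) ^ 4 * E := by
      have h1 : zeroAtEmpty f O + 2 * pexp ((sub δ (smallSet c B)).law f) f =
          pexp ((sub δ (smallSet c B)).law f) fun Sm => zeroAtEmpty f O + 2 * f Sm := by
        rw [pexp_add _ (isBdd_const _) (IsBdd.of_finite _), pexp_const, pexp_const_mul]
      rw [hy, h1, hE, ← pexp_const_mul]
      exact pexp_mono (IsBdd.of_finite _) (IsBdd.of_finite _) fun Sm _ => hstep Sm
    -- If `O` is empty, `T` itself is compared with the small set; this also covers `T = ∅` with `f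
    -- ∅ > 0`, which `zeroAtEmpty f` would not see.
    have hOPT : f T ≤ (2 + δ) * y + zeroAtEmpty f O := by
      by_cases hOe : O = ∅
      · rw [hOe, zeroAtEmpty_empty, add_zero]
        refine hsub T fun o ho => ?_
        by_contra hos
        have : o ∈ O := Finset.mem_inter.2 ⟨ho, by simp [largeSet, hos]⟩
        rw [hOe] at this
        exact absurd this (Finset.notMem_empty o)
      · have hTne : T ≠ ∅ := fun h => hOe (by rw [hO, h, Finset.empty_inter])
        have h1 := (hf.zeroAtEmpty hf0).le_add_of_zero (zeroAtEmpty_empty f) (S := T \ O) (T := O)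
          (U := T) Finset.sdiff_disjoint (Finset.sdiff_union_of_subset Finset.inter_subset_left).symm
        rw [zeroAtEmpty_of_ne f hTne] at h1
        have h2 := hsub (T \ O) fun o ho => by
          rw [Finset.mem_sdiff] at ho
          by_contra hos
          exact ho.2 (Finset.mem_inter.2 ⟨ho.1, by simp [largeSet, hos]⟩)
        linarith [zeroAtEmpty_le hf0 (T \ O)]
    have hz := zeroAtEmpty_nonneg hf0 O
    have h1 : f T ≤ (1 + δ / 2) * ((6 + 2 * √3) / (1 - δ) ^ 4 * E) := by
      have h2 := mul_le_mul_of_nonneg_left hmain (by linarith : 0 ≤ 1 + δ / 2)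
      have h3 : 0 ≤ δ / 2 * zeroAtEmpty f O := by positivity
      linarith
    -- The first-order loss is `9.4641 · (1/2 + 4) δ`, about `43 δ`, well below `ε = 125 δ`.
    have h4 : (1 + δ / 2) * ((6 + 2 * √3) / (1 - δ) ^ 4) ≤ 9.465 + ε := by
      rw [← mul_div_assoc, div_le_iff₀ hp4]
      have h5 : 1 - 4 * δ ≤ (1 - δ) ^ 4 := by
        have := one_add_mul_le_pow (by linarith : (-2 : ℝ) ≤ -δ) 4
        norm_num at this
        linarith [show (1 + -δ) ^ 4 = (1 - δ) ^ 4 by ring]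
      have h6 := mul_le_mul_of_nonneg_left h5 (by linarith : 0 ≤ 9.465 + ε)
      have h7 := mul_le_mul_of_nonneg_left hs2 (by linarith : 0 ≤ 1 + δ / 2)
      rw [hεδ] at h6 ⊢
      nlinarith
    calc f T ≤ (1 + δ / 2) * ((6 + 2 * √3) / (1 - δ) ^ 4 * E) := h1
      _ = (1 + δ / 2) * ((6 + 2 * √3) / (1 - δ) ^ 4) * E := by ring
      _ ≤ (9.465 + ε) * E := mul_le_mul_of_nonneg_right h4 hE0
  · have he : pexp ((parKnapsack sub c ε α p B).law f) f = y := by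
      rw [parKnapsack, Prog.law_bind, pexp_bind _ _ (IsBdd.of_finite f)]
      refine pexp_congr fun Sm _ => ?_
      rw [dif_neg h, Prog.law_ret, pexp_pure]
    rw [he]
    rw [Finset.not_nonempty_iff_eq_empty] at h
    have h1 := hsub T fun o _ => by
      by_contra hos
      have : o ∈ largeSet c B := by simp [largeSet, hos]
      rw [h] at this
      exact absurd this (Finset.notMem_empty o)
    exact h1.trans (mul_le_mul_of_nonneg_right (by linarith) hy0)

end Knapsack

end

noncomputable section

/-! ### Explicit bounds for rounds and queries. -/

section Counts

theorem one_sub_pow_mul_sq_lt_one {δ : ℝ} (hδ0 : 0 < δ) (hδ1 : δ ≤ 1) (m : ℕ) :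
    (1 - δ) ^ (⌊2 * Real.log m / δ⌋₊ + 1) * (m : ℝ) ^ 2 < 1 := by
  rcases Nat.eq_zero_or_pos m with rfl | hm
  · simp
  have hm' : (0 : ℝ) < m := by exact_mod_cast hm
  have h1 : 2 * Real.log m < δ * ((⌊2 * Real.log m / δ⌋₊ + 1 : ℕ) : ℝ) := by
    have := Nat.lt_floor_add_one (2 * Real.log m / δ)
    rw [div_lt_iff₀ hδ0] at this
    push_cast
    linarith
  have h2 := (one_sub_pow_le_exp hδ1 (⌊2 * Real.log m / δ⌋₊ + 1)).trans_lt
    (Real.exp_lt_exp.2 (neg_lt_neg h1))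
  have h3 : Real.exp (-(2 * Real.log m)) = ((m : ℝ) ^ 2)⁻¹ := by
    rw [Real.exp_neg, two_mul, Real.exp_add, Real.exp_log hm', sq]
  rw [h3] at h2
  calc _ < ((m : ℝ) ^ 2)⁻¹ * (m : ℝ) ^ 2 := mul_lt_mul_of_pos_right h2 (by positivity)
    _ = 1 := inv_mul_cancel₀ (by positivity)

/-- Bounds for the number of rounds and queries of the parallel runs. -/
theorem count_bounds {m : ℕ} {ε : ℝ} (hε0 : 0 < ε) (hε : ε < 1 / 3) (hm : (2 : ℝ) ≤ m) {W : ℝ}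
    (hW : W = 1 / ε * Real.log m + 1 / ε ^ 2) {k r t l : ℕ}
    (hk : k = ⌈(ε / 125)⁻¹ * Real.log m⌉₊) (hr : r = ⌈(ε / 125)⁻¹ * Real.log (ε / 125)⁻¹⌉₊)
    (ht : t = ⌊2 * Real.log m / (ε / 125)⌋₊ + 1) (hl : l = ⌈((ε / 125) ^ 2)⁻¹⌉₊) :
    (1 : ℝ) ≤ 1 / ε * Real.log m ∧ 1 ≤ Real.log (1 / ε) * (1 / ε) ∧
    ((t + l + 3 : ℕ) : ℝ) ≤ 10 ^ 5 * W ∧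
    ((m + ((k + 1) * r * ((t + l) * (m * m) + m) + ((k + 1) * r + 2)) : ℕ) : ℝ) ≤
      10 ^ 11 * (m ^ 2 / ε ^ 2 * Real.log m * Real.log (1 / ε) * W) := by
  set u := 1 / ε * Real.log m with hu
  set lam := Real.log (1 / ε) with hlam
  have hi : 3 < 1 / ε := by rw [lt_div_iff₀ hε0]; linarith
  have hi2 : 9 ≤ 1 / ε ^ 2 := by
    have : 1 / ε ^ 2 = (1 / ε) * (1 / ε) := by field_simp
    rw [this]; nlinarith
  have hlog2 : 0.69 ≤ Real.log m := by
    have h1 := Real.log_two_gt_d9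
    have h2 := Real.log_le_log (by norm_num) hm
    linarith
  have hu2 : 2 ≤ u := by rw [hu]; nlinarith
  have hlam1 : 1 ≤ lam := by
    rw [hlam, Real.le_log_iff_exp_le (by positivity)]
    linarith [Real.exp_one_lt_d9]
  have hX1 : 1 ≤ lam * (1 / ε) := by nlinarith
  have hinv : (ε / 125)⁻¹ = 125 * (1 / ε) := by field_simp
  have hkle : ((k : ℝ) + 1) ≤ 126 * u := by
    have h1 : 0 ≤ (ε / 125)⁻¹ * Real.log m := by rw [hinv]; positivity
    have h2 := (Nat.ceil_lt_add_one h1).le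
    rw [← hk, hinv, mul_assoc, ← hu] at h2
    linarith
  -- Here `15626 = 125² + 1`: `log 125 ≤ 124` and `lam ≥ 1` give `log (125/ε) ≤ 125 lam`, and the
  -- rounding of the ceiling is absorbed by `lam/ε ≥ 1`.
  have hrle : (r : ℝ) ≤ 15626 * (lam * (1 / ε)) := by
    have h0 : Real.log (ε / 125)⁻¹ = Real.log 125 + lam := by
      rw [hinv, Real.log_mul (by norm_num) (by positivity)]
    have h3 : Real.log 125 ≤ 124 := by
      have := Real.log_le_sub_one_of_pos (show (0 : ℝ) < 125 by norm_num)
      linarith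
    have h3' : 0 ≤ Real.log 125 := Real.log_nonneg (by norm_num)
    have h1 : 0 ≤ (ε / 125)⁻¹ * Real.log (ε / 125)⁻¹ := by rw [h0, hinv]; positivity
    have h2 := (Nat.ceil_lt_add_one h1).le
    rw [← hr, h0, hinv] at h2
    have h4 : Real.log 125 + lam ≤ 125 * lam := by linarith
    have h5 := mul_le_mul_of_nonneg_left h4 (by positivity : 0 ≤ 125 * (1 / ε))
    linarith
  have htl : (t : ℝ) + l ≤ 15626 * W := by
    have h1 : (t : ℝ) ≤ 250 * u + 1 := by
      have h0 : 2 * Real.log m / (ε / 125) = 250 * u := by rw [hu]; field_simp; norm_num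
      rw [ht, h0]
      push_cast
      linarith [Nat.floor_le (by positivity : 0 ≤ 250 * u)]
    have h2 : (l : ℝ) ≤ 15625 * (1 / ε ^ 2) + 1 := by
      have h0 : ((ε / 125) ^ 2)⁻¹ = 15625 * (1 / ε ^ 2) := by field_simp; norm_num
      rw [hl, h0]
      exact (Nat.ceil_lt_add_one (by positivity)).le
    rw [hW]; linarith
  have hW1 : 11 ≤ W := by rw [hW]; linarith
  refine ⟨by linarith, hX1, by push_cast; linarith, ?_⟩
  set X := u * (lam * (1 / ε)) with hX
  have hX1' : 1 ≤ X := one_le_mul_of_one_le_of_one_le (by linarith) hX1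
  have hN : 126 * 15626 = (1968876 : ℝ) := by norm_num
  have hkr : ((k : ℝ) + 1) * r ≤ 1968876 * X := by
    have := mul_le_mul hkle hrle (Nat.cast_nonneg r) (by linarith : 0 ≤ 126 * u)
    rw [hX]; linarith
  have hm2 : (m : ℝ) ≤ (m : ℝ) ^ 2 := by nlinarith
  set Y := (m : ℝ) ^ 2 * W with hY
  have hY1 : (m : ℝ) ^ 2 ≤ Y := le_mul_of_one_le_right (by positivity) (by linarith)
  have hm4 : (4 : ℝ) ≤ (m : ℝ) ^ 2 := by nlinarith
  have hY4 : 4 ≤ Y := hm4.trans hY1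
  have h1 : ((t : ℝ) + l) * (m * m) + m ≤ 15627 * Y := by
    have := mul_le_mul_of_nonneg_right htl (by positivity : (0 : ℝ) ≤ m * m)
    have e : 15626 * W * ((m : ℝ) * m) = 15626 * Y := by rw [hY]; ring
    linarith
  have h2 : ((k : ℝ) + 1) * r * (((t : ℝ) + l) * (m * m) + m) ≤ 1968876 * X * (15627 * Y) :=
    mul_le_mul hkr h1 (by positivity) (by positivity)
  have hXY : X ≤ X * Y := le_mul_of_one_le_right (by linarith) (by linarith)
  have hXY' : Y ≤ X * Y := le_mul_of_one_le_left (by linarith) hX1'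
  have e : (m : ℝ) ^ 2 / ε ^ 2 * Real.log m * lam * W = X * Y := by
    rw [hX, hY, hu]; field_simp
  rw [e]
  push_cast
  linarith

end Counts

end

/-! ### The theorem. -/

theorem theorem3p5 :
    ∃ C : ℝ, 0 < C ∧
      ∀ (R Q : ℝ → ℝ) (ε : ℝ), 0 < ε → ε < 1 / 3 →
      ∃ n₀ : ℕ,
      ∀ (V : Type) [Fintype V] [DecidableEq V]
        (f : Finset V → ℝ) (c : V → ℝ) (B : ℝ)
        (SubmodMax : ℝ → Finset V → Prog V (Finset V)),
        (∀ S, 0 ≤ f S) → IsSubmodular f →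
        0 < B → (∀ x, 0 < c x ∧ c x ≤ B) →
        IsSubmodMax f SubmodMax R Q →
        ∀ (n α : ℝ) (P : Prog V (Finset V)),
        n = Fintype.card V → α = 2 - √3 →
        P = parKnapsack SubmodMax c ε α ((1 - α) / 2) B →
        -- the output is feasible, and its expected value approximates the optimum
        (∀ o ∈ (P.run f).support, setCost c o.out ≤ B) ∧
        (∀ T : Finset V, setCost c T ≤ B → f T ≤ (9.465 + ε) * P.expectedValue f) ∧
        -- bounds for all `n ≥ 2`
        (2 ≤ n →
          P.RoundsLE f (C * (1 / ε * Real.log n + 1 / ε ^ 2) + R (ε / 125)) ∧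
          P.QueriesLE f
            (C * (n ^ 2 / ε ^ 2 * Real.log n * Real.log (1 / ε)
                * (1 / ε * Real.log n + 1 / ε ^ 2)) + Q (ε / 125) * n)) ∧
        -- the asymptotic bounds, for fixed `ε` and `n → ∞`, with an absolute constant
        (n₀ ≤ n →
          P.RoundsLE f (C * (1 / ε * Real.log n)) ∧
          P.QueriesLE f (C * (n ^ 2 / ε ^ 3 * Real.log n ^ 2 * Real.log (1 / ε)))) := by
  refine ⟨10 ^ 12, by norm_num, fun R Q ε hε0 hε => ?_⟩
  -- The first term makes `(1/ε) log n` dominate both `1/ε²` and the rounds of the subroutine, the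
  -- second makes its queries at most `n²`, and the last guarantees `n ≥ 2`.
  refine ⟨⌈Real.exp (ε * (1 / ε ^ 2 + |R (ε / 125)|))⌉₊ + ⌈|Q (ε / 125)|⌉₊ + 2, ?_⟩
  intro V _ _ f c B sub hf0 hf hB hc hsub n α P hn hα hP
  subst hn hα hP
  have hc0 : ∀ x, 0 < c x := fun x => (hc x).1
  have hcB : ∀ x, c x ≤ B := fun x => (hc x).2
  have hδ0 : 0 < ε / 125 := by positivity
  have hδ1 : ε / 125 < 1 := by linarith
  obtain ⟨hsub1, hsub2, hsub3, hsub4⟩ := hsub (ε / 125) hδ0 hδ1 (smallSet c B)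
  have hα0 : (0 : ℝ) ≤ 2 - √3 := by
    have : √3 ≤ 2 := Real.sqrt_le_iff.2 ⟨by norm_num, by norm_num⟩
    linarith
  have hsupp := fun o ho => mem_support_parKnapsack (p := (1 - (2 - √3)) / 2) hf0 hf hc0 hB hcB hα0
    hε0 (by linarith) hsub1 rfl rfl (one_sub_pow_mul_sq_lt_one hδ0 hδ1.le (Fintype.card V))
    (o := o) ho
  refine ⟨fun o ho => (hsupp o ho).1,
    fun T hT => le_expectedValue_parKnapsack hf0 hf hc0 hB hcB hε0 hε hsub2 hT, fun h2 => ?_,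
    fun hn0 => ?_⟩
  · obtain ⟨hu1, hX1, hb1, hb2⟩ := count_bounds hε0 hε h2 rfl rfl rfl rfl rfl
    set W := 1 / ε * Real.log (Fintype.card V) + 1 / ε ^ 2 with hW
    have hW0 : 0 ≤ W := by rw [hW]; positivity
    refine ⟨fun o ho => ?_, fun o ho => ?_⟩
    · obtain ⟨-, o₁, ho₁, h3, -⟩ := hsupp o ho
      have h4 : (o.rounds : ℝ) ≤ _ := Nat.cast_le.2 h3
      rw [Nat.cast_add] at h4
      have h5 := hsub3 o₁ ho₁
      linarith
    · obtain ⟨-, o₁, ho₁, -, h3⟩ := hsupp o ho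
      have h4 : (o.queries : ℝ) ≤ _ := Nat.cast_le.2 h3
      rw [Nat.cast_add] at h4
      have h5 := hsub4 o₁ ho₁
      have h6 : 0 ≤ (Fintype.card V : ℝ) ^ 2 / ε ^ 2 * Real.log (Fintype.card V) *
          Real.log (1 / ε) * W := by
        have := (Nat.cast_nonneg (α := ℝ) _).trans hb2
        linarith
      linarith
  · push_cast at hn0
    have hexp := Nat.le_ceil (Real.exp (ε * (1 / ε ^ 2 + |R (ε / 125)|)))
    have hQ := Nat.le_ceil |Q (ε / 125)|
    have hQ0 := abs_nonneg (Q (ε / 125))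
    have hexp0 := Real.exp_pos (ε * (1 / ε ^ 2 + |R (ε / 125)|))
    have h2 : (2 : ℝ) ≤ (Fintype.card V : ℝ) := by linarith
    have hnpos : (0 : ℝ) < (Fintype.card V : ℝ) := by linarith
    have hlog : ε * (1 / ε ^ 2 + |R (ε / 125)|) ≤ Real.log (Fintype.card V) := by
      rw [Real.le_log_iff_exp_le hnpos]
      linarith
    obtain ⟨hu1, hX1, hb1, hb2⟩ := count_bounds hε0 hε h2 rfl rfl rfl rfl rfl
    set u := 1 / ε * Real.log (Fintype.card V) with hu
    have hRu : 1 / ε ^ 2 + |R (ε / 125)| ≤ u := by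
      have := mul_le_mul_of_nonneg_left hlog (by positivity : 0 ≤ 1 / ε)
      have e : 1 / ε * (ε * (1 / ε ^ 2 + |R (ε / 125)|)) = 1 / ε ^ 2 + |R (ε / 125)| := by
        field_simp
      rwa [e] at this
    have hR := le_abs_self (R (ε / 125))
    have hR0 := abs_nonneg (R (ε / 125))
    have hε2 : 0 ≤ 1 / ε ^ 2 := by positivity
    refine ⟨fun o ho => ?_, fun o ho => ?_⟩
    · obtain ⟨-, o₁, ho₁, h3, -⟩ := hsupp o ho
      have h4 : (o.rounds : ℝ) ≤ _ := Nat.cast_le.2 h3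
      rw [Nat.cast_add] at h4
      have h5 := hsub3 o₁ ho₁
      linarith
    · obtain ⟨-, o₁, ho₁, -, h3⟩ := hsupp o ho
      have h4 : (o.queries : ℝ) ≤ _ := Nat.cast_le.2 h3
      rw [Nat.cast_add] at h4
      have h5 := hsub4 o₁ ho₁
      set N := (Fintype.card V : ℝ) with hN
      set Z := N ^ 2 * u * (Real.log (1 / ε) * (1 / ε)) with hZ
      have e1 : N ^ 2 / ε ^ 2 * Real.log N * Real.log (1 / ε) * (u + 1 / ε ^ 2) =
          Z * (u + 1 / ε ^ 2) := by
        rw [hZ, hu]; field_simp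
      have e2 : N ^ 2 / ε ^ 3 * Real.log N ^ 2 * Real.log (1 / ε) = Z * u := by
        rw [hZ, hu]; field_simp
      rw [e1] at hb2
      rw [e2]
      have hZN : N ^ 2 ≤ Z := by
        rw [hZ, mul_assoc]
        exact le_mul_of_one_le_right (by positivity) (one_le_mul_of_one_le_of_one_le hu1 hX1)
      have hZ0 : 0 ≤ Z := (sq_nonneg N).trans hZN
      have hZu : Z ≤ Z * u := le_mul_of_one_le_right hZ0 hu1
      have hQN : Q (ε / 125) * N ≤ N ^ 2 := by
        rw [sq]
        exact mul_le_mul_of_nonneg_right ((le_abs_self _).trans (by linarith)) hnpos.le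
      have h6 : Z * (u + 1 / ε ^ 2) ≤ Z * (2 * u) :=
        mul_le_mul_of_nonneg_left (by linarith) hZ0
      linarith
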